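/- Let $n\ge 1$ and let $(M,\omega)$ be an $n$-plectic manifold: $M$ is a (finite dimensional) smooth manifold and $\omega\in\Omega^{n+1}(M)$ is a closed form such that $T_mM\to\Lambda^nT_m^*M$, $v\mapsto i_v\omega_m$, is injective for every $m\in M$. Multivector fields are smooth sections of $\Lambda^\bullet TM$, with $i_{v_1\wedge\dots\wedge v_r}=i_{v_r}\cdots i_{v_1}$, with $L_X\alpha=d\,i_X\alpha-(-1)^{r}i_Xd\alpha$ for $X$ of tensor degree $r$, and with the Schouten bracket $[\cdot,\cdot]$ (the graded antisymmetric extension of the Lie bracket with $[X,Y\wedge Z]=[X,Y]\wedge Z+(-1)^{(|X|-1)|Y|}Y\wedge[X,Z]$). For a form $f$, a multivector field $X$ with $i_X\omega=-df$ is called an associated semi-Hamiltonian multivector field, and a multivector field $Y$ with $i_Y\omega=-f$ an associated Hamiltonian multivector field; $f$ is Hamiltonian if it has both, and $H(M)$ is the vector space of Hamiltonian forms. It is graded by $\deg f=n-r$ for $f$ of tensor degree $r$. Put $e(f)=(-1)^{\deg f}$, $e(f,g)=(-1)^{\deg f\deg g}$, let $e(s;f_1,f_2,f_3)$ be the Koszul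 sign of a permutation $s$, defined by $f_1\otimes f_2\otimes f_3=e(s;f_1,f_2,f_3)\,f_{s_1}\otimes f_{s_2}\otimes f_{s_3}$, and let $Sh(p,q)$ be the set of permutations $s$ of $\{1,\dots,p+q\}$ with $s_1<\dots<s_p$ and $s_{p+1}<\dots<s_{p+q}$. Define $D_1f=-df$ and, for homogeneous $f_i\in H(M)$ with associated semi-Hamiltonian multivector fields $X_i$, $$D_2(f_1,f_2)=e(f_1)L_{X_1}f_2+e(f_1,f_2)e(f_2)L_{X_2}f_1,$$ $$D_3(f_1,f_2,f_3)=-\tfrac12\sum_{s\in Sh(2,1)}e(s;f_1,f_2,f_3)\,e(f_{s_1})e(f_{s_2})\,i_{X_{D_2}(f_{s_1},f_{s_2})}f_{s_3},$$ where $X_{D_2}(f_i,f_j)$ denotes any semi-Hamiltonian multivector field associated to $D_2(f_i,f_j)$; both are extended multilinearly to $H(M)$. Then $D_2(f_1,f_2)$ is a well defined Hamiltonian form, one choice of $X_{D_2}(f_1,f_2)$ being $-2e(f_1)[X_2,X_1]$, and $D_3$ is a well defined (that is, independent of the choice of the fields $X_{D_2}$) trilinear operator $H(M)\times H(M)\times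 H(M)\to H(M)$, which is graded symmetric, i.e. $D_3(f_1,f_2,f_3)=e(s;f_1,f_2,f_3)D_3(f_{s_1},f_{s_2},f_{s_3})$ for every permutation $s$ and homogeneous $f_i$, and homogeneous of degree $-1$. For all homogeneous $f_1,f_2,f_3\in H(M)$ the strong homotopy Jacobi equation in dimension three holds: $$D_1D_3(f_1,f_2,f_3)+\sum_{s\in Sh(1,2)}e(s;f_1,f_2,f_3)D_3(D_1f_{s_1},f_{s_2},f_{s_3})+\sum_{s\in Sh(2,1)}e(s;f_1,f_2,f_3)D_2(D_2(f_{s_1},f_{s_2}),f_{s_3})=0.$$ If $Y_1,Y_2,Y_3$ are associated Hamiltonian and $X_1,X_2,X_3$ associated semi-Hamiltonian multivector fields of $f_1,f_2,f_3$, and the $X_{D_2}(f_i,f_j)$ are any semi-Hamiltonian multivector fields associated to $D_2(f_i,f_j)$, then $$-\tfrac12\sum_{s\in Sh(2,1)}e(s;f_1,f_2,f_3)\,e(f_{s_1})e(f_{s_2})\,Y_{s_3}\wedge X_{D_2}(f_{s_1},f_{s_2})$$ is a Hamiltonian multivector field associated to $D_3(f_1,f_2,f_3)$, and $$\sum_{s\in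 Sh(1,2)}e(s;f_1,f_2,f_3)\,e(f_{s_2})\,[[X_{s_3},X_{s_2}],Y_{s_1}]+\tfrac12\sum_{s\in Sh(2,1)}e(s;f_1,f_2,f_3)\,X_{s_3}\wedge X_{D_2}(f_{s_1},f_{s_2})$$ is a semi-Hamiltonian multivector field associated to $D_3(f_1,f_2,f_3)$. -/

import Mathlib

open scoped Manifold

namespace NPlectic

noncomputable section

section Fibre

variable (V : Type*) [AddCommGroup V] [Module ℝ V] [TopologicalSpace V]

/-- The fibre `⨁ₖ Λᵏ V*` of differential forms of arbitrary (also mixed) tensor degree: a family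
of alternating `k`-linear forms, `k = 0, 1, 2, …` (for `k > dim V` they all vanish). -/
abbrev Alt : Type _ := ∀ k : ℕ, V [⋀^Fin k]→L[ℝ] ℝ

variable {V}

/-- Insertion of a vector in the first slot: `(v₁, …, vₖ) ↦ α (v, v₁, …, vₖ)`. -/
def insertFirst {k : ℕ} (v : V) (α : V [⋀^Fin (k + 1)]→L[ℝ] ℝ) : V [⋀^Fin k]→L[ℝ] ℝ :=
  { α.toAlternatingMap.curryLeft v with
    cont := α.cont.comp (Continuous.matrixVecCons continuous_const continuous_id) }

theorem insertFirst_apply {k : ℕ} (v : V) (α : V [⋀^Fin (k + 1)]→L[ℝ] ℝ) (w : Fin k → V) :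
    insertFirst v α w = α (Matrix.vecCons v w) := rfl

/-- The contraction `i_v` along a vector, acting on forms of all degrees (it kills `0`-forms), as
a linear map in `v`. -/
def contractVec [IsTopologicalAddGroup V] [ContinuousConstSMul ℝ V] :
    V →ₗ[ℝ] Module.End ℝ (Alt V) where
  toFun v :=
    { toFun := fun α k => insertFirst v (α (k + 1))
      map_add' := fun α β => by funext k; ext w; simp [insertFirst_apply]
      map_smul' := fun c α => by funext k; ext w; simp [insertFirst_apply] }
  map_add' v v' := by
    ext α k w
    change (α (k + 1)) (Matrix.vecCons (v + v') w)
      = (α (k + 1)) (Matrix.vecCons v w) + (α (k + 1)) (Matrix.vecCons v' w)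
    exact (α (k + 1)).toAlternatingMap.map_vecCons_add w v v'
  map_smul' c v := by
    ext α k w
    change (α (k + 1)) (Matrix.vecCons (c • v) w) = c • (α (k + 1)) (Matrix.vecCons v w)
    exact (α (k + 1)).toAlternatingMap.map_vecCons_smul w c v

theorem contractVec_contractVec [IsTopologicalAddGroup V] [ContinuousConstSMul ℝ V] (v : V) :
    contractVec v * contractVec v = 0 := by
  ext α k w
  change (α (k + 1 + 1)) (Matrix.vecCons v (Matrix.vecCons v w)) = 0
  exact (α (k + 1 + 1)).toAlternatingMap.map_eq_zero_of_eq _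
    (i := 0) (j := 1) (by simp) (by simp)

/-- Contraction along multivectors: the algebra homomorphism into the opposite of the endomorphism
algebra, so `i_{X ∧ Y} = i_Y ∘ i_X` and `i_{v₁ ∧ … ∧ vᵣ} = i_{vᵣ} ∘ … ∘ i_{v₁}`. -/
def contractAlg [IsTopologicalAddGroup V] [ContinuousConstSMul ℝ V] :
    ExteriorAlgebra ℝ V →ₐ[ℝ] (Module.End ℝ (Alt V))ᵐᵒᵖ :=
  ExteriorAlgebra.lift ℝ
    ⟨(MulOpposite.opLinearEquiv ℝ).toLinearMap ∘ₗ contractVec, fun v => by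
      simp [← MulOpposite.op_mul, contractVec_contractVec]⟩

/-- The contraction `i_X α` of a form `α` along a multivector `X`. -/
def contractPt [IsTopologicalAddGroup V] [ContinuousConstSMul ℝ V]
    (X : ExteriorAlgebra ℝ V) (α : Alt V) : Alt V :=
  (contractAlg X).unop α

theorem contractPt_add_left [IsTopologicalAddGroup V] [ContinuousConstSMul ℝ V] (X Y : ExteriorAlgebra ℝ V) (α : Alt V) :
    contractPt (X + Y) α = contractPt X α + contractPt Y α := by
  simp [contractPt]

theorem contractPt_smul_left [IsTopologicalAddGroup V] [ContinuousConstSMul ℝ V] (c : ℝ) (X : ExteriorAlgebra ℝ V)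
    (α : Alt V) : contractPt (c • X) α = c • contractPt X α := by
  simp [contractPt]

end Fibre

section Manifold

variable (E : Type*) [NormedAddCommGroup E] [NormedSpace ℝ E]
variable (M : Type*) [TopologicalSpace M] [ChartedSpace E M]

/-- (Not necessarily smooth, not necessarily homogeneous) differential forms on `M`. -/
abbrev FormField : Type _ := ∀ x : M, Alt (TangentSpace 𝓘(ℝ, E) x)

/-- (Not necessarily smooth, not necessarily homogeneous) multivector fields on `M`, sections of
the exterior algebra bundle of `TM`. The pointwise product is the wedge product. -/
abbrev MVField : Type _ := ∀ x : M, ExteriorAlgebra ℝ (TangentSpace 𝓘(ℝ, E) x)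

variable {E M}

/-- The differential at `p` of the chart around `x₀`, with `T E` identified with `E`. -/
def chartDeriv (x₀ p : M) : TangentSpace 𝓘(ℝ, E) p →L[ℝ] E :=
  mfderiv 𝓘(ℝ, E) 𝓘(ℝ, E) (chartAt E x₀) p

/-- The differential at `y` of the inverse of the chart around `x₀`. -/
def chartSymmDeriv (x₀ : M) (y : E) : E →L[ℝ] TangentSpace 𝓘(ℝ, E) ((chartAt E x₀).symm y) :=
  mfderiv 𝓘(ℝ, E) 𝓘(ℝ, E) (chartAt E x₀).symm y

/-- The degree `k` part of a form in the chart around `x₀`: its pullback along the inverse of the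
chart. Only its values on the target of the chart matter. -/
def formInChart (x₀ : M) (α : FormField E M) (k : ℕ) (y : E) : E [⋀^Fin k]→L[ℝ] ℝ :=
  (α ((chartAt E x₀).symm y) k).compContinuousLinearMap (chartSymmDeriv x₀ y)

/-- Smoothness of a form: it is smooth in charts. -/
def SmoothForm (α : FormField E M) : Prop :=
  ∀ (x₀ : M) (k : ℕ), ContDiffOn ℝ (⊤ : ℕ∞) (formInChart x₀ α k) (chartAt E x₀).target

/-- A multivector field in the chart around `x₀`: its pushforward along the chart. Only its values
on the target of the chart matter. -/
def mvInChart (x₀ : M) (X : MVField E M) (y : E) : ExteriorAlgebra ℝ E :=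
  ExteriorAlgebra.map (chartDeriv x₀ ((chartAt E x₀).symm y)).toLinearMap
    (X ((chartAt E x₀).symm y))

/-- The exterior derivative, computed at `x` in the chart around `x`. -/
def extD (α : FormField E M) : FormField E M
  | _, 0 => 0
  | x, k + 1 =>
    (extDeriv (formInChart x α k) (chartAt E x x)).compContinuousLinearMap (chartDeriv x x)

/-- The contraction `i_X α`. -/
def contract (X : MVField E M) (α : FormField E M) : FormField E M :=
  fun x => contractPt (X x) (α x)

/-- The Lie derivative along a multivector field, `L_X α = d i_X α - (-1)ʳ i_X d α` for `X` of
tensor degree `r`; the grade involution of the exterior algebra is multiplication by `(-1)ʳ` in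
degree `r`. -/
def lieD (X : MVField E M) (α : FormField E M) : FormField E M :=
  extD (contract X α) - contract (fun x => CliffordAlgebra.involute (X x)) (extD α)

/-- `f` is homogeneous of symmetric degree `a`, i.e. only its part of tensor degree `k` with
`n - k = a` may be nonzero. -/
def HasDeg (n : ℕ) (a : ℤ) (f : FormField E M) : Prop :=
  ∀ (x : M) (k : ℕ), (n : ℤ) - k ≠ a → f x k = 0

/-- The homogeneous component of tensor degree `k`. -/
def component (k : ℕ) (f : FormField E M) : FormField E M := fun x => Pi.single k (f x k)

/-- `(M, ω)` is an `n`-plectic manifold. -/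
structure IsNPlectic (n : ℕ) (ω : FormField E M) : Prop where
  one_le : 1 ≤ n
  smooth : SmoothForm ω
  degree : ∀ (x : M) (k : ℕ), k ≠ n + 1 → ω x k = 0
  closed : extD ω = 0
  nondegenerate : ∀ x : M, Function.Injective
    fun v : TangentSpace 𝓘(ℝ, E) x => contractPt (ExteriorAlgebra.ι ℝ v) (ω x)

theorem formInChart_add (x₀ : M) (α β : FormField E M) (k : ℕ) :
    formInChart x₀ (α + β) k = formInChart x₀ α k + formInChart x₀ β k := by
  funext y; ext v; rfl

theorem formInChart_smul (x₀ : M) (c : ℝ) (α : FormField E M) (k : ℕ) :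
    formInChart x₀ (c • α) k = c • formInChart x₀ α k := by
  funext y; ext v; rfl

theorem SmoothForm.differentiableAt {α : FormField E M} (h : SmoothForm α) (x : M) (k : ℕ) :
    DifferentiableAt ℝ (formInChart x α k) (chartAt E x x) :=
  ((h x k).differentiableOn (by simp)).differentiableAt
    ((chartAt E x).open_target.mem_nhds (mem_chart_target E x))

theorem extD_add {α β : FormField E M} (hα : SmoothForm α) (hβ : SmoothForm β) :
    extD (α + β) = extD α + extD β := by
  funext x k
  cases k with
  | zero => simp [extD]
  | succ k =>
    ext v
    simp [extD, formInChart_add, extDeriv_add (hα.differentiableAt x k) (hβ.differentiableAt x k)]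

theorem extD_smul (c : ℝ) (α : FormField E M) : extD (c • α) = c • extD α := by
  funext x k
  cases k with
  | zero => simp [extD]
  | succ k =>
    ext v
    simp [extD, formInChart_smul, extDeriv_smul]

theorem SmoothForm.add {α β : FormField E M} (hα : SmoothForm α) (hβ : SmoothForm β) :
    SmoothForm (α + β) := fun x₀ k => by
  rw [formInChart_add]; exact (hα x₀ k).add (hβ x₀ k)

theorem SmoothForm.smul (c : ℝ) {α : FormField E M} (hα : SmoothForm α) :
    SmoothForm (c • α) := fun x₀ k => by
  rw [formInChart_smul]; exact (hα x₀ k).const_smul c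

theorem smoothForm_zero : SmoothForm (0 : FormField E M) := fun x₀ k => by
  have h : formInChart x₀ (0 : FormField E M) k = fun _ => 0 := by funext y; ext v; rfl
  rw [h]; exact contDiffOn_const

variable [FiniteDimensional ℝ E]

variable (E) in
/-- The basis `e_{i₁} ∧ … ∧ e_{iᵣ}`, `i₁ < … < iᵣ`, of the exterior algebra of the model space. -/
def extBasis : Module.Basis (Finset (Fin (Module.finrank ℝ E))) ℝ (ExteriorAlgebra ℝ E) :=
  (Module.finBasis ℝ E).ExteriorAlgebra

/-- Smoothness of a multivector field: its coefficients in charts are smooth. -/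
def SmoothMV (X : MVField E M) : Prop :=
  ∀ (x₀ : M) (S : Finset (Fin (Module.finrank ℝ E))),
    ContDiffOn ℝ (⊤ : ℕ∞) (fun y => (extBasis E).repr (mvInChart x₀ X y) S) (chartAt E x₀).target

/-- The coefficientwise partial derivative `∂ᵢ Z` of a multivector field on the model space. -/
def partialMV (Z : E → ExteriorAlgebra ℝ E) (y : E) (i : Fin (Module.finrank ℝ E)) :
    ExteriorAlgebra ℝ E :=
  ∑ S, (fderiv ℝ (fun z => (extBasis E).repr (Z z) S) y (Module.finBasis ℝ E i)) • extBasis E S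

/-- The Schouten bracket on the model space,
`[Z, W] = ∑ᵢ (Z ⌊ dxⁱ) ∧ ∂ᵢW - ∂ᵢZ ∧ (dxⁱ ⌋ W)`, where `dxⁱ ⌋` and `⌊ dxⁱ` are the left and the
right interior products with the `i`-th coordinate form. On vector fields it is the Lie bracket, it
satisfies `[Z, U ∧ W] = [Z, U] ∧ W + (-1)^((|Z| - 1)|U|) U ∧ [Z, W]`, and
`[Z, W] = -(-1)^((|Z| - 1)(|W| - 1)) [W, Z]`. -/
def schoutenModel (Z W : E → ExteriorAlgebra ℝ E) (y : E) : ExteriorAlgebra ℝ E :=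
  ∑ i, (CliffordAlgebra.contractRight (Z y) ((Module.finBasis ℝ E).coord i) * partialMV W y i
    - partialMV Z y i * CliffordAlgebra.contractLeft ((Module.finBasis ℝ E).coord i) (W y))

/-- The Schouten bracket of multivector fields on `M`, computed at `x` in the chart around `x`. -/
def schouten (X Y : MVField E M) : MVField E M := fun x =>
  ExteriorAlgebra.map (ContinuousLinearMap.inverse (chartDeriv x x)).toLinearMap
    (schoutenModel (mvInChart x X) (mvInChart x Y) (chartAt E x x))

/-- `X` is a semi-Hamiltonian multivector field associated to `f`: `i_X ω = -df`. -/
def IsSemiHam (ω : FormField E M) (X : MVField E M) (f : FormField E M) : Prop :=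
  SmoothMV X ∧ contract X ω = -extD f

/-- `Y` is a Hamiltonian multivector field associated to `f`: `i_Y ω = -f`. -/
def IsHam (ω : FormField E M) (Y : MVField E M) (f : FormField E M) : Prop :=
  SmoothMV Y ∧ contract Y ω = -f

theorem SmoothMV.add {X Y : MVField E M} (hX : SmoothMV X) (hY : SmoothMV Y) :
    SmoothMV (X + Y) := fun x₀ S => by
  simpa [mvInChart] using (hX x₀ S).add (hY x₀ S)

theorem SmoothMV.smul (c : ℝ) {X : MVField E M} (hX : SmoothMV X) :
    SmoothMV (c • X) := fun x₀ S => by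
  simpa [mvInChart] using (hX x₀ S).const_smul c

theorem IsSemiHam.add {ω f g : FormField E M} {X Y : MVField E M} (hf : SmoothForm f)
    (hg : SmoothForm g) (hX : IsSemiHam ω X f) (hY : IsSemiHam ω Y g) :
    IsSemiHam ω (X + Y) (f + g) := by
  refine ⟨hX.1.add hY.1, ?_⟩
  rw [extD_add hf hg, neg_add, ← hX.2, ← hY.2]
  funext x
  exact contractPt_add_left _ _ _

theorem IsSemiHam.smul (c : ℝ) {ω f : FormField E M} {X : MVField E M} (hX : IsSemiHam ω X f) :
    IsSemiHam ω (c • X) (c • f) := by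
  refine ⟨hX.1.smul c, ?_⟩
  rw [extD_smul, show -(c • extD f) = c • -extD f from (smul_neg c (extD f)).symm, ← hX.2]
  funext x
  exact contractPt_smul_left _ _ _

theorem IsHam.add {ω f g : FormField E M} {X Y : MVField E M} (hX : IsHam ω X f)
    (hY : IsHam ω Y g) : IsHam ω (X + Y) (f + g) := by
  refine ⟨hX.1.add hY.1, ?_⟩
  rw [neg_add, ← hX.2, ← hY.2]
  funext x
  exact contractPt_add_left _ _ _

theorem IsHam.smul (c : ℝ) {ω f : FormField E M} {X : MVField E M} (hX : IsHam ω X f) :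
    IsHam ω (c • X) (c • f) := by
  refine ⟨hX.1.smul c, ?_⟩
  rw [show -(c • f) = c • -f from (smul_neg c f).symm, ← hX.2]
  funext x
  exact contractPt_smul_left _ _ _

theorem smoothMV_zero : SmoothMV (0 : MVField E M) := fun x₀ S => by
  simpa [mvInChart] using contDiffOn_const

/-- The space `H(M)` of Hamiltonian forms: smooth forms with an associated semi-Hamiltonian and an
associated Hamiltonian multivector field. -/
def hamForms (ω : FormField E M) : Submodule ℝ (FormField E M) where
  carrier := {f | SmoothForm f ∧ (∃ X, IsSemiHam ω X f) ∧ ∃ Y, IsHam ω Y f}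
  add_mem' := by
    rintro f g ⟨hf, ⟨X, hX⟩, Y, hY⟩ ⟨hg, ⟨X', hX'⟩, Y', hY'⟩
    exact ⟨hf.add hg, ⟨_, hX.add hf hg hX'⟩, _, hY.add hY'⟩
  zero_mem' := by
    have h0 : contract (0 : MVField E M) ω = 0 := by
      funext x; simpa [contract] using contractPt_smul_left (0 : ℝ) 0 (ω x)
    have hd : extD (0 : FormField E M) = 0 := by simpa using extD_smul (0 : ℝ) (0 : FormField E M)
    exact ⟨smoothForm_zero, ⟨0, smoothMV_zero, by rw [h0, hd, neg_zero]⟩,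
      0, smoothMV_zero, by rw [h0, neg_zero]⟩
  smul_mem' := by
    rintro c f ⟨hf, ⟨X, hX⟩, Y, hY⟩
    exact ⟨hf.smul c, ⟨_, hX.smul c⟩, _, hY.smul c⟩

/-- `(-1)ᵃ`. With `a = deg f` this is `e(f)`, with `a = deg f * deg g` it is `e(f, g)`. -/
def sgn (a : ℤ) : ℝ := (a.negOnePow : ℤ)

/-- The Koszul sign `e(s; v₁, …, vₘ)` of a permutation `s` and vectors of degrees `a₁, …, aₘ`,
defined by `v₁ ⊗ … ⊗ vₘ = e(s; v₁, …, vₘ) v_{s₁} ⊗ … ⊗ v_{sₘ}`: one factor `(-1)^(a_{sᵢ} a_{sⱼ})`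
for every inversion of `s`. -/
def koszul {m : ℕ} (s : Equiv.Perm (Fin m)) (a : Fin m → ℤ) : ℝ :=
  ∏ i, ∏ j, if i < j ∧ s j < s i then sgn (a (s i) * a (s j)) else 1

/-- The set `Sh(p, q)` of shuffles of `p + q` elements. -/
def shuffles (p q : ℕ) : Finset (Equiv.Perm (Fin (p + q))) :=
  {s | ∀ i j : Fin (p + q), i < j → ((j : ℕ) < p ∨ p ≤ (i : ℕ)) → s i < s j}

open Classical in
/-- A choice of a semi-Hamiltonian multivector field associated to `f`. -/
def someSemiHam (ω f : FormField E M) : MVField E M :=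
  if h : ∃ X, IsSemiHam ω X f then h.choose else 0

/-- The differential `D₁ f = -df`. -/
def D₁ (f : FormField E M) : FormField E M := -extD f

/-- The formula for the bracket `D₂(f₁, f₂)` of forms `f₁`, `f₂` of degrees `a₁`, `a₂`, in terms of
associated semi-Hamiltonian multivector fields `X₁`, `X₂`. -/
def D₂formula (a₁ a₂ : ℤ) (X₁ X₂ : MVField E M) (f₁ f₂ : FormField E M) : FormField E M :=
  sgn a₁ • lieD X₁ f₂ + (sgn (a₁ * a₂) * sgn a₂) • lieD X₂ f₁

/-- The bracket `D₂`: defined on homogeneous forms by the formula above and extended bilinearly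
through the decomposition into homogeneous components. -/
def D₂ (n : ℕ) (ω f₁ f₂ : FormField E M) : FormField E M :=
  ∑ k ∈ Finset.range (Module.finrank ℝ E + 1), ∑ l ∈ Finset.range (Module.finrank ℝ E + 1),
    D₂formula (n - k) (n - l) (someSemiHam ω (component k f₁)) (someSemiHam ω (component l f₂))
      (component k f₁) (component l f₂)

/-- The formula for the bracket `D₃(f₁, f₂, f₃)` of forms `fᵢ` of degrees `aᵢ`, in terms of
semi-Hamiltonian multivector fields `Z i j` associated to the forms `D₂(fᵢ, fⱼ)`. -/
def D₃formula (a : Fin 3 → ℤ) (Z : Fin 3 → Fin 3 → MVField E M) (f : Fin 3 → FormField E M) :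
    FormField E M :=
  (-(1 / 2) : ℝ) • ∑ s ∈ shuffles 2 1,
    (koszul s a * sgn (a (s 0)) * sgn (a (s 1))) • contract (Z (s 0) (s 1)) (f (s 2))

/-- The bracket `D₃`: defined on homogeneous forms by the formula above and extended trilinearly
through the decomposition into homogeneous components. -/
def D₃ (n : ℕ) (ω : FormField E M) (f : Fin 3 → FormField E M) : FormField E M :=
  ∑ k : Fin 3 → Fin (Module.finrank ℝ E + 1),
    D₃formula (fun i => n - (k i : ℕ))
      (fun i j => someSemiHam ω (D₂ n ω (component (k i) (f i)) (component (k j) (f j))))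
      (fun i => component (k i) (f i))

end Manifold

end

end NPlectic

open NPlectic

/-!
A contraction `i_X` commutes up to sign with every other contraction, so on contractions of `ω` it
depends on `i_X ω` only. If `f` is Hamiltonian, `f` and `df` are contractions of `ω`; hence an
associated field may be replaced by any other one, in particular by its part of the right tensor
degree, and `D₂` and `D₃` do not depend on choices.

Everything else is Cartan calculus. Since the Schouten bracket satisfies `i_{[X, Y]} = ±[L_X, i_Y]`,
`dω = 0` yields the fields associated to `D₂(f, g)` and `D₃(f, g, h)`. Expanding the Jacobi equation
with the same formula leaves terms in `i_{X i}`, `i_{X j}` and `d` applied to `f k`, and a field `Z`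
of `D₂(f i, f j)` contracted with `d (f k)` can be evaluated in two ways: by the formula for
`i_{[X j, X i]}`, or by exchanging `Z` with the field of `f k`. Comparing the two closes the
equation.
-/

namespace NPlectic

noncomputable section

open CliffordAlgebra (involute contractLeft contractRight)

/-! ### Signs and contractions in Clifford and exterior algebras -/

section SuperAlgebra

section Clifford

variable {R V : Type*} [CommRing R] [AddCommGroup V] [Module R V] {Q : QuadraticForm R V}

theorem contractLeft_mul (d : Module.Dual R V) (x y : CliffordAlgebra Q) :
    contractLeft d (x * y) = contractLeft d x * y + involute x * contractLeft d y := by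
  induction x using CliffordAlgebra.left_induction generalizing y with
  | algebraMap r => simp [CliffordAlgebra.contractLeft_algebraMap_mul]
  | add a b ha hb => simp only [add_mul, map_add, ha, hb]; abel
  | ι_mul x v hx =>
    rw [mul_assoc, CliffordAlgebra.contractLeft_ι_mul, hx, CliffordAlgebra.contractLeft_ι_mul,
      map_mul, CliffordAlgebra.involute_ι]
    simp only [sub_mul, mul_add, smul_mul_assoc, mul_assoc, neg_mul]
    abel

theorem contractLeft_eq_involute_contractRight (d : Module.Dual R V) (x : CliffordAlgebra Q) :
    contractLeft d x = involute (contractRight x d) := by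
  induction x using CliffordAlgebra.right_induction with
  | algebraMap r => simp
  | add a b ha hb => simp only [map_add, LinearMap.add_apply, ha, hb]
  | mul_ι v x hx =>
    rw [contractLeft_mul, hx, CliffordAlgebra.contractRight_mul_ι, CliffordAlgebra.contractLeft_ι,
      map_sub, map_mul, map_smul, CliffordAlgebra.involute_ι, mul_neg, sub_neg_eq_add,
      Algebra.smul_def, Algebra.commutes, add_comm]

theorem involute_contractRight (d : Module.Dual R V) (x : CliffordAlgebra Q) :
    involute (contractRight x d) = -contractRight (involute x) d := by
  induction x using CliffordAlgebra.right_induction with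
  | algebraMap r => simp
  | add a b ha hb => simp only [map_add, LinearMap.add_apply, ha, hb, neg_add]
  | mul_ι v x hx =>
    simp only [CliffordAlgebra.contractRight_mul_ι, map_sub, map_smul, map_mul, map_neg, hx,
      CliffordAlgebra.involute_ι, mul_neg, neg_mul, LinearMap.neg_apply, neg_neg]

end Clifford

section Exterior

variable {R V W : Type*} [CommRing R] [AddCommGroup V] [Module R V] [AddCommGroup W] [Module R W]

theorem involute_ι (v : V) : involute (ExteriorAlgebra.ι R v) = -ExteriorAlgebra.ι R v :=
  CliffordAlgebra.involute_ι v

theorem map_involute (A : V →ₗ[R] W) (x : ExteriorAlgebra R V) :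
    ExteriorAlgebra.map A (involute x) = involute (ExteriorAlgebra.map A x) := by
  induction x using ExteriorAlgebra.induction with
  | algebraMap r => simp
  | ι v => rw [involute_ι, map_neg, ExteriorAlgebra.map_apply_ι, involute_ι]
  | mul a b ha hb => simp only [map_mul, ha, hb]
  | add a b ha hb => simp only [map_add, ha, hb]

theorem ι_mul_eq_involute_mul_ι (v : V) (x : ExteriorAlgebra R V) :
    ExteriorAlgebra.ι R v * x = involute x * ExteriorAlgebra.ι R v := by
  induction x using ExteriorAlgebra.induction with
  | algebraMap r => simp [Algebra.commutes]
  | ι w =>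
    rw [involute_ι, neg_mul]
    exact eq_neg_of_add_eq_zero_left (ExteriorAlgebra.ι_add_mul_swap v w)
  | mul a b ha hb => rw [← mul_assoc, ha, mul_assoc, hb, map_mul, mul_assoc]
  | add a b ha hb => rw [mul_add, ha, hb, map_add, add_mul]

theorem mul_comm_of_involute_eq {x : ExteriorAlgebra R V} (hx : involute x = x)
    (y : ExteriorAlgebra R V) : y * x = x * y := by
  induction y using ExteriorAlgebra.induction with
  | algebraMap r => exact Algebra.commutes r x
  | ι v => rw [ι_mul_eq_involute_mul_ι, hx]
  | mul a b ha hb => rw [mul_assoc, hb, ← mul_assoc, ha, mul_assoc]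
  | add a b ha hb => rw [add_mul, ha, hb, mul_add]

theorem mul_eq_mul_involute_of_involute_eq_neg {x : ExteriorAlgebra R V} (hx : involute x = -x)
    (y : ExteriorAlgebra R V) : y * x = x * involute y := by
  induction y using ExteriorAlgebra.induction with
  | algebraMap r => simp [Algebra.commutes]
  | ι v => rw [ι_mul_eq_involute_mul_ι, hx, involute_ι, neg_mul, mul_neg]
  | mul a b ha hb => rw [mul_assoc, hb, ← mul_assoc, ha, mul_assoc, map_mul]
  | add a b ha hb => rw [add_mul, ha, hb, map_add, mul_add]

end Exterior

section Sign

theorem sgn_of_even {a : ℤ} (h : Even a) : sgn a = 1 := by simp [sgn, Int.negOnePow_even a h]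

theorem sgn_of_odd {a : ℤ} (h : Odd a) : sgn a = -1 := by simp [sgn, Int.negOnePow_odd a h]

theorem sgn_add (a b : ℤ) : sgn (a + b) = sgn a * sgn b := by simp [sgn, Int.negOnePow_add]

theorem sgn_sub (a b : ℤ) : sgn (a - b) = sgn a * sgn b := by simp [sgn, Int.negOnePow_sub]

theorem sgn_zero : sgn 0 = 1 := by simp [sgn]

theorem sgn_one : sgn 1 = -1 := by simp [sgn]

theorem sgn_natCast (k : ℕ) : sgn k = (-1) ^ k := Int.cast_negOnePow_natCast ℝ k

theorem sgn_eq_one_or_neg_one (a : ℤ) : sgn a = 1 ∨ sgn a = -1 :=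
  (Int.even_or_odd a).imp sgn_of_even sgn_of_odd

theorem sgn_mul_self (a : ℤ) : sgn a * sgn a = 1 := by
  rw [← sgn_add, sgn_of_even (Even.add_self a)]

end Sign

section Parity

variable {V W : Type*} [AddCommGroup V] [Module ℝ V] [AddCommGroup W] [Module ℝ W]

/-- A multivector at a point has the parity of `r` if the grade involution multiplies it by
`(-1)ʳ`; multivectors of tensor degree `r` do. -/
def HasParityPt (r : ℤ) (x : ExteriorAlgebra ℝ V) : Prop := involute x = sgn r • x

protected theorem HasParityPt.mul_comm {x y : ExteriorAlgebra ℝ V} {r s : ℤ} (hx : HasParityPt r x)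
    (hy : HasParityPt s y) : y * x = sgn (r * s) • (x * y) := by
  unfold HasParityPt at hx hy
  rcases Int.even_or_odd r with hr | hr
  · rw [sgn_of_even hr, one_smul] at hx
    rw [sgn_of_even (hr.mul_right s), one_smul, mul_comm_of_involute_eq hx]
  · rw [sgn_of_odd hr, neg_one_smul] at hx
    rw [mul_eq_mul_involute_of_involute_eq_neg hx, hy, mul_smul_comm]
    rcases Int.even_or_odd s with hs | hs
    · rw [sgn_of_even hs, sgn_of_even (hs.mul_left r)]
    · rw [sgn_of_odd hs, sgn_of_odd (hr.mul hs)]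

protected theorem HasParityPt.map {x : ExteriorAlgebra ℝ V} {r : ℤ} (hx : HasParityPt r x)
    (A : V →ₗ[ℝ] W) : HasParityPt r (ExteriorAlgebra.map A x) := by
  rw [HasParityPt, ← map_involute, hx, map_smul]

protected theorem HasParityPt.contractRight {x : ExteriorAlgebra ℝ V} {r : ℤ} (hx : HasParityPt r x)
    (d : Module.Dual ℝ V) : HasParityPt (r + 1) (contractRight x d) := by
  rw [HasParityPt, involute_contractRight, hx, map_smul, LinearMap.smul_apply, sgn_add, sgn_one,
    mul_neg_one, neg_smul]

/-- The projection onto the multivectors with the parity of `t`. -/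
def parityPart (t : ℤ) : ExteriorAlgebra ℝ V →ₗ[ℝ] ExteriorAlgebra ℝ V :=
  (1 / 2 : ℝ) • (LinearMap.id + sgn t • involute.toLinearMap)

theorem hasParityPt_parityPart (t : ℤ) (x : ExteriorAlgebra ℝ V) :
    HasParityPt t (parityPart t x) := by
  simp only [HasParityPt, parityPart, LinearMap.smul_apply, LinearMap.add_apply, LinearMap.id_apply,
    AlgHom.toLinearMap_apply, map_smul, map_add, CliffordAlgebra.involute_involute, smul_add,
    smul_smul, mul_left_comm (sgn t), sgn_mul_self]
  module

theorem parityPart_zero_add_parityPart_one (x : ExteriorAlgebra ℝ V) :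
    parityPart 0 x + parityPart 1 x = x := by
  simp only [parityPart, LinearMap.smul_apply, LinearMap.add_apply, LinearMap.id_apply,
    AlgHom.toLinearMap_apply, sgn_zero, sgn_one]
  module

theorem map_parityPart (A : V →ₗ[ℝ] W) (t : ℤ) (x : ExteriorAlgebra ℝ V) :
    ExteriorAlgebra.map A (parityPart t x) = parityPart t (ExteriorAlgebra.map A x) := by
  simp [parityPart, map_involute]

end Parity

end SuperAlgebra

section Contraction

variable {V W : Type*} [AddCommGroup V] [Module ℝ V] [TopologicalSpace V]
  [AddCommGroup W] [Module ℝ W] [TopologicalSpace W]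

/-- The pullback of forms of all degrees along a linear map. -/
def pullAlt (A : V →L[ℝ] W) (α : Alt W) : Alt V := fun k => (α k).compContinuousLinearMap A

theorem pullAlt_smul (A : V →L[ℝ] W) (c : ℝ) (α : Alt W) :
    pullAlt A (c • α) = c • pullAlt A α := rfl

theorem pullAlt_add (A : V →L[ℝ] W) (α β : Alt W) :
    pullAlt A (α + β) = pullAlt A α + pullAlt A β := rfl

theorem pullAlt_sub (A : V →L[ℝ] W) (α β : Alt W) :
    pullAlt A (α - β) = pullAlt A α - pullAlt A β := rfl

variable [IsTopologicalAddGroup V] [IsTopologicalAddGroup W]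
  [ContinuousConstSMul ℝ V] [ContinuousConstSMul ℝ W]

/-- The contraction `contractPt` as a bilinear map. -/
def contractHom : ExteriorAlgebra ℝ V →ₗ[ℝ] Module.End ℝ (Alt V) :=
  (MulOpposite.opLinearEquiv ℝ).symm.toLinearMap ∘ₗ contractAlg.toLinearMap

theorem contractPt_mul (X Y : ExteriorAlgebra ℝ V) (α : Alt V) :
    contractPt (X * Y) α = contractPt Y (contractPt X α) := by
  simp [contractPt]

theorem contractPt_algebraMap (r : ℝ) (α : Alt V) :
    contractPt (algebraMap ℝ (ExteriorAlgebra ℝ V) r) α = r • α := by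
  rw [contractPt, AlgHom.commutes]; rfl

theorem contractPt_ι (v : V) (α : Alt V) :
    contractPt (ExteriorAlgebra.ι ℝ v) α = contractVec v α := by
  simp [contractPt, contractAlg]

theorem contractVec_apply (v : V) (α : Alt V) (k : ℕ) :
    contractVec v α k = insertFirst v (α (k + 1)) := rfl

theorem contractPt_add (X : ExteriorAlgebra ℝ V) (α β : Alt V) :
    contractPt X (α + β) = contractPt X α + contractPt X β := map_add (contractHom X) α β

theorem contractPt_smul (X : ExteriorAlgebra ℝ V) (c : ℝ) (α : Alt V) :
    contractPt X (c • α) = c • contractPt X α := map_smul (contractHom X) c α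

theorem contractPt_neg (X : ExteriorAlgebra ℝ V) (α : Alt V) :
    contractPt X (-α) = -contractPt X α := map_neg (contractHom X) α

theorem contractPt_zero (X : ExteriorAlgebra ℝ V) : contractPt X (0 : Alt V) = 0 :=
  map_zero (contractHom X)

theorem contractPt_sum {ι : Type*} (s : Finset ι) (X : ExteriorAlgebra ℝ V) (α : ι → Alt V) :
    contractPt X (∑ i ∈ s, α i) = ∑ i ∈ s, contractPt X (α i) := map_sum (contractHom X) α s

theorem contractPt_neg_left (X : ExteriorAlgebra ℝ V) (α : Alt V) :
    contractPt (-X) α = -contractPt X α := LinearMap.map_neg₂ contractHom X α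

theorem contractPt_sub_left (X Y : ExteriorAlgebra ℝ V) (α : Alt V) :
    contractPt (X - Y) α = contractPt X α - contractPt Y α := LinearMap.map_sub₂ contractHom X Y α

theorem contractPt_zero_left (α : Alt V) : contractPt (0 : ExteriorAlgebra ℝ V) α = 0 :=
  LinearMap.map_zero₂ contractHom α

theorem contractPt_sum_left {ι : Type*} (s : Finset ι) (X : ι → ExteriorAlgebra ℝ V) (α : Alt V) :
    contractPt (∑ i ∈ s, X i) α = ∑ i ∈ s, contractPt (X i) α :=
  map_sum (contractHom.flip α) X s

theorem HasParityPt.contractPt_comm {X Y : ExteriorAlgebra ℝ V} {r s : ℤ} (hX : HasParityPt r X)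
    (hY : HasParityPt s Y) (α : Alt V) :
    contractPt X (contractPt Y α) = sgn (r * s) • contractPt Y (contractPt X α) := by
  rw [← contractPt_mul, ← contractPt_mul, hX.mul_comm hY, contractPt_smul_left]

theorem contractVec_pullAlt (A : V →L[ℝ] W) (v : V) (α : Alt W) :
    contractVec v (pullAlt A α) = pullAlt A (contractVec (A v) α) := by
  funext k
  ext w
  change α (k + 1) (A ∘ Matrix.vecCons v w) = α (k + 1) (Matrix.vecCons (A v) (A ∘ w))
  congr 1
  funext i
  refine Fin.cases ?_ (fun i => ?_) i <;> simp

theorem contractPt_pullAlt (A : V →L[ℝ] W) (X : ExteriorAlgebra ℝ V) (α : Alt W) :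
    contractPt X (pullAlt A α)
      = pullAlt A (contractPt (ExteriorAlgebra.map A.toLinearMap X) α) := by
  induction X using ExteriorAlgebra.induction generalizing α with
  | algebraMap r => rw [AlgHom.commutes, contractPt_algebraMap, contractPt_algebraMap, pullAlt_smul]
  | ι v => rw [ExteriorAlgebra.map_apply_ι, contractPt_ι, contractPt_ι, contractVec_pullAlt]; rfl
  | mul a b ha hb => rw [map_mul, contractPt_mul, contractPt_mul, ha, hb]
  | add a b ha hb =>
    rw [map_add, contractPt_add_left, contractPt_add_left, ha, hb, pullAlt_add]

theorem contractPt_apply_zero (X : ExteriorAlgebra ℝ V) (α : Alt V) (w : Fin 0 → V) :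
    contractPt X α 0 w = ExteriorAlgebra.liftAlternating (R := ℝ) (M := V) (N := ℝ)
      (fun k => (α k).toAlternatingMap) X := by
  induction X using CliffordAlgebra.left_induction generalizing α with
  | algebraMap r =>
    rw [contractPt_algebraMap]
    refine Eq.trans ?_ (ExteriorAlgebra.liftAlternating_algebraMap _ r).symm
    rw [Subsingleton.elim w 0]; rfl
  | add a b ha hb =>
    rw [contractPt_add_left, map_add, ← ha, ← hb]; rfl
  | ι_mul x v hx =>
    refine Eq.trans ?_ (ExteriorAlgebra.liftAlternating_ι_mul _ v x).symm
    rw [contractPt_mul, hx, show contractPt (CliffordAlgebra.ι (0 : QuadraticForm ℝ V) v) α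
      = contractVec v α from contractPt_ι v α]
    rfl

end Contraction

section Degree

section Projection

variable {R V W : Type*} [CommRing R] [AddCommGroup V] [Module R V] [AddCommGroup W] [Module R W]

/-- The projection onto the part of degree `a` of the exterior algebra. The index is an integer, as
the tensor degrees that occur below are differences; the projection is zero for negative `a`. -/
def degProj (a : ℤ) : ExteriorAlgebra R V →ₗ[R] ExteriorAlgebra R V :=
  if 0 ≤ a then GradedAlgebra.proj (fun i : ℕ => ⋀[R]^i V) a.toNat else 0

theorem degProj_of_mem {i : ℕ} {x : ExteriorAlgebra R V} (hx : x ∈ ⋀[R]^i V) (a : ℤ) :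
    degProj a x = if (i : ℤ) = a then x else 0 := by
  unfold degProj
  by_cases ha : 0 ≤ a
  · lift a to ℕ using ha
    simp only [Nat.cast_nonneg, if_true, Int.toNat_natCast, Nat.cast_inj, GradedAlgebra.proj_apply]
    by_cases h : i = a
    · subst h; rw [if_pos rfl]; exact DirectSum.decompose_of_mem_same _ hx
    · rw [if_neg h]; exact DirectSum.decompose_of_mem_ne _ hx h
  · rw [if_neg ha, if_neg (by lia)]; rfl

@[elab_as_elim]
theorem exteriorPower_induction {P : ExteriorAlgebra R V → Prop}
    (mem : ∀ (i : ℕ) (x : ExteriorAlgebra R V), x ∈ ⋀[R]^i V → P x)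
    (add : ∀ x y, P x → P y → P (x + y)) (x : ExteriorAlgebra R V) : P x :=
  DirectSum.Decomposition.inductionOn (fun i : ℕ => ⋀[R]^i V) (mem 0 0 (Submodule.zero_mem _))
    (fun m => mem _ m m.2) add x

theorem map_mem_exteriorPower (A : V →ₗ[R] W) {i : ℕ} {x : ExteriorAlgebra R V}
    (hx : x ∈ ⋀[R]^i V) : ExteriorAlgebra.map A x ∈ ⋀[R]^i W := by
  induction hx using Submodule.pow_induction_on_right' with
  | algebraMap r =>
    rw [AlgHom.commutes]
    exact Submodule.mem_one.2 ⟨r, rfl⟩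
  | add x y i _ _ h h' => rw [map_add]; exact add_mem h h'
  | mul_mem i x _ h m hm =>
    obtain ⟨v, rfl⟩ := hm
    rw [map_mul, ExteriorAlgebra.map_apply_ι]
    exact Submodule.mul_mem_mul h ⟨_, rfl⟩

theorem map_degProj (A : V →ₗ[R] W) (a : ℤ) (x : ExteriorAlgebra R V) :
    ExteriorAlgebra.map A (degProj a x) = degProj a (ExteriorAlgebra.map A x) := by
  induction x using exteriorPower_induction with
  | mem i x hx =>
    rw [degProj_of_mem hx, degProj_of_mem (map_mem_exteriorPower A hx)]
    split_ifs <;> simp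
  | add x y hx hy => simp only [map_add, hx, hy]

theorem involute_of_mem_exteriorPower {i : ℕ} {x : ExteriorAlgebra R V} (hx : x ∈ ⋀[R]^i V) :
    involute x = (-1 : R) ^ i • x := by
  induction hx using Submodule.pow_induction_on_right' with
  | algebraMap r => simp
  | add x y i _ _ h h' => rw [map_add, h, h', smul_add]
  | mul_mem i x _ h m hm =>
    obtain ⟨v, rfl⟩ := hm
    rw [map_mul, h, involute_ι, pow_succ, mul_neg_one, neg_smul, smul_mul_assoc, mul_neg, smul_neg]

theorem degProj_degProj (a : ℤ) (x : ExteriorAlgebra R V) :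
    degProj a (degProj a x) = degProj a x := by
  induction x using exteriorPower_induction with
  | mem i x hx =>
    rw [degProj_of_mem hx]
    split_ifs with h
    · rw [degProj_of_mem hx, if_pos h]
    · exact map_zero _
  | add x y hx hy => simp only [map_add, hx, hy]

end Projection

variable {V : Type*} [AddCommGroup V] [Module ℝ V]

theorem hasParityPt_degProj (a : ℤ) (x : ExteriorAlgebra ℝ V) : HasParityPt a (degProj a x) := by
  unfold HasParityPt
  induction x using exteriorPower_induction with
  | mem i x hx =>
    rw [degProj_of_mem hx]
    split_ifs with h
    · rw [involute_of_mem_exteriorPower hx, ← h, sgn_natCast]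
    · rw [map_zero, smul_zero]
  | add x y hx hy => simp only [map_add, hx, hy, smul_add]

variable [TopologicalSpace V]

/-- `α` is homogeneous of tensor degree `m`. -/
def HasTensorDegree (m : ℤ) (α : Alt V) : Prop := ∀ j : ℕ, (j : ℤ) ≠ m → α j = 0

variable [IsTopologicalAddGroup V] [ContinuousConstSMul ℝ V]

theorem contractPt_eq_zero_of_mem {i : ℕ} {x : ExteriorAlgebra ℝ V} (hx : x ∈ ⋀[ℝ]^i V)
    {α : Alt V} {k : ℕ} (hα : α (k + i) = 0) : contractPt x α k = 0 := by
  induction hx using Submodule.pow_induction_on_right' generalizing k with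
  | algebraMap r =>
    rw [contractPt_algebraMap, Pi.smul_apply, show α k = 0 from hα, smul_zero]
  | add x y i _ _ h h' => rw [contractPt_add_left, Pi.add_apply, h hα, h' hα, add_zero]
  | mul_mem i x _ h m hm =>
    obtain ⟨v, rfl⟩ := hm
    rw [contractPt_mul, contractPt_ι, contractVec_apply,
      h (by rwa [show k + 1 + i = k + i.succ by lia])]
    rfl

theorem HasTensorDegree.contractPt_degProj {m : ℤ} {α : Alt V} (hα : HasTensorDegree m α) (a : ℤ)
    (x : ExteriorAlgebra ℝ V) (k : ℕ) :
    contractPt (degProj a x) α k = if k + a = m then contractPt x α k else 0 := by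
  induction x using exteriorPower_induction with
  | mem i x hx =>
    have hzero (h : (k : ℤ) + i ≠ m) : contractPt x α k = 0 :=
      contractPt_eq_zero_of_mem hx (hα _ (by push_cast; exact h))
    rw [degProj_of_mem hx]
    split_ifs with h h' h'
    · rfl
    · exact hzero (by lia)
    · rw [hzero (by lia), contractPt_zero_left]; rfl
    · rw [contractPt_zero_left]; rfl
  | add x y hx hy =>
    rw [map_add, contractPt_add_left, contractPt_add_left, Pi.add_apply, hx, hy, Pi.add_apply]
    split_ifs <;> simp

protected theorem HasTensorDegree.contractPt {m a : ℤ} {α : Alt V} {x : ExteriorAlgebra ℝ V}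
    (hα : HasTensorDegree m α) (hx : degProj a x = x) :
    HasTensorDegree (m - a) (contractPt x α) := fun k hk => by
  rw [← hx, hα.contractPt_degProj, if_neg (by lia)]

theorem HasTensorDegree.contractPt_involute {m : ℤ} {α : Alt V} (hα : HasTensorDegree m α)
    (x : ExteriorAlgebra ℝ V) (k : ℕ) :
    contractPt (involute x) α k = sgn (m - k) • contractPt x α k := by
  induction x using exteriorPower_induction with
  | mem i x hx =>
    rw [involute_of_mem_exteriorPower hx, contractPt_smul_left, Pi.smul_apply, ← sgn_natCast]
    by_cases h : (k : ℤ) + i = m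
    · rw [show m - k = i by lia]
    · rw [contractPt_eq_zero_of_mem hx (hα _ (by push_cast; exact h)), smul_zero, smul_zero]
  | add x y hx hy =>
    rw [map_add, contractPt_add_left, contractPt_add_left, Pi.add_apply, Pi.add_apply, hx, hy,
      smul_add]

theorem HasTensorDegree.contractPt_contractPt_eq_zero {m : ℤ} {α : Alt V}
    (hα : HasTensorDegree m α) {x : ExteriorAlgebra ℝ V} (hx : contractPt x α = 0)
    (y : ExteriorAlgebra ℝ V) : contractPt x (contractPt y α) = 0 := by
  have hinvolute : contractPt (involute x) α = 0 := by
    funext k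
    rw [hα.contractPt_involute, hx, Pi.zero_apply, smul_zero]
  have hpart (t : ℤ) : contractPt (parityPart t x) α = 0 := by
    simp [parityPart, contractPt_smul_left, contractPt_add_left, hx, hinvolute]
  have hcomm (t u : ℤ) : contractPt (parityPart t x) (contractPt (parityPart u y) α) = 0 := by
    rw [(hasParityPt_parityPart t x).contractPt_comm (hasParityPt_parityPart u y), hpart,
      contractPt_zero, smul_zero]
  rw [← parityPart_zero_add_parityPart_one x, ← parityPart_zero_add_parityPart_one y]
  simp only [contractPt_add_left, contractPt_add, hcomm, add_zero]

end Degree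

section Wedge

variable {E : Type*} [NormedAddCommGroup E] [NormedSpace ℝ E]

/-- The left wedge multiplication `φ ∧ α` of forms of all degrees by a covector. -/
def wedgeCov (φ : E →L[ℝ] ℝ) (α : Alt E) : Alt E
  | 0 => 0
  | k + 1 => ContinuousAlternatingMap.alternatizeUncurryFin (φ.smulRight (α k))

theorem wedgeCov_add (φ : E →L[ℝ] ℝ) (α β : Alt E) :
    wedgeCov φ (α + β) = wedgeCov φ α + wedgeCov φ β := by
  funext k
  cases k with
  | zero => simp [wedgeCov]
  | succ k =>
    have h : φ.smulRight (α k + β k) = φ.smulRight (α k) + φ.smulRight (β k) := by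
      ext1 v
      simp
    simp only [wedgeCov, Pi.add_apply, ← ContinuousAlternatingMap.alternatizeUncurryFin_add, ← h]

theorem wedgeCov_smul (φ : E →L[ℝ] ℝ) (c : ℝ) (α : Alt E) :
    wedgeCov φ (c • α) = c • wedgeCov φ α := by
  funext k
  cases k with
  | zero => simp [wedgeCov]
  | succ k =>
    have h : φ.smulRight (c • α k) = c • φ.smulRight (α k) := by
      ext1 v
      simp [smul_comm c]
    simp only [wedgeCov, Pi.smul_apply, ← ContinuousAlternatingMap.alternatizeUncurryFin_smul, ← h]

theorem removeNth_zero_vecCons {X : Type*} {k : ℕ} (v : X) (w : Fin k → X) :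
    Fin.removeNth 0 (Matrix.vecCons v w) = w := Fin.removeNth_zero _

theorem removeNth_succ_vecCons {X : Type*} {k : ℕ} (v : X) (w : Fin (k + 1) → X)
    (i : Fin (k + 1)) :
    Fin.removeNth i.succ (Matrix.vecCons v w) = Matrix.vecCons v (Fin.removeNth i w) := by
  funext j
  refine Fin.cases ?_ (fun j => ?_) j <;> simp [Fin.removeNth, Fin.succ_succAbove_succ]

theorem contractVec_wedgeCov (φ : E →L[ℝ] ℝ) (v : E) (α : Alt E) :
    contractVec v (wedgeCov φ α) + wedgeCov φ (contractVec v α) = φ v • α := by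
  funext k
  ext w
  cases k with
  | zero =>
    simp only [Pi.add_apply, contractVec_apply, wedgeCov, add_zero, insertFirst_apply,
      ContinuousAlternatingMap.alternatizeUncurryFin_apply]
    simp [Subsingleton.elim (Fin.removeNth 0 (Matrix.vecCons v w)) w]
  | succ k =>
    simp only [Pi.add_apply, contractVec_apply, wedgeCov, ContinuousAlternatingMap.add_apply,
      insertFirst_apply, ContinuousAlternatingMap.alternatizeUncurryFin_apply]
    rw [Fin.sum_univ_succ]
    simp only [removeNth_zero_vecCons, removeNth_succ_vecCons, Matrix.cons_val_zero,
      Matrix.cons_val_succ, Fin.val_succ, pow_succ]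
    simp [insertFirst_apply, add_assoc]

theorem wedgeCov_contractPt (φ : E →L[ℝ] ℝ) (X : ExteriorAlgebra ℝ E) (α : Alt E) :
    wedgeCov φ (contractPt X α) = contractPt (involute X) (wedgeCov φ α)
      + contractPt (contractRight X (φ : E →ₗ[ℝ] ℝ)) α := by
  induction X using CliffordAlgebra.right_induction with
  | algebraMap r =>
    rw [AlgHom.commutes, CliffordAlgebra.contractRight_algebraMap, contractPt_zero_left, add_zero]
    refine (congrArg _ (contractPt_algebraMap r α)).trans ?_
    rw [wedgeCov_smul]
    exact (contractPt_algebraMap r _).symm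
  | add a b ha hb =>
    rw [contractPt_add_left, wedgeCov_add, ha, hb, map_add, map_add, LinearMap.add_apply,
      contractPt_add_left, contractPt_add_left]
    abel
  | mul_ι v x hx =>
    have hι (β : Alt E) : contractPt (CliffordAlgebra.ι (0 : QuadraticForm ℝ E) v) β
      = contractVec v β := contractPt_ι v β
    rw [contractPt_mul, hι, eq_sub_of_add_eq' (contractVec_wedgeCov φ v _), hx, map_mul,
      CliffordAlgebra.involute_ι, CliffordAlgebra.contractRight_mul_ι, contractPt_sub_left,
      contractPt_smul_left, contractPt_mul, contractPt_mul, contractPt_neg_left, hι, hι, map_add,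
      ContinuousLinearMap.coe_coe]
    abel

end Wedge

section Faithful

theorem continuous_multilinearMap {V : Type*} [AddCommGroup V] [Module ℝ V] [TopologicalSpace V]
    [IsTopologicalAddGroup V] [ContinuousSMul ℝ V] [T2Space V] [FiniteDimensional ℝ V]
    {ι : Type*} [Finite ι] (g : MultilinearMap ℝ (fun _ : ι => V) ℝ) : Continuous g := by
  classical
  have := Fintype.ofFinite ι
  let b := Module.finBasis ℝ V
  have hg (v : ι → V) : g v = ∑ r : ι → Fin (Module.finrank ℝ V),
      (∏ i, b.repr (v i) (r i)) • g fun i => b (r i) := by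
    conv_lhs => rw [show v = fun i => ∑ j, b.repr (v i) j • b j from
      funext fun i => (b.sum_repr (v i)).symm]
    rw [g.map_sum]
    exact Finset.sum_congr rfl fun r _ => g.map_smul_univ _ _
  rw [funext hg]
  refine continuous_finsetSum _ fun r _ => (continuous_finsetProd _ fun i _ => ?_).mul
    continuous_const
  exact (b.coord (r i)).continuous_of_finiteDimensional.comp (continuous_apply i)

-- By the universal property of the exterior algebra, the degree zero part of the contractions of a
-- multivector computes every linear functional on it.
theorem eq_of_contractPt_apply_zero_eq {V : Type*} [AddCommGroup V] [Module ℝ V]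
    [TopologicalSpace V] [IsTopologicalAddGroup V] [ContinuousSMul ℝ V] [T2Space V]
    [FiniteDimensional ℝ V] {X Y : ExteriorAlgebra ℝ V}
    (h : ∀ α : Alt V, contractPt X α 0 = contractPt Y α 0) : X = Y := by
  rw [← sub_eq_zero, ← Module.forall_dual_apply_eq_zero_iff ℝ]
  intro ℓ
  obtain ⟨g, rfl⟩ := (ExteriorAlgebra.liftAlternatingEquiv (R := ℝ) (M := V) (N := ℝ)).surjective ℓ
  let α : Alt V := fun k => { g k with cont := continuous_multilinearMap (g k).toMultilinearMap }
  have hα := congrArg (fun β => β 0) (h α)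
  simp only [contractPt_apply_zero] at hα
  rw [map_sub, sub_eq_zero]
  exact hα

end Faithful

/-! ### Cartan calculus on the model space -/

section Model

variable {E : Type*} [NormedAddCommGroup E] [NormedSpace ℝ E]

/-- Insertion of a vector in the first slot as a continuous linear map. -/
def insertFirstCLM (k : ℕ) (v : E) : (E [⋀^Fin (k + 1)]→L[ℝ] ℝ) →L[ℝ] (E [⋀^Fin k]→L[ℝ] ℝ) :=
  (ContinuousLinearMap.apply ℝ (E [⋀^Fin k]→L[ℝ] ℝ) v).comp
    (ContinuousAlternatingMap.curryLeftLI (𝕜 := ℝ) (E := E) (F := ℝ)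
      (n := k)).toContinuousLinearMap

/-- Degreewise differentiability of a field of forms of all degrees. -/
def DiffAltAt (α : E → Alt E) (y : E) : Prop := ∀ k, DifferentiableAt ℝ (fun z => α z k) y

/-- Degreewise smoothness of a field of forms of all degrees. -/
def SmoothAltOn (α : E → Alt E) (U : Set E) : Prop :=
  ∀ k, ContDiffOn ℝ (⊤ : ℕ∞) (fun z => α z k) U

/-- The degreewise directional derivative of a field of forms of all degrees. -/
def diffAlt (α : E → Alt E) (y v : E) : Alt E := fun k => fderiv ℝ (fun z => α z k) y v

/-- The exterior derivative of a field of forms of all degrees on the model space. -/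
def modelD (α : E → Alt E) (y : E) : Alt E
  | 0 => 0
  | k + 1 => extDeriv (fun z => α z k) y

theorem SmoothAltOn.diffAltAt {α : E → Alt E} {U : Set E} (h : SmoothAltOn α U) (hU : IsOpen U)
    {y : E} (hy : y ∈ U) : DiffAltAt α y := fun k =>
  ((h k).differentiableOn (by simp)).differentiableAt (hU.mem_nhds hy)

theorem DiffAltAt.contractPt_const (X : ExteriorAlgebra ℝ E) {α : E → Alt E} {y : E}
    (hα : DiffAltAt α y) : DiffAltAt (fun z => contractPt X (α z)) y := by
  induction X using ExteriorAlgebra.induction generalizing α with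
  | algebraMap r =>
    simp only [contractPt_algebraMap]
    exact fun k => (hα k).const_smul r
  | ι w =>
    simp only [contractPt_ι]
    exact fun k => (insertFirstCLM k w).differentiableAt.comp y (hα (k + 1))
  | mul a b ha hb =>
    simp only [contractPt_mul]
    exact hb (ha hα)
  | add a b ha hb =>
    simp only [contractPt_add_left]
    exact fun k => (ha hα k).add (hb hα k)

theorem diffAlt_contractPt_const (X : ExteriorAlgebra ℝ E) {α : E → Alt E} {y : E}
    (hα : DiffAltAt α y) (v : E) :
    diffAlt (fun z => contractPt X (α z)) y v = contractPt X (diffAlt α y v) := by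
  induction X using ExteriorAlgebra.induction generalizing α with
  | algebraMap r =>
    simp only [contractPt_algebraMap]
    funext k
    exact congrArg (· v) (fderiv_fun_const_smul (hα k) r)
  | ι w =>
    simp only [contractPt_ι]
    funext k
    exact congrArg (· v)
      ((insertFirstCLM k w).hasFDerivAt.comp y (hα (k + 1)).hasFDerivAt).fderiv
  | mul a b ha hb => simp only [contractPt_mul, hb (hα.contractPt_const a), ha hα]
  | add a b ha hb =>
    simp only [contractPt_add_left, ← ha hα, ← hb hα]
    funext k
    exact congrArg (· v) (fderiv_fun_add (hα.contractPt_const a k) (hα.contractPt_const b k))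

theorem SmoothAltOn.contractPt_const (X : ExteriorAlgebra ℝ E) {α : E → Alt E} {U : Set E}
    (hα : SmoothAltOn α U) : SmoothAltOn (fun z => contractPt X (α z)) U := by
  induction X using ExteriorAlgebra.induction generalizing α with
  | algebraMap r =>
    simp only [contractPt_algebraMap]
    exact fun k => (hα k).const_smul r
  | ι w =>
    simp only [contractPt_ι]
    exact fun k => (insertFirstCLM k w).contDiff.comp_contDiffOn (hα (k + 1))
  | mul a b ha hb =>
    simp only [contractPt_mul]
    exact hb (ha hα)
  | add a b ha hb =>
    simp only [contractPt_add_left]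
    exact fun k => (ha hα k).add (hb hα k)

variable [FiniteDimensional ℝ E]

/-- Differentiability of the coefficients of a multivector field on the model space. -/
def DiffMVAt (Z : E → ExteriorAlgebra ℝ E) (y : E) : Prop :=
  ∀ S, DifferentiableAt ℝ (fun z => (extBasis E).repr (Z z) S) y

/-- Smoothness of the coefficients of a multivector field on the model space. -/
def SmoothMVOn (Z : E → ExteriorAlgebra ℝ E) (U : Set E) : Prop :=
  ∀ S, ContDiffOn ℝ (⊤ : ℕ∞) (fun z => (extBasis E).repr (Z z) S) U

theorem SmoothMVOn.diffMVAt {Z : E → ExteriorAlgebra ℝ E} {U : Set E} (h : SmoothMVOn Z U)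
    (hU : IsOpen U) {y : E} (hy : y ∈ U) : DiffMVAt Z y := fun S =>
  ((h S).differentiableOn (by simp)).differentiableAt (hU.mem_nhds hy)

theorem linearMap_apply_eq_sum {F : Type*} [AddCommGroup F] [Module ℝ F]
    (T : ExteriorAlgebra ℝ E →ₗ[ℝ] F) (x : ExteriorAlgebra ℝ E) :
    T x = ∑ S, (extBasis E).repr x S • T (extBasis E S) := by
  conv_lhs => rw [← (extBasis E).sum_repr x]
  simp only [map_sum, map_smul]

theorem SmoothMVOn.functional {Z : E → ExteriorAlgebra ℝ E} {U : Set E} (h : SmoothMVOn Z U)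
    (ℓ : ExteriorAlgebra ℝ E →ₗ[ℝ] ℝ) : ContDiffOn ℝ (⊤ : ℕ∞) (fun z => ℓ (Z z)) U := by
  rw [funext fun z => linearMap_apply_eq_sum ℓ (Z z)]
  exact ContDiffOn.sum fun S _ => (h S).smul contDiffOn_const

protected theorem SmoothMVOn.linearMap {Z : E → ExteriorAlgebra ℝ E} {U : Set E}
    (h : SmoothMVOn Z U) (T : ExteriorAlgebra ℝ E →ₗ[ℝ] ExteriorAlgebra ℝ E) :
    SmoothMVOn (fun z => T (Z z)) U := fun S => h.functional ((extBasis E).coord S ∘ₗ T)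

protected theorem SmoothMVOn.mul {Z W : E → ExteriorAlgebra ℝ E} {U : Set E} (hZ : SmoothMVOn Z U)
    (hW : SmoothMVOn W U) : SmoothMVOn (fun z => Z z * W z) U := by
  intro S
  have h : ∀ z, (extBasis E).repr (Z z * W z) S = ∑ T, (extBasis E).repr (Z z) T
      * ((extBasis E).coord S ∘ₗ LinearMap.mulLeft ℝ (extBasis E T)) (W z) := fun z => by
    have := linearMap_apply_eq_sum ((extBasis E).coord S ∘ₗ LinearMap.mulRight ℝ (W z)) (Z z)
    simpa using this
  simp only [h]
  exact ContDiffOn.sum fun T _ => (hZ T).mul (hW.functional _)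

protected theorem SmoothMVOn.sub {Z W : E → ExteriorAlgebra ℝ E} {U : Set E} (hZ : SmoothMVOn Z U)
    (hW : SmoothMVOn W U) : SmoothMVOn (fun z => Z z - W z) U := by
  intro S
  simpa using (hZ S).sub (hW S)

protected theorem SmoothMVOn.sum {ι : Type*} (s : Finset ι) {Z : ι → E → ExteriorAlgebra ℝ E}
    {U : Set E} (hZ : ∀ i, SmoothMVOn (Z i) U) : SmoothMVOn (fun z => ∑ i ∈ s, Z i z) U := by
  intro S
  simpa using ContDiffOn.sum fun i (_ : i ∈ s) => hZ i S

theorem repr_partialMV (Z : E → ExteriorAlgebra ℝ E) (y : E) (i : Fin (Module.finrank ℝ E))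
    (S : Finset (Fin (Module.finrank ℝ E))) :
    (extBasis E).repr (partialMV Z y i) S
      = fderiv ℝ (fun z => (extBasis E).repr (Z z) S) y (Module.finBasis ℝ E i) := by
  rw [partialMV, (extBasis E).repr_sum_self]

protected theorem SmoothMVOn.partialMV {Z : E → ExteriorAlgebra ℝ E} {U : Set E}
    (h : SmoothMVOn Z U) (hU : IsOpen U) (i : Fin (Module.finrank ℝ E)) :
    SmoothMVOn (fun z => partialMV Z z i) U := by
  intro S
  simp only [repr_partialMV]
  exact ((h S).fderiv_of_isOpen hU (by simp)).clm_apply contDiffOn_const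

protected theorem SmoothMVOn.schoutenModel {Z W : E → ExteriorAlgebra ℝ E} {U : Set E}
    (hU : IsOpen U) (hZ : SmoothMVOn Z U) (hW : SmoothMVOn W U) :
    SmoothMVOn (schoutenModel Z W) U := by
  refine SmoothMVOn.sum _ fun i => SmoothMVOn.sub ?_ ?_
  · exact (hZ.linearMap (contractRight.flip
      ((Module.finBasis ℝ E).coord i))).mul (hW.partialMV hU i)
  · exact (hZ.partialMV hU i).mul (hW.linearMap (contractLeft
      ((Module.finBasis ℝ E).coord i)))

theorem partialMV_linearMap {Z : E → ExteriorAlgebra ℝ E} {y : E} (h : DiffMVAt Z y)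
    (T : ExteriorAlgebra ℝ E →ₗ[ℝ] ExteriorAlgebra ℝ E) (i : Fin (Module.finrank ℝ E)) :
    partialMV (fun z => T (Z z)) y i = T (partialMV Z y i) := by
  apply (extBasis E).repr.injective
  ext S
  rw [repr_partialMV]
  have h1 : ∀ x, (extBasis E).repr (T x) S
      = ∑ R, (extBasis E).repr x R * (extBasis E).repr (T (extBasis E R)) S := fun x => by
    have := linearMap_apply_eq_sum ((extBasis E).coord S ∘ₗ T) x
    simpa using this
  rw [funext fun z => h1 (Z z), h1]
  simp only [repr_partialMV]
  rw [fderiv_fun_sum fun R _ => (h R).mul_const _]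
  simp only [FunLike.coe_sum, Finset.sum_apply]
  refine Finset.sum_congr rfl fun R _ => ?_
  rw [fderiv_mul_const (h R)]
  simp [mul_comm]

theorem partialMV_add {Z W : E → ExteriorAlgebra ℝ E} {y : E} (hZ : DiffMVAt Z y)
    (hW : DiffMVAt W y) (i : Fin (Module.finrank ℝ E)) :
    partialMV (fun z => Z z + W z) y i = partialMV Z y i + partialMV W y i := by
  apply (extBasis E).repr.injective
  ext S
  rw [map_add, Finsupp.add_apply, repr_partialMV, repr_partialMV, repr_partialMV]
  simp only [map_add, Finsupp.add_apply]
  rw [fderiv_fun_add (hZ S) (hW S)]; rfl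

theorem contractPt_eq_sum (X : ExteriorAlgebra ℝ E) (α : Alt E) :
    contractPt X α = ∑ S, (extBasis E).repr X S • contractPt (extBasis E S) α :=
  linearMap_apply_eq_sum (contractHom.flip α) X

protected theorem SmoothAltOn.contractPt {Z : E → ExteriorAlgebra ℝ E} {α : E → Alt E} {U : Set E}
    (hα : SmoothAltOn α U) (hZ : SmoothMVOn Z U) :
    SmoothAltOn (fun z => contractPt (Z z) (α z)) U := by
  intro k
  simp only [contractPt_eq_sum (Z _), Finset.sum_apply, Pi.smul_apply]
  exact ContDiffOn.sum fun S _ => (hZ S).smul (hα.contractPt_const _ k)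

theorem contractPt_apply_eq_sum (X : ExteriorAlgebra ℝ E) (α : Alt E) (k : ℕ) :
    contractPt X α k = ∑ S, (extBasis E).repr X S • contractPt (extBasis E S) α k := by
  rw [contractPt_eq_sum, Finset.sum_apply]
  rfl

protected theorem DiffAltAt.contractPt {Z : E → ExteriorAlgebra ℝ E} {α : E → Alt E} {y : E}
    (hα : DiffAltAt α y) (hZ : DiffMVAt Z y) : DiffAltAt (fun z => contractPt (Z z) (α z)) y :=
  fun k => by
  simp only [contractPt_apply_eq_sum (Z _)]
  exact DifferentiableAt.fun_sum fun S _ => (hZ S).smul (hα.contractPt_const _ k)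

theorem diffAlt_contractPt {Z : E → ExteriorAlgebra ℝ E} {α : E → Alt E} {y : E}
    (hZ : DiffMVAt Z y) (hα : DiffAltAt α y) (i : Fin (Module.finrank ℝ E)) :
    diffAlt (fun z => contractPt (Z z) (α z)) y (Module.finBasis ℝ E i)
      = contractPt (partialMV Z y i) (α y)
        + contractPt (Z y) (diffAlt α y (Module.finBasis ℝ E i)) := by
  funext k
  rw [Pi.add_apply, contractPt_apply_eq_sum (partialMV Z y i), contractPt_apply_eq_sum (Z y),
    ← Finset.sum_add_distrib]
  simp only [diffAlt, contractPt_apply_eq_sum (Z _)]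
  rw [fderiv_fun_sum fun S _ => (hZ S).fun_smul (hα.contractPt_const _ k)]
  simp only [FunLike.coe_sum, Finset.sum_apply, repr_partialMV]
  refine Finset.sum_congr rfl fun S _ => ?_
  have hconst := congrFun (diffAlt_contractPt_const (extBasis E S) hα (Module.finBasis ℝ E i)) k
  unfold diffAlt at hconst
  rw [fderiv_fun_smul (hZ S) (hα.contractPt_const _ k), add_apply, smul_apply,
    ContinuousLinearMap.smulRight_apply, hconst, add_comm]
  rfl

/-- The coordinate functions of the chosen basis of the model space. -/
def coordForm (i : Fin (Module.finrank ℝ E)) : E →L[ℝ] ℝ :=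
  LinearMap.toContinuousLinearMap ((Module.finBasis ℝ E).coord i)

theorem coe_coordForm (i : Fin (Module.finrank ℝ E)) :
    (coordForm i : E →ₗ[ℝ] ℝ) = (Module.finBasis ℝ E).coord i := rfl

theorem modelD_eq_sum (α : E → Alt E) (y : E) :
    modelD α y = ∑ i, wedgeCov (coordForm i) (diffAlt α y (Module.finBasis ℝ E i)) := by
  funext k
  rw [Finset.sum_apply]
  cases k with
  | zero => simp [modelD, wedgeCov]
  | succ k =>
    have h : fderiv ℝ (fun z => α z k) y = ∑ i, (coordForm i).smulRight
        (fderiv ℝ (fun z => α z k) y (Module.finBasis ℝ E i)) := by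
      ext1 v
      conv_lhs => rw [← (Module.finBasis ℝ E).sum_repr v, map_sum]
      simp only [FunLike.coe_sum, Finset.sum_apply, map_smul]
      rfl
    simp only [modelD, wedgeCov, extDeriv]
    conv_lhs => rw [h]
    simp only [← ContinuousAlternatingMap.alternatizeUncurryFinCLM_apply, map_sum]
    rfl

/-- The Lie derivative along a multivector field on the model space. -/
def modelLie (Z : E → ExteriorAlgebra ℝ E) (α : E → Alt E) (y : E) : Alt E :=
  modelD (fun z => contractPt (Z z) (α z)) y
    - contractPt (involute (Z y)) (modelD α y)

theorem modelLie_eq_sum {Z : E → ExteriorAlgebra ℝ E} {α : E → Alt E} {y : E}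
    (hZ : DiffMVAt Z y) (hα : DiffAltAt α y) :
    modelLie Z α y = ∑ i, (wedgeCov (coordForm i) (contractPt (partialMV Z y i) (α y))
      + contractPt (contractRight (Z y) ((Module.finBasis ℝ E).coord i))
        (diffAlt α y (Module.finBasis ℝ E i))) := by
  rw [modelLie, modelD_eq_sum, modelD_eq_sum, contractPt_sum, ← Finset.sum_sub_distrib]
  refine Finset.sum_congr rfl fun i _ => ?_
  rw [diffAlt_contractPt hZ hα i, wedgeCov_add, wedgeCov_contractPt (coordForm i) (Z y),
    coe_coordForm]
  abel

protected theorem HasParityPt.partialMV {Z : E → ExteriorAlgebra ℝ E} {y : E} {r : ℤ}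
    (hZ : DiffMVAt Z y) (hr : ∀ z, HasParityPt r (Z z)) (i : Fin (Module.finrank ℝ E)) :
    HasParityPt r (partialMV Z y i) := by
  have hinvolute := partialMV_linearMap hZ involute.toLinearMap i
  have hsmul := partialMV_linearMap hZ (sgn r • LinearMap.id) i
  exact hinvolute.symm.trans ((congrArg (partialMV · y i) (funext hr)).trans hsmul)

theorem contractPt_schoutenModel {Z W : E → ExteriorAlgebra ℝ E} {α : E → Alt E} {y : E} {r s : ℤ}
    (hZ : DiffMVAt Z y) (hW : DiffMVAt W y) (hα : DiffAltAt α y)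
    (hr : ∀ z, HasParityPt r (Z z)) (hs : ∀ z, HasParityPt s (W z)) :
    contractPt (schoutenModel Z W y) (α y)
      = sgn ((r - 1) * s) • modelLie Z (fun z => contractPt (W z) (α z)) y
        - contractPt (W y) (modelLie Z α y) := by
  rw [modelLie_eq_sum hZ (hα.contractPt hW), modelLie_eq_sum hZ hα, contractPt_sum,
    schoutenModel, contractPt_sum_left, Finset.smul_sum, ← Finset.sum_sub_distrib]
  refine Finset.sum_congr rfl fun i _ => ?_
  have hright := (hr y).contractRight ((Module.finBasis ℝ E).coord i)
  have hleft : contractLeft ((Module.finBasis ℝ E).coord i) (W y)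
      = -(sgn s • contractRight (W y) ((Module.finBasis ℝ E).coord i)) := by
    rw [contractLeft_eq_involute_contractRight, involute_contractRight, hs y, map_smul,
      LinearMap.smul_apply]
  rw [diffAlt_contractPt hW hα i, contractPt_sub_left, contractPt_mul, contractPt_mul, hleft,
    contractPt_neg_left, contractPt_smul_left,
    (HasParityPt.partialMV hZ hr i).contractPt_comm (hs y), wedgeCov_smul, wedgeCov_contractPt,
    coe_coordForm, contractPt_add, contractPt_add,
    hright.contractPt_comm (HasParityPt.partialMV hW hs i), hright.contractPt_comm (hs y), hs y,
    contractPt_smul_left, sub_mul, add_mul, one_mul, sgn_sub, sgn_add]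
  rcases sgn_eq_one_or_neg_one (r * s) with hrs | hrs <;>
    rcases sgn_eq_one_or_neg_one s with hs' | hs' <;> rw [hrs, hs'] <;> module

end Model

section Naturality

open scoped Topology

variable {E : Type*} [NormedAddCommGroup E] [NormedSpace ℝ E]

/-- The pullback of a field of forms of all degrees along a map of the model space. -/
def modelPull (τ : E → E) (α : E → Alt E) (y : E) : Alt E := pullAlt (fderiv ℝ τ y) (α (τ y))

/-- `τ`-relatedness of two multivector fields near `y`: the differential of `τ` carries `Z` to
`Z'`. -/
def MVRelatedAt (τ : E → E) (Z Z' : E → ExteriorAlgebra ℝ E) (y : E) : Prop :=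
  ∀ᶠ z in 𝓝 y, Z' (τ z) = ExteriorAlgebra.map (fderiv ℝ τ z).toLinearMap (Z z)

theorem contractPt_modelPull (τ : E → E) (Z : E → ExteriorAlgebra ℝ E) (α : E → Alt E) (y : E) :
    contractPt (Z y) (modelPull τ α y) = pullAlt (fderiv ℝ τ y)
      (contractPt (ExteriorAlgebra.map (fderiv ℝ τ y).toLinearMap (Z y)) (α (τ y))) :=
  contractPt_pullAlt _ _ _

theorem MVRelatedAt.contractPt_modelPull {τ : E → E} {Z Z' : E → ExteriorAlgebra ℝ E} {y : E}
    (h : MVRelatedAt τ Z Z' y) (α : E → Alt E) :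
    (fun z => contractPt (Z z) (modelPull τ α z))
      =ᶠ[𝓝 y] modelPull τ fun z => contractPt (Z' z) (α z) := by
  filter_upwards [h] with z hz
  rw [NPlectic.contractPt_modelPull, ← hz, modelPull]

theorem two_le_smooth : (2 : WithTop ℕ∞) ≤ ((⊤ : ℕ∞) : WithTop ℕ∞) :=
  WithTop.coe_le_coe.2 (le_top : (2 : ℕ∞) ≤ ⊤)

theorem modelD_congr {α β : E → Alt E} {y : E} (h : α =ᶠ[𝓝 y] β) : modelD α y = modelD β y := by
  funext k
  cases k with
  | zero => rfl
  | succ k => exact Filter.EventuallyEq.extDeriv_eq (h.mono fun z hz => congrFun hz k)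

protected theorem SmoothAltOn.modelD {α : E → Alt E} {U : Set E} (hα : SmoothAltOn α U)
    (hU : IsOpen U) : SmoothAltOn (modelD α) U
  | 0 => contDiffOn_const
  | k + 1 => (ContinuousAlternatingMap.alternatizeUncurryFinCLM ℝ E ℝ).contDiff.comp_contDiffOn
      ((hα k).fderiv_of_isOpen hU (by simp))

theorem modelD_modelD {α : E → Alt E} {U : Set E} (hα : SmoothAltOn α U) (hU : IsOpen U) {y : E}
    (hy : y ∈ U) : modelD (modelD α) y = 0 := by
  funext k
  match k with
  | 0 => rfl
  | 1 =>
    change extDeriv (fun _ : E => (0 : E [⋀^Fin 0]→L[ℝ] ℝ)) y = 0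
    ext v
    simp [extDeriv, ContinuousAlternatingMap.alternatizeUncurryFin_apply]
  | k + 2 =>
    exact extDeriv_extDeriv_apply ((hα k).contDiffAt (hU.mem_nhds hy))
      (by simpa using two_le_smooth)

protected theorem DiffAltAt.modelPull {τ : E → E} {α : E → Alt E} {y : E} (hα : DiffAltAt α (τ y))
    (hτ : ContDiffAt ℝ (⊤ : ℕ∞) τ y) : DiffAltAt (modelPull τ α) y := fun k =>
  DifferentiableAt.continuousAlternatingMapCompContinuousLinearMap
    ((hα k).comp y (hτ.differentiableAt (by simp)))
    ((hτ.fderiv_right (m := 1) two_le_smooth).differentiableAt (by simp))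

theorem modelD_modelPull {τ : E → E} {α : E → Alt E} {y : E} (hα : DiffAltAt α (τ y))
    (hτ : ContDiffAt ℝ (⊤ : ℕ∞) τ y) : modelD (modelPull τ α) y = modelPull τ (modelD α) y := by
  funext k
  cases k with
  | zero => rfl
  | succ k => exact extDeriv_pullback (hα k) hτ (by simpa using two_le_smooth)

theorem modelLie_congr (Z : E → ExteriorAlgebra ℝ E) {α β : E → Alt E} {y : E}
    (h : α =ᶠ[𝓝 y] β) : modelLie Z α y = modelLie Z β y := by
  have hcontract : (fun z => contractPt (Z z) (α z)) =ᶠ[𝓝 y] fun z => contractPt (Z z) (β z) :=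
    h.mono fun z hz => congrArg (contractPt (Z z)) hz
  rw [modelLie, modelLie, modelD_congr h, modelD_congr hcontract]

protected theorem MVRelatedAt.parityPart {τ : E → E} {Z Z' : E → ExteriorAlgebra ℝ E} {y : E}
    (h : MVRelatedAt τ Z Z' y) (t : ℤ) :
    MVRelatedAt τ (fun z => parityPart t (Z z)) (fun z => parityPart t (Z' z)) y :=
  h.mono fun _ hz => (congrArg (parityPart t) hz).trans (map_parityPart _ t _).symm

variable [FiniteDimensional ℝ E]

theorem modelLie_modelPull {τ : E → E} {Z Z' : E → ExteriorAlgebra ℝ E} {α : E → Alt E} {y : E}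
    (hτ : ContDiffAt ℝ (⊤ : ℕ∞) τ y) (hα : DiffAltAt α (τ y)) (hZ' : DiffMVAt Z' (τ y))
    (h : MVRelatedAt τ Z Z' y) :
    modelLie Z (modelPull τ α) y = modelPull τ (modelLie Z' α) y := by
  rw [modelLie, modelD_congr (h.contractPt_modelPull α), modelD_modelPull (hα.contractPt hZ') hτ,
    modelD_modelPull hα hτ, contractPt_modelPull τ (fun z => involute (Z z)), map_involute,
    ← h.self_of_nhds, modelPull, modelPull, modelLie, pullAlt_sub]

protected theorem DiffMVAt.linearMap {Z : E → ExteriorAlgebra ℝ E} {y : E} (h : DiffMVAt Z y)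
    (T : ExteriorAlgebra ℝ E →ₗ[ℝ] ExteriorAlgebra ℝ E) : DiffMVAt (fun z => T (Z z)) y := by
  intro S
  change DifferentiableAt ℝ (fun z => ((extBasis E).coord S ∘ₗ T) (Z z)) y
  rw [funext fun z => linearMap_apply_eq_sum ((extBasis E).coord S ∘ₗ T) (Z z)]
  exact DifferentiableAt.fun_sum fun R _ => (h R).smul_const _

/-- The bracket is determined by its contractions, which Cartan calculus expresses through
operators commuting with pullback. -/
theorem schoutenModel_map_of_hasParityPt {τ : E → E} {Z W Z' W' : E → ExteriorAlgebra ℝ E} {y : E}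
    {r s : ℤ} (hτ : ContDiffAt ℝ (⊤ : ℕ∞) τ y)
    (hZ : DiffMVAt Z y) (hW : DiffMVAt W y) (hZ' : DiffMVAt Z' (τ y)) (hW' : DiffMVAt W' (τ y))
    (hr : ∀ z, HasParityPt r (Z z)) (hs : ∀ z, HasParityPt s (W z))
    (hr' : ∀ z, HasParityPt r (Z' z)) (hs' : ∀ z, HasParityPt s (W' z))
    (hZZ' : MVRelatedAt τ Z Z' y) (hWW' : MVRelatedAt τ W W' y) :
    schoutenModel Z' W' (τ y)
      = ExteriorAlgebra.map (fderiv ℝ τ y).toLinearMap (schoutenModel Z W y) := by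
  refine eq_of_contractPt_apply_zero_eq fun β => ?_
  have hβ : DiffAltAt (fun _ : E => β) (τ y) := fun k => differentiableAt_const _
  have hpull : modelPull τ (fun z => contractPt (schoutenModel Z' W' z) β) y
      = pullAlt (fderiv ℝ τ y) (contractPt (ExteriorAlgebra.map (fderiv ℝ τ y).toLinearMap
        (schoutenModel Z W y)) β) := by
    rw [← contractPt_modelPull τ (schoutenModel Z W) fun _ => β,
      contractPt_schoutenModel hZ hW (hβ.modelPull hτ) hr hs,
      modelLie_congr Z (hWW'.contractPt_modelPull fun _ => β),
      modelLie_modelPull hτ (hβ.contractPt hW') hZ' hZZ', modelLie_modelPull hτ hβ hZ' hZZ',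
      contractPt_modelPull, ← hWW'.self_of_nhds, modelPull, modelPull,
      contractPt_schoutenModel hZ' hW' hβ hr' hs', pullAlt_sub, pullAlt_smul]
  ext w
  have hzero := congrArg (fun γ : Alt E => γ 0 w) hpull
  change (contractPt (schoutenModel Z' W' (τ y)) β 0) (fderiv ℝ τ y ∘ w)
    = (contractPt (ExteriorAlgebra.map _ _) β 0) (fderiv ℝ τ y ∘ w) at hzero
  rwa [Subsingleton.elim (fderiv ℝ τ y ∘ w) w] at hzero

theorem schoutenModel_add_left {Z Z' : E → ExteriorAlgebra ℝ E} {y : E} (hZ : DiffMVAt Z y)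
    (hZ' : DiffMVAt Z' y) (W : E → ExteriorAlgebra ℝ E) :
    schoutenModel (fun z => Z z + Z' z) W y = schoutenModel Z W y + schoutenModel Z' W y := by
  simp only [schoutenModel, partialMV_add hZ hZ', map_add, LinearMap.add_apply, add_mul,
    ← Finset.sum_add_distrib]
  exact Finset.sum_congr rfl fun i _ => add_sub_add_comm _ _ _ _

theorem schoutenModel_add_right {W W' : E → ExteriorAlgebra ℝ E} {y : E} (hW : DiffMVAt W y)
    (hW' : DiffMVAt W' y) (Z : E → ExteriorAlgebra ℝ E) :
    schoutenModel Z (fun z => W z + W' z) y = schoutenModel Z W y + schoutenModel Z W' y := by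
  simp only [schoutenModel, partialMV_add hW hW', map_add, mul_add, ← Finset.sum_add_distrib]
  exact Finset.sum_congr rfl fun i _ => add_sub_add_comm _ _ _ _

theorem schoutenModel_smul_left {Z : E → ExteriorAlgebra ℝ E} {y : E} (hZ : DiffMVAt Z y) (c : ℝ)
    (W : E → ExteriorAlgebra ℝ E) :
    schoutenModel (fun z => c • Z z) W y = c • schoutenModel Z W y := by
  have hpartial : ∀ i, partialMV (fun z => c • Z z) y i = c • partialMV Z y i :=
    partialMV_linearMap hZ (LinearMap.lsmul ℝ (ExteriorAlgebra ℝ E) c)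
  simp only [schoutenModel, hpartial, map_smul, LinearMap.smul_apply, smul_mul_assoc,
    ← smul_sub, ← Finset.smul_sum]

theorem schoutenModel_eq_sum_parityPart {Z W : E → ExteriorAlgebra ℝ E} {y : E}
    (hZ : DiffMVAt Z y) (hW : DiffMVAt W y) :
    schoutenModel Z W y =
      (schoutenModel (fun z => parityPart 0 (Z z)) (fun z => parityPart 0 (W z)) y
        + schoutenModel (fun z => parityPart 0 (Z z)) (fun z => parityPart 1 (W z)) y)
      + (schoutenModel (fun z => parityPart 1 (Z z)) (fun z => parityPart 0 (W z)) y
        + schoutenModel (fun z => parityPart 1 (Z z)) (fun z => parityPart 1 (W z)) y) := by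
  rw [← schoutenModel_add_right (hW.linearMap _) (hW.linearMap _),
    ← schoutenModel_add_right (hW.linearMap _) (hW.linearMap _),
    ← schoutenModel_add_left (hZ.linearMap _) (hZ.linearMap _)]
  simp only [parityPart_zero_add_parityPart_one]

theorem schoutenModel_map {τ : E → E} {Z W Z' W' : E → ExteriorAlgebra ℝ E} {y : E}
    (hτ : ContDiffAt ℝ (⊤ : ℕ∞) τ y)
    (hZ : DiffMVAt Z y) (hW : DiffMVAt W y) (hZ' : DiffMVAt Z' (τ y)) (hW' : DiffMVAt W' (τ y))
    (hZZ' : MVRelatedAt τ Z Z' y) (hWW' : MVRelatedAt τ W W' y) :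
    schoutenModel Z' W' (τ y)
      = ExteriorAlgebra.map (fderiv ℝ τ y).toLinearMap (schoutenModel Z W y) := by
  have hparts : ∀ s t : ℤ,
      schoutenModel (fun z => parityPart s (Z' z)) (fun z => parityPart t (W' z)) (τ y)
        = ExteriorAlgebra.map (fderiv ℝ τ y).toLinearMap
          (schoutenModel (fun z => parityPart s (Z z)) (fun z => parityPart t (W z)) y) :=
    fun s t => schoutenModel_map_of_hasParityPt hτ (hZ.linearMap _) (hW.linearMap _)
      (hZ'.linearMap _) (hW'.linearMap _) (fun _ => hasParityPt_parityPart s _)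
      (fun _ => hasParityPt_parityPart t _) (fun _ => hasParityPt_parityPart s _)
      (fun _ => hasParityPt_parityPart t _) (hZZ'.parityPart s) (hWW'.parityPart t)
  simp only [schoutenModel_eq_sum_parityPart hZ' hW', schoutenModel_eq_sum_parityPart hZ hW,
    hparts, map_add]

end Naturality

/-! ### Change of charts -/

section Charts

open scoped Topology

variable {E : Type*} [NormedAddCommGroup E] {M : Type*} [TopologicalSpace M] [ChartedSpace E M]

/-- The change of coordinates between the charts around `x₀` and `q`. -/
def transition (x₀ q : M) (z : E) : E := chartAt E q ((chartAt E x₀).symm z)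

/-- The domain of the change of coordinates `transition x₀ q`. -/
def transitionSource (x₀ q : M) : Set E :=
  (chartAt E x₀).target ∩ (chartAt E x₀).symm ⁻¹' (chartAt E q).source

theorem transitionSource_mem_nhds {x₀ q : M} {y : E} (hy : y ∈ transitionSource x₀ q) :
    transitionSource x₀ q ∈ 𝓝 y :=
  ((chartAt E x₀).isOpen_inter_preimage_symm (chartAt E q).open_source).mem_nhds hy

theorem transition_mem_target {x₀ q : M} {y : E} (hy : y ∈ transitionSource x₀ q) :
    transition x₀ q y ∈ (chartAt E q).target := (chartAt E q).map_source hy.2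

theorem mem_transitionSource_symm {x₀ : M} {y : E} (hy : y ∈ (chartAt E x₀).target) :
    y ∈ transitionSource x₀ ((chartAt E x₀).symm y) := ⟨hy, mem_chart_source E _⟩

variable [NormedSpace ℝ E]

/-- A form of all degrees in the chart around `x₀`. -/
def formAlt (x₀ : M) (α : FormField E M) (y : E) : Alt E := fun k => formInChart x₀ α k y

theorem formAlt_eq_pullAlt (x₀ : M) (α : FormField E M) (y : E) :
    formAlt x₀ α y = pullAlt (chartSymmDeriv x₀ y) (α ((chartAt E x₀).symm y)) := rfl

theorem formAlt_smul (x₀ : M) (c : ℝ) (α : FormField E M) (y : E) :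
    formAlt x₀ (c • α) y = c • formAlt x₀ α y := rfl

theorem formAlt_sub (x₀ : M) (α β : FormField E M) (y : E) :
    formAlt x₀ (α - β) y = formAlt x₀ α y - formAlt x₀ β y := rfl

theorem mvInChart_add (x₀ : M) (X Y : MVField E M) :
    mvInChart x₀ (X + Y) = fun y => mvInChart x₀ X y + mvInChart x₀ Y y :=
  funext fun _ => map_add _ _ _

theorem mvInChart_smul (x₀ : M) (c : ℝ) (X : MVField E M) :
    mvInChart x₀ (c • X) = fun y => c • mvInChart x₀ X y :=
  funext fun _ => by simp [mvInChart]

theorem mvInChart_mul (x₀ : M) (X Y : MVField E M) :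
    mvInChart x₀ (X * Y) = fun y => mvInChart x₀ X y * mvInChart x₀ Y y :=
  funext fun _ => map_mul _ _ _

theorem mvInChart_involute (x₀ : M) (X : MVField E M) :
    mvInChart x₀ (fun x => involute (X x)) = fun y => involute (mvInChart x₀ X y) :=
  funext fun _ => map_involute _ _

theorem mvInChart_chartAt (q : M) (X : MVField E M) {p : M} (hp : p ∈ (chartAt E q).source) :
    mvInChart q X (chartAt E q p) = ExteriorAlgebra.map (chartDeriv q p).toLinearMap (X p) := by
  unfold mvInChart
  rw [(chartAt E q).left_inv hp]

/-- The part of integer degree `a` of a multivector field. -/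
def mvPart (a : ℤ) (X : MVField E M) : MVField E M := fun x => degProj a (X x)

/-- The even (`t` even) or odd (`t` odd) part of a multivector field. -/
def mvParityPart (t : ℤ) (X : MVField E M) : MVField E M := fun x => parityPart t (X x)

theorem mvParityPart_zero_add_mvParityPart_one (X : MVField E M) :
    mvParityPart 0 X + mvParityPart 1 X = X :=
  funext fun x => parityPart_zero_add_parityPart_one (X x)

/-- The multivector field `X` is even or odd, according to the parity of `r`. -/
def HasParity (r : ℤ) (X : MVField E M) : Prop := ∀ x, HasParityPt r (X x)

theorem hasParity_mvParityPart (t : ℤ) (X : MVField E M) : HasParity t (mvParityPart t X) :=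
  fun x => hasParityPt_parityPart t (X x)

protected theorem HasParity.mvInChart {r : ℤ} {X : MVField E M} (h : HasParity r X) (x₀ : M)
    (y : E) : HasParityPt r (mvInChart x₀ X y) := (h _).map _

protected theorem SmoothForm.diffAltAt {α : FormField E M} (hα : SmoothForm α) (x₀ : M) {y : E}
    (hy : y ∈ (chartAt E x₀).target) : DiffAltAt (formAlt x₀ α) y :=
  SmoothAltOn.diffAltAt (hα x₀) (chartAt E x₀).open_target hy

theorem extD_apply (α : FormField E M) (x : M) :
    extD α x = pullAlt (chartDeriv x x) (modelD (formAlt x α) (chartAt E x x)) := by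
  funext k
  cases k <;> rfl

section FiniteDimensional

variable [FiniteDimensional ℝ E]

protected theorem SmoothMV.diffMVAt {X : MVField E M} (hX : SmoothMV X) (x₀ : M) {y : E}
    (hy : y ∈ (chartAt E x₀).target) : DiffMVAt (mvInChart x₀ X) y :=
  SmoothMVOn.diffMVAt (hX x₀) (chartAt E x₀).open_target hy

protected theorem SmoothMV.mul {X Y : MVField E M} (hX : SmoothMV X) (hY : SmoothMV Y) :
    SmoothMV (X * Y) := fun x₀ => by
  rw [mvInChart_mul]
  exact SmoothMVOn.mul (hX x₀) (hY x₀)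

protected theorem SmoothMV.mvPart (a : ℤ) {X : MVField E M} (hX : SmoothMV X) :
    SmoothMV (mvPart a X) := fun x₀ => by
  rw [show mvInChart x₀ (NPlectic.mvPart a X) = fun y => degProj a (mvInChart x₀ X y) from
    funext fun _ => map_degProj _ a _]
  exact SmoothMVOn.linearMap (hX x₀) (degProj a)

protected theorem SmoothMV.mvParityPart (t : ℤ) {X : MVField E M} (hX : SmoothMV X) :
    SmoothMV (mvParityPart t X) := fun x₀ => by
  rw [show mvInChart x₀ (NPlectic.mvParityPart t X) = fun y => parityPart t (mvInChart x₀ X y) from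
    funext fun _ => map_parityPart _ t _]
  exact SmoothMVOn.linearMap (hX x₀) (parityPart t)

theorem schouten_add_left {X X' : MVField E M} (hX : SmoothMV X) (hX' : SmoothMV X')
    (Y : MVField E M) : schouten (X + X') Y = schouten X Y + schouten X' Y := by
  funext x
  rw [schouten, mvInChart_add, schoutenModel_add_left (hX.diffMVAt x (mem_chart_target E x))
    (hX'.diffMVAt x (mem_chart_target E x)), map_add]
  rfl

theorem schouten_add_right {Y Y' : MVField E M} (hY : SmoothMV Y) (hY' : SmoothMV Y')
    (X : MVField E M) : schouten X (Y + Y') = schouten X Y + schouten X Y' := by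
  funext x
  rw [schouten, mvInChart_add, schoutenModel_add_right (hY.diffMVAt x (mem_chart_target E x))
    (hY'.diffMVAt x (mem_chart_target E x)), map_add]
  rfl

theorem schouten_smul_left {X : MVField E M} (hX : SmoothMV X) (c : ℝ) (Y : MVField E M) :
    schouten (c • X) Y = c • schouten X Y := by
  funext x
  rw [schouten, mvInChart_smul, schoutenModel_smul_left (hX.diffMVAt x (mem_chart_target E x)),
    map_smul]
  rfl

end FiniteDimensional

variable [IsManifold 𝓘(ℝ, E) (⊤ : ℕ∞) M]

theorem chartDeriv_comp_chartSymmDeriv (x₀ : M) {y : E} (hy : y ∈ (chartAt E x₀).target) :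
    (chartDeriv x₀ ((chartAt E x₀).symm y)).comp (chartSymmDeriv x₀ y)
      = ContinuousLinearMap.id ℝ E :=
  (mdifferentiable_chart (I := 𝓘(ℝ, E)) x₀).comp_symm_deriv hy

theorem chartSymmDeriv_comp_chartDeriv (x₀ : M) {y : E} (hy : y ∈ (chartAt E x₀).target) :
    (chartSymmDeriv x₀ y).comp (chartDeriv x₀ ((chartAt E x₀).symm y))
      = ContinuousLinearMap.id ℝ (TangentSpace 𝓘(ℝ, E) ((chartAt E x₀).symm y)) := by
  have h := (mdifferentiable_chart (I := 𝓘(ℝ, E)) x₀).symm_comp_deriv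
    ((chartAt E x₀).map_target hy)
  rw [(chartAt E x₀).right_inv hy] at h
  exact h

theorem inverse_chartDeriv_comp_chartDeriv {x₀ p : M} (hp : p ∈ (chartAt E x₀).source) :
    (chartDeriv x₀ p).inverse.comp (chartDeriv x₀ p)
      = ContinuousLinearMap.id ℝ (TangentSpace 𝓘(ℝ, E) p) :=
  ContinuousLinearMap.IsInvertible.inverse_comp_self
    ⟨(mdifferentiable_chart (I := 𝓘(ℝ, E)) x₀).mfderiv hp, rfl⟩

theorem contDiffAt_transition {x₀ q : M} {y : E} (hy : y ∈ transitionSource x₀ q) :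
    ContDiffAt ℝ (⊤ : ℕ∞) (transition (E := E) x₀ q) y := by
  have h := contDiffWithinAt_ext_coord_change (I := 𝓘(ℝ, E)) (n := (⊤ : ℕ∞)) q x₀ (y := y)
    (by simpa [transitionSource] using hy)
  simp only [mfld_simps, contDiffWithinAt_univ] at h
  exact h

theorem fderiv_transition {x₀ q : M} {y : E} (hy : y ∈ transitionSource x₀ q) :
    fderiv ℝ (transition x₀ q) y
      = (chartDeriv q ((chartAt E x₀).symm y)).comp (chartSymmDeriv x₀ y) := by
  rw [← mfderiv_eq_fderiv]
  exact mfderiv_comp y ((mdifferentiable_chart (I := 𝓘(ℝ, E)) q).mdifferentiableAt hy.2)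
    ((mdifferentiable_chart (I := 𝓘(ℝ, E)) x₀).mdifferentiableAt_symm hy.1)

theorem pullAlt_formAlt (q : M) (α : FormField E M) {p : M} (hp : p ∈ (chartAt E q).source) :
    pullAlt (chartDeriv q p) (formAlt q α (chartAt E q p)) = α p := by
  obtain ⟨w, hw, rfl⟩ : ∃ w ∈ (chartAt E q).target, (chartAt E q).symm w = p :=
    ⟨_, (chartAt E q).map_source hp, (chartAt E q).left_inv hp⟩
  rw [(chartAt E q).right_inv hw, formAlt_eq_pullAlt]
  change pullAlt ((chartSymmDeriv q w).comp (chartDeriv q ((chartAt E q).symm w))) (α _) = _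
  rw [chartSymmDeriv_comp_chartDeriv q hw]
  rfl

theorem eq_of_formAlt_eq {α β : FormField E M}
    (h : ∀ (x₀ : M), ∀ y ∈ (chartAt E x₀).target, formAlt x₀ α y = formAlt x₀ β y) : α = β := by
  funext x
  rw [← pullAlt_formAlt x α (mem_chart_source E x), ← pullAlt_formAlt x β (mem_chart_source E x),
    h x _ (mem_chart_target E x)]

theorem modelPull_transition_formAlt {x₀ q : M} (α : FormField E M) {z : E}
    (hz : z ∈ transitionSource x₀ q) :
    modelPull (transition x₀ q) (formAlt q α) z = formAlt x₀ α z := by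
  rw [formAlt_eq_pullAlt, ← pullAlt_formAlt q α hz.2, modelPull, fderiv_transition hz]
  rfl

theorem formAlt_extD {α : FormField E M} (hα : SmoothForm α) (x₀ : M) {y : E}
    (hy : y ∈ (chartAt E x₀).target) : formAlt x₀ (extD α) y = modelD (formAlt x₀ α) y := by
  have hmem := mem_transitionSource_symm hy
  rw [formAlt_eq_pullAlt, extD_apply]
  set q := (chartAt E x₀).symm y
  calc pullAlt (chartSymmDeriv x₀ y) (pullAlt (chartDeriv q q) (modelD (formAlt q α) _))
      = modelPull (transition x₀ q) (modelD (formAlt q α)) y := by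
        rw [modelPull, fderiv_transition hmem]; rfl
    _ = modelD (modelPull (transition x₀ q) (formAlt q α)) y :=
        (modelD_modelPull (hα.diffAltAt q (transition_mem_target hmem))
          (contDiffAt_transition hmem)).symm
    _ = modelD (formAlt x₀ α) y :=
        modelD_congr (Filter.eventually_of_mem (transitionSource_mem_nhds hmem) fun _ =>
          modelPull_transition_formAlt α)

protected theorem SmoothForm.extD {α : FormField E M} (hα : SmoothForm α) :
    SmoothForm (extD α) := fun x₀ k =>
  (SmoothAltOn.modelD (hα x₀) (chartAt E x₀).open_target k).congr fun _ hy =>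
    congrFun (formAlt_extD hα x₀ hy) k

theorem extD_extD {α : FormField E M} (hα : SmoothForm α) : extD (extD α) = 0 := by
  refine eq_of_formAlt_eq fun x₀ y hy => ?_
  have hopen := (chartAt E x₀).open_target
  rw [formAlt_extD hα.extD x₀ hy, modelD_congr (β := modelD (formAlt x₀ α))
    (Filter.eventually_of_mem (hopen.mem_nhds hy) fun _ => formAlt_extD hα x₀),
    modelD_modelD (α := formAlt x₀ α) (hα x₀) hopen hy]
  rfl

theorem formAlt_contract (X : MVField E M) (α : FormField E M) (x₀ : M) {y : E}
    (hy : y ∈ (chartAt E x₀).target) :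
    formAlt x₀ (contract X α) y = contractPt (mvInChart x₀ X y) (formAlt x₀ α y) := by
  have hpull := pullAlt_formAlt x₀ α ((chartAt E x₀).map_target hy)
  rw [(chartAt E x₀).right_inv hy] at hpull
  rw [formAlt_eq_pullAlt x₀ (contract X α), contract, ← hpull, contractPt_pullAlt]
  change pullAlt ((chartDeriv x₀ ((chartAt E x₀).symm y)).comp (chartSymmDeriv x₀ y)) _ = _
  rw [chartDeriv_comp_chartSymmDeriv x₀ hy]
  rfl

theorem formAlt_contract_eventuallyEq (X : MVField E M) (α : FormField E M) (x₀ : M) {y : E}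
    (hy : y ∈ (chartAt E x₀).target) :
    formAlt x₀ (contract X α) =ᶠ[𝓝 y] fun z => contractPt (mvInChart x₀ X z) (formAlt x₀ α z) :=
  Filter.eventually_of_mem ((chartAt E x₀).open_target.mem_nhds hy) fun _ =>
    formAlt_contract X α x₀

theorem mvInChart_transition {x₀ q : M} (X : MVField E M) {z : E}
    (hz : z ∈ transitionSource x₀ q) : mvInChart q X (transition x₀ q z)
      = ExteriorAlgebra.map (fderiv ℝ (transition x₀ q) z).toLinearMap (mvInChart x₀ X z) := by
  have hcomp : (chartDeriv q ((chartAt E x₀).symm z)).toLinearMap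
      = (((chartDeriv q ((chartAt E x₀).symm z)).comp (chartSymmDeriv x₀ z)).comp
        (chartDeriv x₀ ((chartAt E x₀).symm z))).toLinearMap := by
    rw [ContinuousLinearMap.comp_assoc, chartSymmDeriv_comp_chartDeriv x₀ hz.1]; rfl
  rw [transition, mvInChart_chartAt q X hz.2, fderiv_transition hz, mvInChart,
    ← AlgHom.comp_apply, ExteriorAlgebra.map_comp_map, hcomp]
  rfl

theorem mvRelatedAt_transition {x₀ q : M} (X : MVField E M) {y : E}
    (hy : y ∈ transitionSource x₀ q) :
    MVRelatedAt (transition x₀ q) (mvInChart x₀ X) (mvInChart q X) y :=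
  Filter.eventually_of_mem (transitionSource_mem_nhds hy) fun _ => mvInChart_transition X

theorem map_chartDeriv_inverse_transition {x₀ : M} {y : E} (hy : y ∈ (chartAt E x₀).target)
    (Z : ExteriorAlgebra ℝ E) :
    ExteriorAlgebra.map (chartDeriv x₀ ((chartAt E x₀).symm y)).toLinearMap
      (ExteriorAlgebra.map (chartDeriv ((chartAt E x₀).symm y)
        ((chartAt E x₀).symm y)).inverse.toLinearMap
        (ExteriorAlgebra.map (fderiv ℝ (transition x₀ ((chartAt E x₀).symm y)) y).toLinearMap Z))
      = Z := by
  set q := (chartAt E x₀).symm y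
  have hid : (chartDeriv x₀ q).toLinearMap ∘ₗ (chartDeriv q q).inverse.toLinearMap ∘ₗ
      (fderiv ℝ (transition x₀ q) y).toLinearMap = LinearMap.id := by
    rw [fderiv_transition (mem_transitionSource_symm hy)]
    change ((chartDeriv x₀ q).comp (((chartDeriv q q).inverse.comp (chartDeriv q q)).comp
      (chartSymmDeriv x₀ y))).toLinearMap = _
    rw [inverse_chartDeriv_comp_chartDeriv (mem_chart_source E q)]
    change ((chartDeriv x₀ q).comp (chartSymmDeriv x₀ y)).toLinearMap = _
    rw [chartDeriv_comp_chartSymmDeriv x₀ hy]; rfl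
  rw [← AlgHom.comp_apply, ← AlgHom.comp_apply, ExteriorAlgebra.map_comp_map,
    ExteriorAlgebra.map_comp_map, LinearMap.comp_assoc, hid, ExteriorAlgebra.map_id]
  rfl

variable [FiniteDimensional ℝ E]

protected theorem SmoothForm.contract {X : MVField E M} {α : FormField E M} (hα : SmoothForm α)
    (hX : SmoothMV X) : SmoothForm (contract X α) := fun x₀ k =>
  (SmoothAltOn.contractPt (hα x₀) (hX x₀) k).congr fun _ hy =>
    congrFun (formAlt_contract X α x₀ hy) k

theorem mvInChart_schouten {X Y : MVField E M} (hX : SmoothMV X) (hY : SmoothMV Y) (x₀ : M) {y : E}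
    (hy : y ∈ (chartAt E x₀).target) :
    mvInChart x₀ (schouten X Y) y = schoutenModel (mvInChart x₀ X) (mvInChart x₀ Y) y := by
  have hmem := mem_transitionSource_symm hy
  have hmap := schoutenModel_map (contDiffAt_transition hmem) (hX.diffMVAt x₀ hy)
    (hY.diffMVAt x₀ hy) (hX.diffMVAt _ (transition_mem_target hmem))
    (hY.diffMVAt _ (transition_mem_target hmem)) (mvRelatedAt_transition X hmem)
    (mvRelatedAt_transition Y hmem)
  rw [mvInChart, schouten]
  exact (congrArg _ (congrArg _ hmap)).trans (map_chartDeriv_inverse_transition hy _)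

protected theorem SmoothMV.schouten {X Y : MVField E M} (hX : SmoothMV X) (hY : SmoothMV Y) :
    SmoothMV (schouten X Y) := fun x₀ S =>
  (SmoothMVOn.schoutenModel (chartAt E x₀).open_target (hX x₀) (hY x₀) S).congr fun _ hy => by
    simp only [mvInChart_schouten hX hY x₀ hy]

theorem formAlt_lieD {X : MVField E M} {α : FormField E M} (hX : SmoothMV X) (hα : SmoothForm α)
    (x₀ : M) {y : E} (hy : y ∈ (chartAt E x₀).target) :
    formAlt x₀ (lieD X α) y = modelLie (mvInChart x₀ X) (formAlt x₀ α) y := by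
  rw [lieD, formAlt_sub, formAlt_extD (hα.contract hX) x₀ hy, formAlt_contract _ _ _ hy,
    formAlt_extD hα x₀ hy, mvInChart_involute, modelLie,
    modelD_congr (formAlt_contract_eventuallyEq X α x₀ hy)]

theorem contract_schouten {X Y : MVField E M} {α : FormField E M} {r s : ℤ} (hX : SmoothMV X)
    (hY : SmoothMV Y) (hα : SmoothForm α) (hr : HasParity r X) (hs : HasParity s Y) :
    contract (schouten X Y) α
      = sgn ((r - 1) * s) • lieD X (contract Y α) - contract Y (lieD X α) := by
  refine eq_of_formAlt_eq fun x₀ y hy => ?_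
  rw [formAlt_contract _ _ _ hy, mvInChart_schouten hX hY x₀ hy, formAlt_sub, formAlt_smul,
    formAlt_lieD hX (hα.contract hY) x₀ hy, formAlt_contract _ _ _ hy, formAlt_lieD hX hα x₀ hy,
    contractPt_schoutenModel (hX.diffMVAt x₀ hy) (hY.diffMVAt x₀ hy) (hα.diffAltAt x₀ hy)
      (hr.mvInChart x₀) (hs.mvInChart x₀),
    modelLie_congr _ (formAlt_contract_eventuallyEq Y α x₀ hy)]

end Charts

/-! ### Differential forms and multivector fields on the manifold -/

section Operators

variable {E : Type*} [NormedAddCommGroup E] [NormedSpace ℝ E]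
  {M : Type*} [TopologicalSpace M] [ChartedSpace E M]

theorem contract_add_left (X Y : MVField E M) (α : FormField E M) :
    contract (X + Y) α = contract X α + contract Y α := funext fun _ => contractPt_add_left _ _ _

theorem contract_smul_left (c : ℝ) (X : MVField E M) (α : FormField E M) :
    contract (c • X) α = c • contract X α := funext fun _ => contractPt_smul_left _ _ _

theorem contract_sub_left (X Y : MVField E M) (α : FormField E M) :
    contract (X - Y) α = contract X α - contract Y α := funext fun _ => contractPt_sub_left _ _ _

theorem contract_zero_left (α : FormField E M) : contract (0 : MVField E M) α = 0 :=
  funext fun _ => contractPt_zero_left _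

theorem contract_add (X : MVField E M) (α β : FormField E M) :
    contract X (α + β) = contract X α + contract X β := funext fun _ => contractPt_add _ _ _

theorem contract_smul (c : ℝ) (X : MVField E M) (α : FormField E M) :
    contract X (c • α) = c • contract X α := funext fun _ => contractPt_smul _ _ _

theorem contract_neg (X : MVField E M) (α : FormField E M) :
    contract X (-α) = -contract X α := funext fun _ => contractPt_neg _ _

theorem contract_sub (X : MVField E M) (α β : FormField E M) :
    contract X (α - β) = contract X α - contract X β := by
  rw [sub_eq_add_neg, contract_add, contract_neg, sub_eq_add_neg]

theorem contract_zero (X : MVField E M) : contract X (0 : FormField E M) = 0 :=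
  funext fun _ => contractPt_zero _

theorem contract_mul (X Y : MVField E M) (α : FormField E M) :
    contract (X * Y) α = contract Y (contract X α) := funext fun _ => contractPt_mul _ _ _

theorem extD_zero : extD (0 : FormField E M) = 0 := by
  simpa using extD_smul (0 : ℝ) (0 : FormField E M)

theorem extD_neg (α : FormField E M) : extD (-α) = -extD α := by
  rw [← neg_one_smul ℝ α, extD_smul]; module

theorem SmoothForm.neg {α : FormField E M} (hα : SmoothForm α) : SmoothForm (-α) := by
  rw [← neg_one_smul ℝ α]; exact hα.smul (-1)

theorem SmoothForm.sub {α β : FormField E M} (hα : SmoothForm α) (hβ : SmoothForm β) :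
    SmoothForm (α - β) := by
  rw [sub_eq_add_neg]; exact hα.add hβ.neg

theorem extD_sub {α β : FormField E M} (hα : SmoothForm α) (hβ : SmoothForm β) :
    extD (α - β) = extD α - extD β := by
  rw [sub_eq_add_neg, extD_add hα hβ.neg, extD_neg, sub_eq_add_neg]

theorem lieD_zero_right (X : MVField E M) : lieD X (0 : FormField E M) = 0 := by
  rw [lieD, contract_zero, extD_zero, contract_zero, sub_zero]

theorem formInChart_congr {α β : FormField E M} {k : ℕ} (h : ∀ x, α x k = β x k) (x₀ : M) :
    formInChart x₀ α k = formInChart x₀ β k :=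
  funext fun _ => by rw [formInChart, h]; rfl

theorem extD_succ_congr {α β : FormField E M} {k : ℕ} (h : ∀ x, α x k = β x k) (x : M) :
    extD α x (k + 1) = extD β x (k + 1) := by
  simp only [extD, formInChart_congr h]

section Grading

variable {n k : ℕ} {a : ℤ} {f g : FormField E M}

protected theorem HasDeg.extD (hf : HasDeg n a f) : HasDeg n (a - 1) (extD f) := by
  intro x k hk
  cases k with
  | zero => rfl
  | succ k =>
    have hfk : ∀ x, f x k = (0 : FormField E M) x k := fun x => hf x k (by push_cast at hk; lia)
    rw [extD_succ_congr hfk x, extD_zero]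
    rfl

theorem HasDeg.add (hf : HasDeg n a f) (hg : HasDeg n a g) : HasDeg n a (f + g) :=
  fun x k hk => by rw [Pi.add_apply, Pi.add_apply, hf x k hk, hg x k hk, add_zero]

theorem HasDeg.smul (c : ℝ) (hf : HasDeg n a f) : HasDeg n a (c • f) :=
  fun x k hk => by rw [Pi.smul_apply, Pi.smul_apply, hf x k hk, smul_zero]

theorem HasDeg.neg (hf : HasDeg n a f) : HasDeg n a (-f) := by
  rw [← neg_one_smul ℝ f]; exact hf.smul (-1)

theorem HasDeg.sub (hf : HasDeg n a f) (hg : HasDeg n a g) : HasDeg n a (f - g) := by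
  rw [sub_eq_add_neg]; exact hf.add hg.neg

theorem component_apply_self (k : ℕ) (f : FormField E M) (x : M) :
    component k f x k = f x k := Pi.single_eq_same _ _

theorem component_apply_of_ne {j : ℕ} (h : j ≠ k) (f : FormField E M) (x : M) :
    component k f x j = 0 := Pi.single_eq_of_ne h _

theorem hasDeg_component (n k : ℕ) (f : FormField E M) : HasDeg n (n - k) (component k f) :=
  fun x _ hj => component_apply_of_ne (by lia) f x

theorem component_add (k : ℕ) (f g : FormField E M) :
    component k (f + g) = component k f + component k g :=
  funext fun _ => Pi.single_add _ _ _

theorem component_smul (k : ℕ) (c : ℝ) (f : FormField E M) :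
    component k (c • f) = c • component k f :=
  funext fun x => (LinearMap.single ℝ (fun j => TangentSpace 𝓘(ℝ, E) x [⋀^Fin j]→L[ℝ] ℝ) k).map_smul
    c (f x k)

theorem component_eq_self (hf : HasDeg n a f) (h : (n : ℤ) - k = a) : component k f = f := by
  funext x j
  by_cases hj : j = k
  · subst hj; exact component_apply_self _ _ _
  · rw [component_apply_of_ne hj, hf x j (by lia)]

theorem component_eq_zero (hf : HasDeg n a f) (h : (n : ℤ) - k ≠ a) : component k f = 0 := by
  funext x j
  by_cases hj : j = k
  · subst hj; rw [component_apply_self, hf x j h]; rfl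
  · rw [component_apply_of_ne hj]; rfl

protected theorem SmoothForm.component (k : ℕ) (hf : SmoothForm f) :
    SmoothForm (component k f) := by
  intro x₀ j
  by_cases hj : j = k
  · subst hj
    rw [formInChart_congr (component_apply_self j f)]
    exact hf x₀ j
  · rw [formInChart_congr (β := 0) (component_apply_of_ne hj f)]
    exact smoothForm_zero x₀ j

theorem extD_component_succ (k : ℕ) (f : FormField E M) (x : M) :
    extD (component k f) x (k + 1) = extD f x (k + 1) :=
  extD_succ_congr (component_apply_self k f) x

end Grading

theorem HasParity.contract_contract {r s : ℤ} {X Y : MVField E M} (hX : HasParity r X)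
    (hY : HasParity s Y) (α : FormField E M) :
    contract X (contract Y α) = sgn (r * s) • contract Y (contract X α) :=
  funext fun x => (hX x).contractPt_comm (hY x) (α x)

theorem hasParity_mvPart (a : ℤ) (X : MVField E M) : HasParity a (mvPart a X) :=
  fun x => hasParityPt_degProj a (X x)

protected theorem HasDeg.contract_mvPart {n : ℕ} {a b : ℤ} {f : FormField E M} (hf : HasDeg n b f)
    (X : MVField E M) : HasDeg n (a + b) (contract (mvPart a X) f) := fun x k hk => by
  have hfx : HasTensorDegree (n - b) (f x) := fun j hj => hf x j (by lia)
  exact hfx.contractPt (degProj_degProj a (X x)) k (by lia)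

end Operators

section PreNPlectic

variable {E : Type*} [NormedAddCommGroup E] [NormedSpace ℝ E]
  {M : Type*} [TopologicalSpace M] [ChartedSpace E M] {n : ℕ} {ω : FormField E M}

/-- Pre-`n`-plectic forms: closed smooth forms of tensor degree `n + 1`, possibly degenerate. -/
structure IsPreNPlectic (n : ℕ) (ω : FormField E M) : Prop where
  smooth : SmoothForm ω
  degree : ∀ (x : M) (k : ℕ), k ≠ n + 1 → ω x k = 0
  closed : extD ω = 0

theorem IsNPlectic.isPreNPlectic (hω : IsNPlectic n ω) : IsPreNPlectic n ω :=
  ⟨hω.smooth, hω.degree, hω.closed⟩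

theorem IsPreNPlectic.hasTensorDegree (hω : IsPreNPlectic n ω) (x : M) :
    HasTensorDegree (n + 1) (ω x) := fun j hj => hω.degree x j (by lia)

theorem IsPreNPlectic.contract_involute_congr (hω : IsPreNPlectic n ω) {X X' : MVField E M}
    (h : contract X ω = contract X' ω) :
    contract (fun x => involute (X x)) ω = contract (fun x => involute (X' x)) ω := by
  funext x k
  have hx : contractPt (X x) (ω x) k = contractPt (X' x) (ω x) k := congrFun (congrFun h x) k
  rw [contract, contract, (hω.hasTensorDegree x).contractPt_involute,
    (hω.hasTensorDegree x).contractPt_involute, hx]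

/-- Forms that are contractions of `ω`. -/
def IsContraction (ω g : FormField E M) : Prop := ∃ Y : MVField E M, contract Y ω = g

/-- Contractions along multivectors commute up to sign, so a field that annihilates `ω` annihilates
every contraction of `ω`. -/
theorem IsPreNPlectic.contract_congr (hω : IsPreNPlectic n ω) {X X' : MVField E M}
    (h : contract X ω = contract X' ω) {g : FormField E M} (hg : IsContraction ω g) :
    contract X g = contract X' g := by
  obtain ⟨Y, rfl⟩ := hg
  rw [← sub_eq_zero, ← contract_sub_left] at h ⊢
  funext x
  exact (hω.hasTensorDegree x).contractPt_contractPt_eq_zero (congrFun h x) (Y x)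

protected theorem IsContraction.contract {g : FormField E M} (hg : IsContraction ω g)
    (X : MVField E M) : IsContraction ω (contract X g) := by
  obtain ⟨Y, rfl⟩ := hg
  exact ⟨Y * X, contract_mul _ _ _⟩

theorem IsContraction.neg {g : FormField E M} (hg : IsContraction ω g) : IsContraction ω (-g) := by
  obtain ⟨Y, rfl⟩ := hg
  exact ⟨(-1 : ℝ) • Y, by rw [contract_smul_left]; module⟩

theorem IsPreNPlectic.contract_mvPart_apply (hω : IsPreNPlectic n ω) (a : ℤ) (X : MVField E M)
    (x : M) (k : ℕ) :
    contract (mvPart a X) ω x k = if (k : ℤ) + a = n + 1 then contract X ω x k else 0 :=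
  (hω.hasTensorDegree x).contractPt_degProj a (X x) k

theorem IsPreNPlectic.contract_mvPart (hω : IsPreNPlectic n ω) {a : ℤ} {X : MVField E M}
    (h : HasDeg n (a - 1) (contract X ω)) : contract (mvPart a X) ω = contract X ω := by
  funext x k
  rw [hω.contract_mvPart_apply]
  split_ifs with hk
  · rfl
  · exact (h x k (by lia)).symm

end PreNPlectic

/-! ### Hamiltonian forms and their fields -/

section Hamiltonian

variable {E : Type*} [NormedAddCommGroup E] [NormedSpace ℝ E] [FiniteDimensional ℝ E]
  {M : Type*} [TopologicalSpace M] [ChartedSpace E M]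
  {n : ℕ} {ω f g h : FormField E M} {X X' Y : MVField E M} {a b : ℤ}

theorem SmoothMV.sub (hX : SmoothMV X) (hY : SmoothMV Y) : SmoothMV (X - Y) := by
  rw [sub_eq_add_neg, ← neg_one_smul ℝ Y]
  exact hX.add (hY.smul (-1))

/-- `f` is a Hamiltonian form, homogeneous of symmetric degree `a`. -/
structure HomHam (n : ℕ) (ω : FormField E M) (a : ℤ) (f : FormField E M) : Prop where
  mem : f ∈ hamForms ω
  deg : HasDeg n a f

theorem HomHam.smooth (hf : HomHam n ω a f) : SmoothForm f := hf.mem.1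

theorem HomHam.neg (hf : HomHam n ω a f) : HomHam n ω a (-f) := ⟨neg_mem hf.mem, hf.deg.neg⟩

theorem IsHam.isContraction (hY : IsHam ω Y f) : IsContraction ω f := by
  simpa only [neg_neg] using IsContraction.neg ⟨Y, hY.2⟩

theorem HomHam.isContraction (hf : HomHam n ω a f) : IsContraction ω f :=
  hf.mem.2.2.choose_spec.isContraction

theorem IsSemiHam.isHam_extD (hX : IsSemiHam ω X f) : IsHam ω X (extD f) := hX

theorem HomHam.isContraction_extD (hf : HomHam n ω a f) : IsContraction ω (extD f) :=
  hf.mem.2.1.choose_spec.isHam_extD.isContraction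

theorem isSemiHam_zero_of_extD_eq_zero (hf : extD f = 0) : IsSemiHam ω (0 : MVField E M) f :=
  ⟨smoothMV_zero, by rw [hf, contract_zero_left, neg_zero]⟩

theorem isSemiHam_someSemiHam (hf : f ∈ hamForms ω) : IsSemiHam ω (someSemiHam ω f) f := by
  unfold someSemiHam
  rw [dif_pos hf.2.1]
  exact hf.2.1.choose_spec

protected theorem IsSemiHam.mvPart (hω : IsPreNPlectic n ω) (hX : IsSemiHam ω X f)
    (hf : HasDeg n a f) : IsSemiHam ω (mvPart a X) f :=
  ⟨hX.1.mvPart a, by rw [hω.contract_mvPart (hX.2 ▸ hf.extD.neg), hX.2]⟩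

protected theorem IsHam.mvPart (hω : IsPreNPlectic n ω) (hY : IsHam ω Y f) (hf : HasDeg n a f) :
    IsHam ω (mvPart (a + 1) Y) f :=
  ⟨hY.1.mvPart _, by
    rw [hω.contract_mvPart (by rw [add_sub_cancel_right, hY.2]; exact hf.neg), hY.2]⟩

theorem IsSemiHam.mvPart_component (hω : IsPreNPlectic n ω) (k : ℕ) (hX : IsSemiHam ω X f) :
    IsSemiHam ω (mvPart (n - k) X) (component k f) := by
  refine ⟨hX.1.mvPart _, ?_⟩
  funext x j
  rw [hω.contract_mvPart_apply, hX.2]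
  split_ifs with hj
  · obtain rfl : j = k + 1 := by lia
    exact congrArg Neg.neg (extD_component_succ k f x).symm
  · exact (neg_eq_zero.2 ((hasDeg_component n k f).extD x j (by lia))).symm

theorem IsHam.mvPart_component (hω : IsPreNPlectic n ω) (k : ℕ) (hY : IsHam ω Y f) :
    IsHam ω (mvPart (n - k + 1) Y) (component k f) := by
  refine ⟨hY.1.mvPart _, ?_⟩
  funext x j
  rw [hω.contract_mvPart_apply, hY.2]
  split_ifs with hj
  · obtain rfl : j = k := by lia
    exact congrArg Neg.neg (component_apply_self j f x).symm
  · exact (neg_eq_zero.2 (component_apply_of_ne (by lia) f x)).symm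

theorem homHam_component (hω : IsPreNPlectic n ω) (k : ℕ) (hf : f ∈ hamForms ω) :
    HomHam n ω (n - k) (component k f) := by
  obtain ⟨hs, ⟨X, hX⟩, Y, hY⟩ := hf
  exact ⟨⟨hs.component k, ⟨_, hX.mvPart_component hω k⟩, _, hY.mvPart_component hω k⟩,
    hasDeg_component n k f⟩

theorem IsSemiHam.contract_congr (hω : IsPreNPlectic n ω) (hX : IsSemiHam ω X f)
    (hX' : IsSemiHam ω X' f) (hg : IsContraction ω g) : contract X g = contract X' g :=
  hω.contract_congr (hX.2.trans hX'.2.symm) hg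

theorem IsSemiHam.hasDeg_contract (hω : IsPreNPlectic n ω) (hX : IsSemiHam ω X f)
    (hf : HasDeg n a f) (hg : HasDeg n b g) (hgω : IsContraction ω g) :
    HasDeg n (a + b) (contract X g) := by
  rw [hX.contract_congr hω (hX.mvPart hω hf) hgω]
  exact hg.contract_mvPart X

theorem IsSemiHam.lieD_eq (hω : IsPreNPlectic n ω) (hX : IsSemiHam ω X f) (hf : HasDeg n a f)
    (hg : IsContraction ω (extD g)) :
    lieD X g = extD (contract X g) - sgn a • contract X (extD g) := by
  have hXa := hX.mvPart hω hf
  have hinvolute : (fun x => involute (mvPart a X x)) = sgn a • mvPart a X :=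
    funext (hasParity_mvPart a X)
  rw [lieD, hω.contract_congr (hω.contract_involute_congr (hX.2.trans hXa.2.symm)) hg,
    hX.contract_congr hω hXa hg, hinvolute, contract_smul_left]

theorem IsSemiHam.contract_contract_comm (hω : IsPreNPlectic n ω) (hX : IsSemiHam ω X f)
    (hY : IsSemiHam ω Y g) (hf : HasDeg n a f) (hg : HasDeg n b g) (hh : IsContraction ω h) :
    contract X (contract Y h) = sgn (a * b) • contract Y (contract X h) := by
  have hXa := hX.mvPart hω hf
  have hYb := hY.mvPart hω hg
  rw [hX.contract_congr hω hXa (hh.contract Y), hY.contract_congr hω hYb hh,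
    hY.contract_congr hω hYb (hh.contract X), hX.contract_congr hω hXa hh,
    (hasParity_mvPart a X).contract_contract (hasParity_mvPart b Y)]

theorem IsSemiHam.contract_extD_comm (hω : IsPreNPlectic n ω) (hX : IsSemiHam ω X f)
    (hY : IsSemiHam ω Y g) (hf : HasDeg n a f) (hg : HasDeg n b g) :
    contract X (extD g) = sgn (a * b) • contract Y (extD f) := by
  have hω' : IsContraction ω ω :=
    ⟨1, funext fun x => by simpa [contract] using contractPt_algebraMap 1 (ω x)⟩
  rw [← neg_neg (extD g), ← hY.2, ← neg_neg (extD f), ← hX.2, contract_neg, contract_neg,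
    hX.contract_contract_comm hω hY hf hg hω', smul_neg]

variable [IsManifold 𝓘(ℝ, E) (⊤ : ℕ∞) M]

protected theorem HomHam.extD (hf : HomHam n ω a f) : HomHam n ω (a - 1) (extD f) :=
  ⟨⟨hf.smooth.extD, ⟨0, isSemiHam_zero_of_extD_eq_zero (extD_extD hf.smooth)⟩,
    hf.mem.2.1.choose, hf.mem.2.1.choose_spec.isHam_extD⟩, hf.deg.extD⟩

theorem IsSemiHam.extD_contract (hX : IsSemiHam ω X f) (hf : SmoothForm f) :
    extD (contract X ω) = 0 := by
  rw [hX.2, extD_neg, extD_extD hf, neg_zero]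

end Hamiltonian

section SchoutenContraction

variable {E : Type*} [NormedAddCommGroup E] [NormedSpace ℝ E]
  {M : Type*} [TopologicalSpace M] [ChartedSpace E M]
  {n : ℕ} {ω f g : FormField E M} {X Y K W : MVField E M} {a b r s : ℤ}

theorem IsPreNPlectic.contract_mvParityPart_eq_zero (hω : IsPreNPlectic n ω) (t : ℤ)
    (hK : contract K ω = 0) : contract (mvParityPart t K) ω = 0 := by
  funext x k
  have hKx : contractPt (K x) (ω x) = 0 := congrFun hK x
  simp [contract, mvParityPart, parityPart, contractPt_smul_left, contractPt_add_left,
    (hω.hasTensorDegree x).contractPt_involute, hKx]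

theorem IsPreNPlectic.lieD_congr (hω : IsPreNPlectic n ω) (h : contract X ω = contract Y ω)
    (hg : IsContraction ω g) (hdg : IsContraction ω (extD g)) : lieD X g = lieD Y g := by
  rw [lieD, lieD, hω.contract_congr (hω.contract_involute_congr h) hdg, hω.contract_congr h hg]

theorem lieD_zero_left (α : FormField E M) : lieD 0 α = 0 := by
  simp only [lieD, Pi.zero_apply, map_zero]
  rw [contract_zero_left, extD_zero, zero_sub, neg_eq_zero]
  exact contract_zero_left _

theorem IsPreNPlectic.lieD_eq_zero (hω : IsPreNPlectic n ω) (hK : contract K ω = 0)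
    (hg : IsContraction ω g) (hdg : IsContraction ω (extD g)) : lieD K g = 0 := by
  rw [hω.lieD_congr (hK.trans (contract_zero_left ω).symm) hg hdg, lieD_zero_left]

variable [FiniteDimensional ℝ E] [IsManifold 𝓘(ℝ, E) (⊤ : ℕ∞) M]

theorem IsPreNPlectic.contract_schouten_of_extD_eq_zero (hω : IsPreNPlectic n ω) (hX : SmoothMV X)
    (hY : SmoothMV Y) (hr : HasParity r X) (hs : HasParity s Y) (hcl : extD (contract X ω) = 0) :
    contract (schouten X Y) ω = sgn ((r - 1) * s) • lieD X (contract Y ω) := by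
  have hlie : lieD X ω = 0 := by rw [lieD, hcl, hω.closed, contract_zero, sub_zero]
  rw [contract_schouten hX hY hω.smooth hr hs, hlie, contract_zero, sub_zero]

theorem IsPreNPlectic.contract_schouten_eq_zero_of_right (hω : IsPreNPlectic n ω)
    (hX : SmoothMV X) (hr : HasParity r X) (hcl : extD (contract X ω) = 0) (hK : SmoothMV K)
    (hKω : contract K ω = 0) : contract (schouten X K) ω = 0 := by
  have hpart (t : ℤ) : contract (schouten X (mvParityPart t K)) ω = 0 := by
    rw [hω.contract_schouten_of_extD_eq_zero hX (hK.mvParityPart t) hr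
      (hasParity_mvParityPart t K) hcl, hω.contract_mvParityPart_eq_zero t hKω, lieD_zero_right,
      smul_zero]
  rw [← mvParityPart_zero_add_mvParityPart_one K,
    schouten_add_right (hK.mvParityPart 0) (hK.mvParityPart 1), contract_add_left, hpart, hpart,
    add_zero]

theorem IsPreNPlectic.contract_schouten_eq_zero_of_left (hω : IsPreNPlectic n ω)
    (hK : SmoothMV K) (hKω : contract K ω = 0) (hW : SmoothMV W) (hs : HasParity s W)
    (hdW : IsContraction ω (extD (contract W ω))) : contract (schouten K W) ω = 0 := by
  have hpart (t : ℤ) : contract (schouten (mvParityPart t K) W) ω = 0 := by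
    have hKt := hω.contract_mvParityPart_eq_zero t hKω
    rw [hω.contract_schouten_of_extD_eq_zero (hK.mvParityPart t) hW (hasParity_mvParityPart t K) hs
      (by rw [hKt, extD_zero]), hω.lieD_eq_zero hKt ⟨W, rfl⟩ hdW, smul_zero]
  rw [← mvParityPart_zero_add_mvParityPart_one K,
    schouten_add_left (hK.mvParityPart 0) (hK.mvParityPart 1), contract_add_left, hpart, hpart,
    add_zero]

theorem IsPreNPlectic.contract_schouten_eq_zero (hω : IsPreNPlectic n ω) (hK : SmoothMV K)
    (hKω : contract K ω = 0) (hW : SmoothMV W) (hWω : contract W ω = 0) :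
    contract (schouten K W) ω = 0 := by
  have hpart (t : ℤ) : contract (schouten (mvParityPart t K) W) ω = 0 :=
    hω.contract_schouten_eq_zero_of_right (hK.mvParityPart t) (hasParity_mvParityPart t K)
      (by rw [hω.contract_mvParityPart_eq_zero t hKω, extD_zero]) hW hWω
  rw [← mvParityPart_zero_add_mvParityPart_one K,
    schouten_add_left (hK.mvParityPart 0) (hK.mvParityPart 1), contract_add_left, hpart, hpart,
    add_zero]

theorem IsSemiHam.contract_schouten_of_hasParity (hω : IsPreNPlectic n ω) (hX : IsSemiHam ω X f)
    (hf : SmoothForm f) (ha : HasDeg n a f) (hXa : HasParity a X) (hY : IsHam ω Y g)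
    (hdg : IsContraction ω (extD g)) (hYs : HasParity s Y) :
    contract (schouten X Y) ω = -(sgn ((a - 1) * s) • lieD X g) := by
  have hdneg : IsContraction ω (extD (-g)) := by rw [extD_neg]; exact hdg.neg
  rw [hω.contract_schouten_of_extD_eq_zero hX.1 hY.1 hXa hYs (hX.extD_contract hf), hY.2,
    hX.lieD_eq hω ha hdneg, hX.lieD_eq hω ha hdg, contract_neg, extD_neg, extD_neg, contract_neg]
  module

theorem IsSemiHam.contract_schouten (hω : IsPreNPlectic n ω) (hX : IsSemiHam ω X f)
    (hf : SmoothForm f) (ha : HasDeg n a f) (hY : IsHam ω Y g) (hg : HomHam n ω b g) :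
    contract (schouten X Y) ω = -(sgn ((a - 1) * (b + 1)) • lieD X g) := by
  have hXa := hX.mvPart hω ha
  have hYb := hY.mvPart hω hg.deg
  have hK : SmoothMV (X - mvPart a X) := hX.1.sub hXa.1
  have hKω : contract (X - mvPart a X) ω = 0 := by
    rw [contract_sub_left, hX.2, hXa.2, sub_self]
  have hL : SmoothMV (Y - mvPart (b + 1) Y) := hY.1.sub hYb.1
  have hLω : contract (Y - mvPart (b + 1) Y) ω = 0 := by
    rw [contract_sub_left, hY.2, hYb.2, sub_self]
  have hdY : IsContraction ω (extD (contract (mvPart (b + 1) Y) ω)) := by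
    rw [hYb.2, extD_neg]
    exact hg.isContraction_extD.neg
  have hsplit : schouten X Y
      = (schouten (mvPart a X) (mvPart (b + 1) Y) + schouten (mvPart a X) (Y - mvPart (b + 1) Y))
        + (schouten (X - mvPart a X) (mvPart (b + 1) Y)
          + schouten (X - mvPart a X) (Y - mvPart (b + 1) Y)) := by
    rw [← schouten_add_right hYb.1 hL, ← schouten_add_right hYb.1 hL, add_sub_cancel,
      ← schouten_add_left hXa.1 hK, add_sub_cancel]
  rw [hsplit, contract_add_left, contract_add_left, contract_add_left,
    hXa.contract_schouten_of_hasParity hω hf ha (hasParity_mvPart a X) hYb hg.isContraction_extD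
      (hasParity_mvPart (b + 1) Y),
    hω.contract_schouten_eq_zero_of_right hXa.1 (hasParity_mvPart a X) (hXa.extD_contract hf) hL
      hLω,
    hω.contract_schouten_eq_zero_of_left hK hKω hYb.1 (hasParity_mvPart (b + 1) Y) hdY,
    hω.contract_schouten_eq_zero hK hKω hL hLω, add_zero, add_zero, add_zero,
    hω.lieD_congr (hXa.2.trans hX.2.symm) hg.isContraction hg.isContraction_extD]

end SchoutenContraction

/-! ### The brackets -/

section Brackets

variable {E : Type*} [NormedAddCommGroup E] [NormedSpace ℝ E] [FiniteDimensional ℝ E]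
  {M : Type*} [TopologicalSpace M] [ChartedSpace E M]
  {n : ℕ} {ω f f' g h : FormField E M} {X X' Y Y' Z : MVField E M} {a b c : ℤ}

theorem HomHam.add (hf : HomHam n ω a f) (hg : HomHam n ω a g) : HomHam n ω a (f + g) :=
  ⟨add_mem hf.mem hg.mem, hf.deg.add hg.deg⟩

theorem HomHam.smul (t : ℝ) (hf : HomHam n ω a f) : HomHam n ω a (t • f) :=
  ⟨(hamForms ω).smul_mem t hf.mem, hf.deg.smul t⟩

theorem HomHam.exists_isSemiHam (hf : HomHam n ω a f) : ∃ X, IsSemiHam ω X f := hf.mem.2.1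

theorem IsHam.mul (hY : IsHam ω Y g) (hX : SmoothMV X) :
    IsHam ω (Y * X) (contract X g) :=
  ⟨hY.1.mul hX, by rw [contract_mul, hY.2, contract_neg]⟩

theorem D₂formula_eq (hω : IsPreNPlectic n ω) (hX : IsSemiHam ω X f) (hY : IsSemiHam ω Y g)
    (hf : HomHam n ω a f) (hg : HomHam n ω b g) :
    D₂formula a b X Y f g = sgn a • extD (contract X g)
      + (sgn (a * b) * sgn b) • extD (contract Y f) - (2 : ℝ) • contract X (extD g) := by
  rw [D₂formula, hX.lieD_eq hω hf.deg hg.isContraction_extD,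
    hY.lieD_eq hω hg.deg hf.isContraction_extD, hY.contract_extD_comm hω hX hg.deg hf.deg,
    mul_comm b a]
  rcases sgn_eq_one_or_neg_one a with ha | ha <;>
  rcases sgn_eq_one_or_neg_one b with hb | hb <;>
  rcases sgn_eq_one_or_neg_one (a * b) with hab | hab <;>
  rw [ha, hb, hab] <;> module

theorem D₂formula_congr (hω : IsPreNPlectic n ω) (hX : IsSemiHam ω X f) (hY : IsSemiHam ω Y g)
    (hX' : IsSemiHam ω X' f) (hY' : IsSemiHam ω Y' g) (hf : HomHam n ω a f)
    (hg : HomHam n ω b g) : D₂formula a b X Y f g = D₂formula a b X' Y' f g := by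
  rw [D₂formula_eq hω hX hY hf hg, D₂formula_eq hω hX' hY' hf hg,
    hX.contract_congr hω hX' hg.isContraction, hY.contract_congr hω hY' hf.isContraction,
    hX.contract_congr hω hX' hg.isContraction_extD]

theorem D₂formula_zero_left (hω : IsPreNPlectic n ω) (hX : IsSemiHam ω X 0)
    (hg : HomHam n ω b g) : D₂formula a b X Y 0 g = 0 := by
  have hXω : contract X ω = 0 := by rw [hX.2, extD_zero, neg_zero]
  rw [D₂formula, hω.lieD_eq_zero hXω hg.isContraction hg.isContraction_extD, lieD_zero_right,
    smul_zero, smul_zero, add_zero]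

theorem D₂formula_zero_right (hω : IsPreNPlectic n ω) (hY : IsSemiHam ω Y 0)
    (hf : HomHam n ω a f) : D₂formula a b X Y f 0 = 0 := by
  have hYω : contract Y ω = 0 := by rw [hY.2, extD_zero, neg_zero]
  rw [D₂formula, hω.lieD_eq_zero hYω hf.isContraction hf.isContraction_extD, lieD_zero_right,
    smul_zero, smul_zero, add_zero]

theorem IsSemiHam.hasDeg_lieD (hω : IsPreNPlectic n ω) (hX : IsSemiHam ω X f)
    (hf : HasDeg n a f) (hg : HomHam n ω b g) : HasDeg n (a + b - 1) (lieD X g) := by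
  have hcontract_extD : HasDeg n (a + b - 1) (contract X (extD g)) := by
    rw [add_sub_assoc]
    exact hX.hasDeg_contract hω hf hg.deg.extD hg.isContraction_extD
  rw [hX.lieD_eq hω hf hg.isContraction_extD]
  exact (hX.hasDeg_contract hω hf hg.deg hg.isContraction).extD.sub (hcontract_extD.smul _)

theorem form_apply_eq_zero_of_finrank_lt (f : FormField E M) (x : M) {k : ℕ}
    (hk : Module.finrank ℝ E < k) : f x k = 0 := by
  ext v
  refine (f x k).toAlternatingMap.map_linearDependent v fun hv => ?_
  have hv' : LinearIndependent ℝ (M := E) v := hv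
  have hcard := hv'.fintype_card_le_finrank
  rw [Fintype.card_fin] at hcard
  lia

theorem HasDeg.exists_or_eq_zero (hf : HasDeg n a f) :
    (∃ k < Module.finrank ℝ E + 1, (n : ℤ) - (k : ℕ) = a) ∨ f = 0 := by
  by_cases h : ∃ k < Module.finrank ℝ E + 1, (n : ℤ) - (k : ℕ) = a
  · exact Or.inl h
  · refine Or.inr (funext fun x => funext fun k => ?_)
    by_cases hk : k < Module.finrank ℝ E + 1
    · exact hf x k fun h' => h ⟨k, hk, h'⟩
    · exact form_apply_eq_zero_of_finrank_lt f x (by lia)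

theorem D₂formula_component (hω : IsPreNPlectic n ω) (hX : IsSemiHam ω X f)
    (hY : IsSemiHam ω Y g) (hf : HomHam n ω a f) (hg : HomHam n ω b g) (k l : ℕ) :
    D₂formula (n - k) (n - l) (someSemiHam ω (component k f)) (someSemiHam ω (component l g))
        (component k f) (component l g)
      = if (n : ℤ) - k = a then if (n : ℤ) - l = b then D₂formula a b X Y f g else 0 else 0 := by
  split_ifs with hk hl
  · rw [component_eq_self hf.deg hk, component_eq_self hg.deg hl, hk, hl]
    exact D₂formula_congr hω (isSemiHam_someSemiHam hf.mem) (isSemiHam_someSemiHam hg.mem)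
      hX hY hf hg
  · rw [component_eq_zero hg.deg hl]
    exact D₂formula_zero_right hω (isSemiHam_someSemiHam (zero_mem _))
      (homHam_component hω k hf.mem)
  · rw [component_eq_zero hf.deg hk]
    exact D₂formula_zero_left hω (isSemiHam_someSemiHam (zero_mem _))
      (homHam_component hω l hg.mem)

theorem D₂_eq (hω : IsPreNPlectic n ω) (hX : IsSemiHam ω X f) (hY : IsSemiHam ω Y g)
    (hf : HomHam n ω a f) (hg : HomHam n ω b g) : D₂ n ω f g = D₂formula a b X Y f g := by
  simp only [D₂, D₂formula_component hω hX hY hf hg]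
  rcases hf.deg.exists_or_eq_zero with ⟨k, hk, hka⟩ | rfl
  · rcases hg.deg.exists_or_eq_zero with ⟨l, hl, hlb⟩ | rfl
    · rw [Finset.sum_eq_single_of_mem k (Finset.mem_range.2 hk) fun k' _ hne =>
          Finset.sum_eq_zero fun l' _ => if_neg (by lia),
        Finset.sum_eq_single_of_mem l (Finset.mem_range.2 hl) fun l' _ hne => by
          rw [if_pos hka, if_neg (by lia)], if_pos hka, if_pos hlb]
    · simp only [D₂formula_zero_right hω hY hf, ite_self, Finset.sum_const_zero]
  · simp only [D₂formula_zero_left hω hX hg, ite_self, Finset.sum_const_zero]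

theorem D₂_symm (hω : IsPreNPlectic n ω) (hf : HomHam n ω a f) (hg : HomHam n ω b g) :
    D₂ n ω f g = sgn (a * b) • D₂ n ω g f := by
  obtain ⟨X, hX⟩ := hf.exists_isSemiHam
  obtain ⟨Y, hY⟩ := hg.exists_isSemiHam
  rw [D₂_eq hω hX hY hf hg, D₂_eq hω hY hX hg hf, D₂formula, D₂formula, mul_comm b a]
  rcases sgn_eq_one_or_neg_one (a * b) with hab | hab <;> rw [hab] <;> module

/-- The form `i_{X_{D₂}(f, g)} h`, for a chosen semi-Hamiltonian multivector field of
`D₂(f, g)`; the bracket `D₃` is a signed sum of such contractions. -/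
def contractD₂ (n : ℕ) (ω f g h : FormField E M) : FormField E M :=
  contract (someSemiHam ω (D₂ n ω f g)) h

theorem contractD₂_smul_add_right (t : ℝ) (f g h h' : FormField E M) :
    contractD₂ n ω f g (t • h + h') = t • contractD₂ n ω f g h + contractD₂ n ω f g h' := by
  rw [contractD₂, contract_add, contract_smul, ← contractD₂, ← contractD₂]

variable [IsManifold 𝓘(ℝ, E) (⊤ : ℕ∞) M]

theorem IsSemiHam.isHam_lieD (hω : IsPreNPlectic n ω) (hX : IsSemiHam ω X f)
    (hf : HomHam n ω a f) (hY : IsHam ω Y g) (hg : HomHam n ω b g) :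
    IsHam ω (sgn ((a - 1) * (b + 1)) • schouten X Y) (lieD X g) := by
  refine ⟨(hX.1.schouten hY.1).smul _, ?_⟩
  rw [contract_smul_left, hX.contract_schouten hω hf.smooth hf.deg hY hg, smul_neg, smul_smul,
    sgn_mul_self, one_smul]

protected theorem IsSemiHam.contract (hω : IsPreNPlectic n ω) (hX : IsSemiHam ω X f)
    (hX' : IsSemiHam ω X' f) (hf : HomHam n ω a f) (hY : IsHam ω Y g) (hZ : IsSemiHam ω Z g)
    (hg : HomHam n ω b g) :
    IsSemiHam ω (sgn ((a - 1) * (b + 1)) • schouten X Y + sgn a • (Z * X')) (contract X g) := by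
  refine ⟨((hX.1.schouten hY.1).smul _).add ((hZ.1.mul hX'.1).smul _), ?_⟩
  rw [contract_add_left, (hX.isHam_lieD hω hf hY hg).2,
    hX.lieD_eq hω hf.deg hg.isContraction_extD, contract_smul_left, contract_mul, hZ.2,
    contract_neg, hX.contract_congr hω hX' hg.isContraction_extD]
  module

theorem IsSemiHam.homHam_contract (hω : IsPreNPlectic n ω) (hX : IsSemiHam ω X f)
    (hf : HomHam n ω a f) (hg : HomHam n ω b g) : HomHam n ω (a + b) (contract X g) := by
  obtain ⟨Z, hZ⟩ := hg.exists_isSemiHam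
  obtain ⟨Y, hY⟩ := hg.mem.2.2
  exact ⟨⟨hg.smooth.contract hX.1, ⟨_, hX.contract hω hX hf hY hZ hg⟩, _, hY.mul hX.1⟩,
    hX.hasDeg_contract hω hf.deg hg.deg hg.isContraction⟩

theorem IsSemiHam.smoothForm_lieD (hω : IsPreNPlectic n ω) (hX : IsSemiHam ω X f)
    (hf : HasDeg n a f) (hg : HomHam n ω b g) : SmoothForm (lieD X g) := by
  rw [hX.lieD_eq hω hf hg.isContraction_extD]
  exact (hg.smooth.contract hX.1).extD.sub ((hg.smooth.extD.contract hX.1).smul _)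

theorem extD_D₂formula (hω : IsPreNPlectic n ω) (hX : IsSemiHam ω X f) (hY : IsSemiHam ω Y g)
    (hf : HomHam n ω a f) (hg : HomHam n ω b g) :
    extD (D₂formula a b X Y f g) = (-2 : ℝ) • extD (contract X (extD g)) := by
  have hXg := hg.smooth.contract hX.1
  have hYf := hf.smooth.contract hY.1
  have hXdg := hg.smooth.extD.contract hX.1
  rw [D₂formula_eq hω hX hY hf hg,
    extD_sub ((hXg.extD.smul _).add (hYf.extD.smul _)) (hXdg.smul _),
    extD_add (hXg.extD.smul _) (hYf.extD.smul _), extD_smul, extD_smul, extD_smul,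
    extD_extD hXg, extD_extD hYf]
  module

theorem isSemiHam_D₂formula (hω : IsPreNPlectic n ω) (hX : IsSemiHam ω X f)
    (hY : IsSemiHam ω Y g) (hf : HomHam n ω a f) (hg : HomHam n ω b g) :
    IsSemiHam ω ((-2 * sgn a) • schouten Y X) (D₂formula a b X Y f g) := by
  have hddf : IsContraction ω (extD (extD f)) := hf.extD.isContraction_extD
  refine ⟨(hY.1.schouten hX.1).smul _, ?_⟩
  rw [extD_D₂formula hω hX hY hf hg, contract_smul_left,
    hY.contract_schouten hω hg.smooth hg.deg hX.isHam_extD hf.extD, hY.lieD_eq hω hg.deg hddf,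
    extD_extD hf.smooth, contract_zero, hX.contract_extD_comm hω hY hf.deg hg.deg, extD_smul,
    sub_add_cancel, sub_mul, one_mul, sgn_sub, mul_comm b a]
  rcases sgn_eq_one_or_neg_one a with ha | ha <;> rw [ha] <;> module

theorem homHam_D₂formula (hω : IsPreNPlectic n ω) (hX : IsSemiHam ω X f) (hY : IsSemiHam ω Y g)
    (hf : HomHam n ω a f) (hg : HomHam n ω b g) :
    HomHam n ω (a + b - 1) (D₂formula a b X Y f g) := by
  obtain ⟨V, hV⟩ := hf.mem.2.2
  obtain ⟨W, hW⟩ := hg.mem.2.2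
  have hdegYf : HasDeg n (a + b - 1) (lieD Y f) := by
    rw [add_comm a b]
    exact hY.hasDeg_lieD hω hg.deg hf
  exact ⟨⟨((hX.smoothForm_lieD hω hf.deg hg).smul _).add
      ((hY.smoothForm_lieD hω hg.deg hf).smul _),
    ⟨_, isSemiHam_D₂formula hω hX hY hf hg⟩,
    _, ((hX.isHam_lieD hω hf hW hg).smul _).add ((hY.isHam_lieD hω hg hV hf).smul _)⟩,
    ((hX.hasDeg_lieD hω hf.deg hg).smul _).add (hdegYf.smul _)⟩

theorem homHam_D₂ (hω : IsPreNPlectic n ω) (hf : HomHam n ω a f) (hg : HomHam n ω b g) :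
    HomHam n ω (a + b - 1) (D₂ n ω f g) := by
  obtain ⟨X, hX⟩ := hf.exists_isSemiHam
  obtain ⟨Y, hY⟩ := hg.exists_isSemiHam
  rw [D₂_eq hω hX hY hf hg]
  exact homHam_D₂formula hω hX hY hf hg

theorem isSemiHam_D₂ (hω : IsPreNPlectic n ω) (hX : IsSemiHam ω X f) (hY : IsSemiHam ω Y g)
    (hf : HomHam n ω a f) (hg : HomHam n ω b g) :
    IsSemiHam ω ((-2 * sgn a) • schouten Y X) (D₂ n ω f g) := by
  rw [D₂_eq hω hX hY hf hg]
  exact isSemiHam_D₂formula hω hX hY hf hg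

theorem extD_D₂ (hω : IsPreNPlectic n ω) (hX : IsSemiHam ω X f) (hf : HomHam n ω a f)
    (hg : HomHam n ω b g) : extD (D₂ n ω f g) = (-2 : ℝ) • extD (contract X (extD g)) := by
  obtain ⟨Y, hY⟩ := hg.exists_isSemiHam
  rw [D₂_eq hω hX hY hf hg, extD_D₂formula hω hX hY hf hg]

theorem D₂_smul_add_left (hω : IsPreNPlectic n ω) (t : ℝ) (hf : HomHam n ω a f)
    (hf' : HomHam n ω a f') (hg : HomHam n ω b g) :
    D₂ n ω (t • f + f') g = t • D₂ n ω f g + D₂ n ω f' g := by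
  obtain ⟨X, hX⟩ := hf.exists_isSemiHam
  obtain ⟨X', hX'⟩ := hf'.exists_isSemiHam
  obtain ⟨Y, hY⟩ := hg.exists_isSemiHam
  have hsum := (hX.smul t).add (hf.smooth.smul t) hf'.smooth hX'
  have hf'' := (hf.smul t).add hf'
  rw [D₂_eq hω hX hY hf hg, D₂_eq hω hX' hY hf' hg, D₂_eq hω hsum hY hf'' hg,
    D₂formula_eq hω hX hY hf hg, D₂formula_eq hω hX' hY hf' hg, D₂formula_eq hω hsum hY hf'' hg,
    contract_add_left, contract_smul_left, contract_add_left, contract_smul_left, contract_add,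
    contract_smul, extD_add ((hg.smooth.contract hX.1).smul t) (hg.smooth.contract hX'.1),
    extD_add ((hf.smooth.contract hY.1).smul t) (hf'.smooth.contract hY.1), extD_smul, extD_smul]
  module

theorem contractD₂_eq (hω : IsPreNPlectic n ω) (hf : HomHam n ω a f) (hg : HomHam n ω b g)
    (hh : IsContraction ω h) (hZ : IsSemiHam ω Z (D₂ n ω f g)) :
    contractD₂ n ω f g h = contract Z h :=
  (isSemiHam_someSemiHam (homHam_D₂ hω hf hg).mem).contract_congr hω hZ hh

theorem contractD₂_smul_add_left (hω : IsPreNPlectic n ω) (t : ℝ) (hf : HomHam n ω a f)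
    (hf' : HomHam n ω a f') (hg : HomHam n ω b g) (hh : IsContraction ω h) :
    contractD₂ n ω (t • f + f') g h = t • contractD₂ n ω f g h + contractD₂ n ω f' g h := by
  have hD := homHam_D₂ hω hf hg
  have hD' := homHam_D₂ hω hf' hg
  have hsum := ((isSemiHam_someSemiHam hD.mem).smul t).add (hD.smooth.smul t) hD'.smooth
    (isSemiHam_someSemiHam hD'.mem)
  rw [← D₂_smul_add_left hω t hf hf' hg] at hsum
  rw [contractD₂_eq hω ((hf.smul t).add hf') hg hh hsum, contract_add_left, contract_smul_left,
    contractD₂, contractD₂]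

theorem contractD₂_symm (hω : IsPreNPlectic n ω) (hf : HomHam n ω a f) (hg : HomHam n ω b g)
    (hh : IsContraction ω h) : contractD₂ n ω f g h = sgn (a * b) • contractD₂ n ω g f h := by
  have hZ := (isSemiHam_someSemiHam (homHam_D₂ hω hg hf).mem).smul (sgn (a * b))
  rw [← D₂_symm hω hf hg] at hZ
  rw [contractD₂_eq hω hf hg hh hZ, contract_smul_left, contractD₂]

theorem isHam_contractD₂ (hω : IsPreNPlectic n ω) (hf : HomHam n ω a f) (hg : HomHam n ω b g)
    (hY : IsHam ω Y h) (hZ : IsSemiHam ω Z (D₂ n ω f g)) :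
    IsHam ω (Y * Z) (contractD₂ n ω f g h) := by
  rw [contractD₂_eq hω hf hg hY.isContraction hZ]
  exact hY.mul hZ.1

theorem isSemiHam_contractD₂ (hω : IsPreNPlectic n ω) (hX : IsSemiHam ω X f)
    (hX' : IsSemiHam ω X' g) (hf : HomHam n ω a f) (hg : HomHam n ω b g) (hY : IsHam ω Y h)
    (hY' : IsSemiHam ω Y' h) (hh : HomHam n ω c h) (hZ : IsSemiHam ω Z (D₂ n ω f g)) :
    IsSemiHam ω ((-2 * (sgn (a * c) * sgn (b * c) * sgn b)) • schouten (schouten X' X) Y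
      - (sgn a * sgn b) • (Y' * Z)) (contractD₂ n ω f g h) := by
  have hD := isSemiHam_D₂ hω hX hX' hf hg
  have hsemi := hD.contract hω hZ (homHam_D₂ hω hf hg) hY hY' hh
  rw [schouten_smul_left (hX'.1.schouten hX.1),
    show (a + b - 1 - 1) * (c + 1) = a * c + b * c + a + b - (c + 1) - (c + 1) by ring] at hsemi
  simp only [sgn_sub, sgn_add, sgn_one] at hsemi
  rw [contractD₂_eq hω hf hg hY.isContraction hD]
  convert hsemi using 1
  rcases sgn_eq_one_or_neg_one a with ha | ha <;>
  rcases sgn_eq_one_or_neg_one c with hc | hc <;> rw [ha, hc] <;> module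

theorem homHam_contractD₂ (hω : IsPreNPlectic n ω) (hf : HomHam n ω a f) (hg : HomHam n ω b g)
    (hh : HomHam n ω c h) : HomHam n ω (a + b + c - 1) (contractD₂ n ω f g h) := by
  have hD := homHam_D₂ hω hf hg
  rw [show a + b + c - 1 = a + b - 1 + c by ring]
  exact (isSemiHam_someSemiHam hD.mem).homHam_contract hω hD hh

end Brackets

section Shuffles

theorem sum_shuffles_two_one {A : Type*} [AddCommMonoid A] (F : Equiv.Perm (Fin 3) → A) :
    ∑ s ∈ shuffles 2 1, F s = F 1 + F (Equiv.swap 1 2) + F (finRotate 3) := by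
  have h : shuffles 2 1 = {1, Equiv.swap 1 2, finRotate 3} := by decide
  rw [h, Finset.sum_insert (by decide), Finset.sum_insert (by decide), Finset.sum_singleton,
    add_assoc]

theorem sum_shuffles_one_two {A : Type*} [AddCommMonoid A] (F : Equiv.Perm (Fin 3) → A) :
    ∑ s ∈ shuffles 1 2, F s = F 1 + F (Equiv.swap 0 1) + F (finRotate 3).symm := by
  have h : shuffles 1 2 = {1, Equiv.swap 0 1, (finRotate 3).symm} := by decide
  rw [h, Finset.sum_insert (by decide), Finset.sum_insert (by decide), Finset.sum_singleton,
    add_assoc]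

theorem koszul_three (s : Equiv.Perm (Fin 3)) (a : Fin 3 → ℤ) :
    koszul s a = (if s 1 < s 0 then sgn (a (s 0) * a (s 1)) else 1)
      * (if s 2 < s 0 then sgn (a (s 0) * a (s 2)) else 1)
      * (if s 2 < s 1 then sgn (a (s 1) * a (s 2)) else 1) := by
  simp [koszul, Fin.prod_univ_three]

theorem koszul_one (a : Fin 3 → ℤ) : koszul 1 a = 1 := by
  rw [koszul_three, if_neg (by decide), if_neg (by decide), if_neg (by decide), one_mul, one_mul]

theorem koszul_swap_zero_one (a : Fin 3 → ℤ) : koszul (Equiv.swap 0 1) a = sgn (a 0 * a 1) := by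
  rw [koszul_three, if_pos (by decide), if_neg (by decide), if_neg (by decide), mul_one, mul_one,
    mul_comm (a 0)]
  rfl

theorem koszul_swap_one_two (a : Fin 3 → ℤ) : koszul (Equiv.swap 1 2) a = sgn (a 1 * a 2) := by
  rw [koszul_three, if_neg (by decide), if_neg (by decide), if_pos (by decide), one_mul, one_mul,
    mul_comm (a 1)]
  rfl

theorem koszul_swap_zero_two (a : Fin 3 → ℤ) :
    koszul (Equiv.swap 0 2) a = sgn (a 1 * a 2) * sgn (a 0 * a 2) * sgn (a 0 * a 1) := by
  rw [koszul_three, if_pos (by decide), if_pos (by decide), if_pos (by decide),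
    mul_comm (a 0), mul_comm (a 1), mul_comm (a 0)]
  rfl

theorem koszul_finRotate (a : Fin 3 → ℤ) :
    koszul (finRotate 3) a = sgn (a 0 * a 1) * sgn (a 0 * a 2) := by
  rw [koszul_three, if_neg (by decide), if_pos (by decide), if_pos (by decide), one_mul,
    mul_comm (a 0), mul_comm (a 0)]
  rfl

theorem koszul_finRotate_symm (a : Fin 3 → ℤ) :
    koszul (finRotate 3).symm a = sgn (a 0 * a 2) * sgn (a 1 * a 2) := by
  rw [koszul_three, if_pos (by decide), if_pos (by decide), if_neg (by decide), mul_one,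
    mul_comm (a 0), mul_comm (a 1)]
  rfl

theorem perm_fin_three (s : Equiv.Perm (Fin 3)) :
    s = 1 ∨ s = Equiv.swap 0 1 ∨ s = Equiv.swap 1 2 ∨ s = Equiv.swap 0 2 ∨ s = finRotate 3
      ∨ s = (finRotate 3).symm := by
  revert s; decide

end Shuffles

section TernaryBracket

variable {E : Type*} [NormedAddCommGroup E] [NormedSpace ℝ E]
  {M : Type*} [TopologicalSpace M] [ChartedSpace E M]
  {n : ℕ} {ω : FormField E M} {a : Fin 3 → ℤ} {f : Fin 3 → FormField E M}

theorem D₃formula_eq (a : Fin 3 → ℤ) (Z : Fin 3 → Fin 3 → MVField E M)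
    (f : Fin 3 → FormField E M) :
    D₃formula a Z f = (-(1 / 2) : ℝ) • ((sgn (a 0) * sgn (a 1)) • contract (Z 0 1) (f 2)
      + (sgn (a 1 * a 2) * sgn (a 0) * sgn (a 2)) • contract (Z 0 2) (f 1)
      + (sgn (a 0 * a 1) * sgn (a 0 * a 2) * sgn (a 1) * sgn (a 2)) • contract (Z 1 2) (f 0)) := by
  rw [D₃formula, sum_shuffles_two_one, koszul_one, koszul_swap_one_two, koszul_finRotate, one_mul]
  rfl

variable [FiniteDimensional ℝ E]

/-- The bracket `D₃` of homogeneous Hamiltonian forms of degrees `a 0`, `a 1`, `a 2`, with the sum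
over the shuffles written out. -/
def D₃hom (n : ℕ) (ω : FormField E M) (a : Fin 3 → ℤ) (f : Fin 3 → FormField E M) :
    FormField E M :=
  (-(1 / 2) : ℝ) • ((sgn (a 0) * sgn (a 1)) • contractD₂ n ω (f 0) (f 1) (f 2)
    + (sgn (a 1 * a 2) * sgn (a 0) * sgn (a 2)) • contractD₂ n ω (f 0) (f 2) (f 1)
    + (sgn (a 0 * a 1) * sgn (a 0 * a 2) * sgn (a 1) * sgn (a 2)) •
      contractD₂ n ω (f 1) (f 2) (f 0))

theorem D₃_eq_sum_D₃hom (f : Fin 3 → FormField E M) :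
    D₃ n ω f = ∑ k : Fin 3 → Fin (Module.finrank ℝ E + 1),
      D₃hom n ω (fun i => n - (k i : ℕ)) (fun i => component (k i) (f i)) :=
  Finset.sum_congr rfl fun _ _ => D₃formula_eq _ _ _

theorem forall_homHam_update (hf : ∀ i, HomHam n ω (a i) (f i)) {i : Fin 3}
    {g : FormField E M} (hg : HomHam n ω (a i) g) :
    ∀ j, HomHam n ω (a j) (Function.update f i g j) :=
  (Function.forall_update_iff f fun j x => HomHam n ω (a j) x).2 ⟨hg, fun j _ => hf j⟩

variable [IsManifold 𝓘(ℝ, E) (⊤ : ℕ∞) M]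

theorem D₃formula_eq_D₃hom (hω : IsPreNPlectic n ω) (hf : ∀ i, HomHam n ω (a i) (f i))
    {Z : Fin 3 → Fin 3 → MVField E M}
    (hZ : ∀ i j, i < j → IsSemiHam ω (Z i j) (D₂ n ω (f i) (f j))) :
    D₃formula a Z f = D₃hom n ω a f := by
  have hcontract (i j k : Fin 3) (hij : i < j) :
      contractD₂ n ω (f i) (f j) (f k) = contract (Z i j) (f k) :=
    contractD₂_eq hω (hf i) (hf j) (hf k).isContraction (hZ i j hij)
  rw [D₃formula_eq, D₃hom, hcontract 0 1 2 (by decide), hcontract 0 2 1 (by decide),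
    hcontract 1 2 0 (by decide)]

theorem homHam_D₃hom (hω : IsPreNPlectic n ω) (hf : ∀ i, HomHam n ω (a i) (f i)) :
    HomHam n ω (a 0 + a 1 + a 2 - 1) (D₃hom n ω a f) := by
  have h012 := homHam_contractD₂ hω (hf 0) (hf 1) (hf 2)
  have h021 := homHam_contractD₂ hω (hf 0) (hf 2) (hf 1)
  have h120 := homHam_contractD₂ hω (hf 1) (hf 2) (hf 0)
  rw [show a 0 + a 2 + a 1 - 1 = a 0 + a 1 + a 2 - 1 by ring] at h021
  rw [show a 1 + a 2 + a 0 - 1 = a 0 + a 1 + a 2 - 1 by ring] at h120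
  exact (((h012.smul _).add (h021.smul _)).add (h120.smul _)).smul _

theorem D₃hom_swap_zero_one (hω : IsPreNPlectic n ω) (hf : ∀ i, HomHam n ω (a i) (f i)) :
    D₃hom n ω a f
      = sgn (a 0 * a 1) • D₃hom n ω (a ∘ Equiv.swap 0 1) (f ∘ Equiv.swap 0 1) := by
  change _ = sgn (a 0 * a 1) • ((-(1 / 2) : ℝ) •
    ((sgn (a 1) * sgn (a 0)) • contractD₂ n ω (f 1) (f 0) (f 2)
      + (sgn (a 0 * a 2) * sgn (a 1) * sgn (a 2)) • contractD₂ n ω (f 1) (f 2) (f 0)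
      + (sgn (a 1 * a 0) * sgn (a 1 * a 2) * sgn (a 0) * sgn (a 2)) •
        contractD₂ n ω (f 0) (f 2) (f 1)))
  rw [D₃hom, contractD₂_symm hω (hf 0) (hf 1) (hf 2).isContraction, mul_comm (a 1) (a 0)]
  rcases sgn_eq_one_or_neg_one (a 0 * a 1) with h | h <;> rw [h] <;> module

theorem D₃hom_swap_one_two (hω : IsPreNPlectic n ω) (hf : ∀ i, HomHam n ω (a i) (f i)) :
    D₃hom n ω a f
      = sgn (a 1 * a 2) • D₃hom n ω (a ∘ Equiv.swap 1 2) (f ∘ Equiv.swap 1 2) := by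
  change _ = sgn (a 1 * a 2) • ((-(1 / 2) : ℝ) •
    ((sgn (a 0) * sgn (a 2)) • contractD₂ n ω (f 0) (f 2) (f 1)
      + (sgn (a 2 * a 1) * sgn (a 0) * sgn (a 1)) • contractD₂ n ω (f 0) (f 1) (f 2)
      + (sgn (a 0 * a 2) * sgn (a 0 * a 1) * sgn (a 2) * sgn (a 1)) •
        contractD₂ n ω (f 2) (f 1) (f 0)))
  rw [D₃hom, contractD₂_symm hω (hf 1) (hf 2) (hf 0).isContraction, mul_comm (a 2) (a 1)]
  rcases sgn_eq_one_or_neg_one (a 1 * a 2) with h | h <;> rw [h] <;> module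

theorem D₃hom_perm (hω : IsPreNPlectic n ω) (hf : ∀ i, HomHam n ω (a i) (f i))
    (s : Equiv.Perm (Fin 3)) : D₃hom n ω a f = koszul s a • D₃hom n ω (a ∘ s) (f ∘ s) := by
  have hcomp {a : Fin 3 → ℤ} {f : Fin 3 → FormField E M} (hf : ∀ i, HomHam n ω (a i) (f i))
      (s : Equiv.Perm (Fin 3)) (i : Fin 3) : HomHam n ω ((a ∘ s) i) ((f ∘ s) i) := hf (s i)
  have h₀₁ := hcomp hf (Equiv.swap 0 1)
  have h₁₂ := hcomp hf (Equiv.swap 1 2)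
  rcases perm_fin_three s with rfl | rfl | rfl | rfl | rfl | rfl
  · rw [koszul_one, one_smul]
    rfl
  · rw [koszul_swap_zero_one, D₃hom_swap_zero_one hω hf]
  · rw [koszul_swap_one_two, D₃hom_swap_one_two hω hf]
  · rw [koszul_swap_zero_two, D₃hom_swap_one_two hω hf, D₃hom_swap_zero_one hω h₁₂,
      D₃hom_swap_one_two hω (hcomp h₁₂ (Equiv.swap 0 1)), smul_smul, smul_smul]
    rfl
  · rw [koszul_finRotate, D₃hom_swap_zero_one hω hf, D₃hom_swap_one_two hω h₀₁, smul_smul]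
    rfl
  · rw [koszul_finRotate_symm, D₃hom_swap_one_two hω hf, D₃hom_swap_zero_one hω h₁₂, smul_smul,
      mul_comm (sgn (a 0 * a 2))]
    rfl

theorem D₃hom_update_zero (hω : IsPreNPlectic n ω) (hf : ∀ i, HomHam n ω (a i) (f i)) (t : ℝ)
    {g h : FormField E M} (hg : HomHam n ω (a 0) g) (hh : HomHam n ω (a 0) h) :
    D₃hom n ω a (Function.update f 0 (t • g + h))
      = t • D₃hom n ω a (Function.update f 0 g) + D₃hom n ω a (Function.update f 0 h) := by
  have hne₁ : (1 : Fin 3) ≠ 0 := by decide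
  have hne₂ : (2 : Fin 3) ≠ 0 := by decide
  simp only [D₃hom, Function.update_self, Function.update_of_ne hne₁, Function.update_of_ne hne₂]
  rw [contractD₂_smul_add_left hω t hg hh (hf 1) (hf 2).isContraction,
    contractD₂_smul_add_left hω t hg hh (hf 2) (hf 1).isContraction,
    contractD₂_smul_add_right]
  module

theorem D₃hom_update (hω : IsPreNPlectic n ω) (hf : ∀ i, HomHam n ω (a i) (f i)) (i : Fin 3)
    (t : ℝ) {g h : FormField E M} (hg : HomHam n ω (a i) g) (hh : HomHam n ω (a i) h) :
    D₃hom n ω a (Function.update f i (t • g + h))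
      = t • D₃hom n ω a (Function.update f i g) + D₃hom n ω a (Function.update f i h) := by
  have hmove {g : FormField E M} (hg : HomHam n ω (a i) g) :
      D₃hom n ω a (Function.update f i g) = koszul (Equiv.swap 0 i) a •
        D₃hom n ω (a ∘ Equiv.swap 0 i) (Function.update (f ∘ Equiv.swap 0 i) 0 g) := by
    rw [D₃hom_perm hω (forall_homHam_update hf hg) (Equiv.swap 0 i), Function.update_comp_equiv,
      Equiv.symm_swap, Equiv.swap_apply_right]
  have hcomp (j : Fin 3) : HomHam n ω ((a ∘ Equiv.swap 0 i) j) ((f ∘ Equiv.swap 0 i) j) := hf _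
  have hi : (a ∘ Equiv.swap 0 i) 0 = a i := congrArg a (Equiv.swap_apply_left 0 i)
  rw [hmove hg, hmove hh, hmove ((hg.smul t).add hh),
    D₃hom_update_zero hω hcomp t (hi ▸ hg) (hi ▸ hh), smul_add, smul_comm t]

theorem D₃hom_eq_zero (hω : IsPreNPlectic n ω) (hf : ∀ i, HomHam n ω (a i) (f i)) {i : Fin 3}
    (hi : f i = 0) : D₃hom n ω a f = 0 := by
  have hadd := D₃hom_update hω hf i 1 (hf i) (hf i)
  rwa [hi, smul_zero, add_zero, one_smul, ← hi, Function.update_eq_self, left_eq_add] at hadd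

theorem D₃hom_component (hω : IsPreNPlectic n ω) (hf : ∀ i, HomHam n ω (a i) (f i))
    (k : Fin 3 → ℕ) :
    D₃hom n ω (fun i => n - k i) (fun i => component (k i) (f i))
      = if ∀ i, (n : ℤ) - k i = a i then D₃hom n ω a f else 0 := by
  split_ifs with hk
  · rw [funext hk, funext fun i => component_eq_self (hf i).deg (hk i)]
  · obtain ⟨i, hi⟩ := not_forall.1 hk
    exact D₃hom_eq_zero hω (fun j => homHam_component hω _ (hf j).mem)
      (component_eq_zero (hf i).deg hi)

theorem D₃_eq (hω : IsPreNPlectic n ω) (hf : ∀ i, HomHam n ω (a i) (f i)) :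
    D₃ n ω f = D₃hom n ω a f := by
  simp only [D₃_eq_sum_D₃hom, D₃hom_component hω hf]
  by_cases hzero : ∃ i, f i = 0
  · obtain ⟨i, hi⟩ := hzero
    simp only [D₃hom_eq_zero hω hf hi, ite_self, Finset.sum_const_zero]
  · have hdeg (i : Fin 3) : ∃ k : Fin (Module.finrank ℝ E + 1), (n : ℤ) - (k : ℕ) = a i := by
      obtain ⟨k, hk, hka⟩ := (hf i).deg.exists_or_eq_zero.resolve_right fun hi => hzero ⟨i, hi⟩
      exact ⟨⟨k, hk⟩, hka⟩
    choose k hk using hdeg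
    rw [Finset.sum_eq_single_of_mem k (Finset.mem_univ k) fun k' _ hne => if_neg fun hk' =>
      hne (funext fun i => Fin.ext (by have := hk i; have := hk' i; lia)), if_pos hk]

theorem D₃_perm (hω : IsPreNPlectic n ω) (hf : ∀ i, HomHam n ω (a i) (f i))
    (s : Equiv.Perm (Fin 3)) : D₃ n ω f = koszul s a • D₃ n ω (fun i => f (s i)) := by
  rw [D₃_eq hω hf, D₃_eq hω fun i => hf (s i)]
  exact D₃hom_perm hω hf s

theorem D₃_mem_hamForms (hω : IsPreNPlectic n ω) (hf : ∀ i, f i ∈ hamForms ω) :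
    D₃ n ω f ∈ hamForms ω := by
  rw [D₃_eq_sum_D₃hom]
  exact sum_mem fun k _ => (homHam_D₃hom hω fun i => homHam_component hω _ (hf i)).mem

theorem D₃_update (hω : IsPreNPlectic n ω) (hf : ∀ i, f i ∈ hamForms ω) (i : Fin 3) (t : ℝ)
    {g h : FormField E M} (hg : g ∈ hamForms ω) (hh : h ∈ hamForms ω) :
    D₃ n ω (Function.update f i (t • g + h))
      = t • D₃ n ω (Function.update f i g) + D₃ n ω (Function.update f i h) := by
  have hcomponent (k : Fin 3 → Fin (Module.finrank ℝ E + 1)) (g : FormField E M) :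
      (fun j => component (k j) (Function.update f i g j))
        = Function.update (fun j => component (k j) (f j)) i (component (k i) g) :=
    funext fun j => Function.apply_update (fun j => component (k j)) f i g j
  simp only [D₃_eq_sum_D₃hom, hcomponent, component_add, component_smul, Finset.smul_sum,
    ← Finset.sum_add_distrib]
  exact Finset.sum_congr rfl fun k _ => D₃hom_update hω (fun j => homHam_component hω _ (hf j)) i t
    (homHam_component hω _ hg) (homHam_component hω _ hh)

end TernaryBracket

/-! ### The strong homotopy Jacobi equation -/

section Jacobi

/-- The linear algebra behind the strong homotopy Jacobi equation for forms `f 0`, `f 1`, `f 2`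
with associated semi-Hamiltonian fields `X 0`, `X 1`, `X 2`. Here `P i j k`, `T i j k`, `U i j k`
stand for `d i_{X i} d i_{X j} f k`, `d i_{X i} i_{X j} d f k`, `i_{X i} d i_{X j} d f k`, while
`R i j k`, `S i j k` stand for `d i_Z f k`, `i_Z d f k` with `Z` associated to `D₂(f i, f j)`, and
`B i j k` for `D₂(D₂(f i, f j), f k)`. -/
theorem jacobi_linear_algebra {A : Type*} [AddCommGroup A] [Module ℝ A] (a : Fin 3 → ℤ)
    (P T U R S B : Fin 3 → Fin 3 → Fin 3 → A)
    (hT_left : ∀ i j k, T i j k = sgn (a i * a j) • T j i k)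
    (hT_right : ∀ i j k, T i j k = sgn (a j * a k) • T i k j)
    (hR : ∀ i j k, R i j k = (-2 * sgn (a i)) • (-(sgn ((a j - 1) * a i) * sgn (a j)) • P j i k
      - P i j k + sgn (a j) • T i j k))
    (hS : ∀ i j k, S i j k = (-2 * sgn ((a i + a j - 1) * a k)) • U k i j)
    (hS_cartan : ∀ i j k, S i j k = (-2 * sgn (a i)) • (sgn ((a j - 1) * a i) •
      (T j i k - sgn (a j) • U j i k) - U i j k))
    (hB : ∀ i j k, B i j k = -(sgn (a i) * sgn (a j)) • R i j k - (2 : ℝ) • S i j k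
      + (sgn (a i * a k) * sgn (a j * a k)) • (sgn (a i) • P k i j
        + (sgn (a i * a j) * sgn (a j)) • P k j i - (2 : ℝ) • T k i j)) :
    (1 / 2 : ℝ) • ((sgn (a 0) * sgn (a 1)) • R 0 1 2
        + (sgn (a 1 * a 2) * sgn (a 0) * sgn (a 2)) • R 0 2 1
        + (sgn (a 0 * a 1) * sgn (a 0 * a 2) * sgn (a 1) * sgn (a 2)) • R 1 2 0)
      + ((1 / 2 * (sgn (a 0 * a 1) * sgn (a 0 * a 2))) • S 1 2 0
        + sgn (a 0 * a 1) • (1 / 2 * (sgn (a 1 * a 0) * sgn (a 1 * a 2))) • S 0 2 1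
        + (sgn (a 0 * a 2) * sgn (a 1 * a 2)) •
          (1 / 2 * (sgn (a 2 * a 0) * sgn (a 2 * a 1))) • S 0 1 2)
      + (B 0 1 2 + sgn (a 1 * a 2) • B 0 2 1 + (sgn (a 0 * a 1) * sgn (a 0 * a 2)) • B 1 2 0)
      = 0 := by
  have hT021 := hT_right 0 2 1
  have hT102 := hT_left 1 0 2
  have hT120 := hT_right 1 2 0
  have hT201 := hT_left 2 0 1
  -- After `R`, `S` and `B` are eliminated, what remains is a multiple of this one relation.
  have hU := (hS 0 1 2).symm.trans (hS_cartan 0 1 2)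
  simp only [hB, hR, hS]
  clear hT_left hT_right hR hS hS_cartan hB
  simp only [sub_mul, add_mul, one_mul, sgn_sub, sgn_add, mul_comm (a 1) (a 0),
    mul_comm (a 2) (a 0), mul_comm (a 2) (a 1)] at hT021 hT102 hT120 hT201 hU ⊢
  rw [hT201, hT120, hT102, hT021]
  rw [hT102] at hU
  rcases Int.even_or_odd (a 0) with h0 | h0 <;> rcases Int.even_or_odd (a 1) with h1 | h1 <;>
  rcases Int.even_or_odd (a 2) with h2 | h2 <;>
  simp only [h0, h1, h2, sgn_of_even, sgn_of_odd, Even.mul_right, Even.mul_left, Odd.mul]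
    at hU ⊢ <;>
  linear_combination (norm := module) (-(3 / 2) : ℝ) • hU

variable {E : Type*} [NormedAddCommGroup E] [NormedSpace ℝ E]
  {M : Type*} [TopologicalSpace M] [ChartedSpace E M]
  {n : ℕ} {ω f g h : FormField E M} {X Y W : MVField E M} {a b c : ℤ}

theorem HasParity.lieD_eq {r : ℤ} (hX : HasParity r X) (α : FormField E M) :
    lieD X α = extD (contract X α) - sgn r • contract X (extD α) := by
  rw [lieD, show (fun x => involute (X x)) = sgn r • X from funext hX, contract_smul_left]

variable [IsManifold 𝓘(ℝ, E) (⊤ : ℕ∞) M]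

theorem extD_D₁ (hf : SmoothForm f) : extD (D₁ f) = 0 := by
  rw [D₁, extD_neg, extD_extD hf, neg_zero]

variable [FiniteDimensional ℝ E]

protected theorem HomHam.D₁ (hf : HomHam n ω a f) : HomHam n ω (a - 1) (D₁ f) := hf.extD.neg

theorem contractD₂_D₁_left (hω : IsPreNPlectic n ω) (hf : HomHam n ω a f) (hg : HomHam n ω b g)
    (hh : IsContraction ω h) : contractD₂ n ω (D₁ f) g h = 0 := by
  have hzero : IsSemiHam ω (0 : MVField E M) (D₂ n ω (D₁ f) g) := by
    refine isSemiHam_zero_of_extD_eq_zero ?_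
    rw [extD_D₂ hω (isSemiHam_zero_of_extD_eq_zero (extD_D₁ hf.smooth)) hf.D₁ hg,
      contract_zero_left, extD_zero, smul_zero]
  rw [contractD₂_eq hω hf.D₁ hg hh hzero, contract_zero_left]

theorem D₃_D₁ (hω : IsPreNPlectic n ω) (hf : HomHam n ω a f) (hg : HomHam n ω b g)
    (hh : HomHam n ω c h) : D₃ n ω ![D₁ f, g, h]
      = (1 / 2 * (sgn (a * b) * sgn (a * c))) • contractD₂ n ω g h (extD f) := by
  have hfgh (i : Fin 3) : HomHam n ω (![a - 1, b, c] i) (![D₁ f, g, h] i) := by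
    fin_cases i
    exacts [hf.D₁, hg, hh]
  have hneg : contractD₂ n ω g h (D₁ f) = -contractD₂ n ω g h (extD f) := contract_neg _ _
  rw [D₃_eq hω hfgh]
  simp only [D₃hom, Matrix.cons_val, contractD₂_D₁_left hω hf hg hh.isContraction,
    contractD₂_D₁_left hω hf hh hg.isContraction, hneg, sub_mul, one_mul, sgn_sub]
  rcases sgn_eq_one_or_neg_one b with hb | hb <;>
  rcases sgn_eq_one_or_neg_one c with hc | hc <;>
  rw [hb, hc] <;> module

theorem D₂_D₂ (hω : IsPreNPlectic n ω) (hX : IsSemiHam ω X f) (hY : IsSemiHam ω Y g)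
    (hW : IsSemiHam ω W h) (hf : HomHam n ω a f) (hg : HomHam n ω b g) (hh : HomHam n ω c h) :
    D₂ n ω (D₂ n ω f g) h = -(sgn a * sgn b) • extD (contractD₂ n ω f g h)
      - (2 : ℝ) • contractD₂ n ω f g (extD h)
      + (sgn (a * c) * sgn (b * c)) • (sgn a • extD (contract W (extD (contract X g)))
        + (sgn (a * b) * sgn b) • extD (contract W (extD (contract Y f)))
        - (2 : ℝ) • extD (contract W (contract X (extD g)))) := by
  have hD := homHam_D₂ hω hf hg
  have hZ := isSemiHam_someSemiHam hD.mem
  have hWXg := (hg.smooth.contract hX.1).extD.contract hW.1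
  have hWYf := (hf.smooth.contract hY.1).extD.contract hW.1
  have hWXdg := (hg.smooth.extD.contract hX.1).contract hW.1
  have hWD : extD (contract W (D₂ n ω f g)) = sgn a • extD (contract W (extD (contract X g)))
        + (sgn (a * b) * sgn b) • extD (contract W (extD (contract Y f)))
        - (2 : ℝ) • extD (contract W (contract X (extD g))) := by
    rw [D₂_eq hω hX hY hf hg, D₂formula_eq hω hX hY hf hg, contract_sub, contract_add,
      contract_smul, contract_smul, contract_smul,
      extD_sub ((hWXg.smul _).add (hWYf.smul _)) (hWXdg.smul _),
      extD_add (hWXg.smul _) (hWYf.smul _), extD_smul, extD_smul, extD_smul]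
  rw [D₂_eq hω hZ hW hD hh, D₂formula_eq hω hZ hW hD hh, hWD, ← contractD₂, ← contractD₂,
    sub_mul, add_mul, one_mul, sgn_sub, sgn_sub, sgn_add, sgn_add, sgn_one]
  rcases sgn_eq_one_or_neg_one c with hc | hc <;> rw [hc] <;> module

theorem contractD₂_eq_cartan (hω : IsPreNPlectic n ω) (hX : IsSemiHam ω X f)
    (hY : IsSemiHam ω Y g) (hXa : HasParity a X) (hYb : HasParity b Y) (hf : HomHam n ω a f)
    (hg : HomHam n ω b g) (hh : HomHam n ω c h) :
    contractD₂ n ω f g h = (-2 * sgn a) • (sgn ((b - 1) * a) •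
        (extD (contract Y (contract X h)) - sgn b • contract Y (extD (contract X h)))
      - contract X (extD (contract Y h)) + sgn b • contract X (contract Y (extD h))) := by
  rw [contractD₂_eq hω hf hg hh.isContraction (isSemiHam_D₂ hω hX hY hf hg), contract_smul_left,
    contract_schouten hY.1 hX.1 hh.smooth hYb hXa, hYb.lieD_eq, hYb.lieD_eq, contract_sub,
    contract_smul]
  module

theorem extD_contractD₂ (hω : IsPreNPlectic n ω) (hX : IsSemiHam ω X f) (hY : IsSemiHam ω Y g)
    (hXa : HasParity a X) (hYb : HasParity b Y) (hf : HomHam n ω a f) (hg : HomHam n ω b g)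
    (hh : HomHam n ω c h) : extD (contractD₂ n ω f g h) = (-2 * sgn a) •
      (-(sgn ((b - 1) * a) * sgn b) • extD (contract Y (extD (contract X h)))
      - extD (contract X (extD (contract Y h)))
      + sgn b • extD (contract X (contract Y (extD h)))) := by
  have hYXh := (hh.smooth.contract hX.1).contract hY.1
  have hYdXh := (hh.smooth.contract hX.1).extD.contract hY.1
  have hXdYh := (hh.smooth.contract hY.1).extD.contract hX.1
  have hXYdh := (hh.smooth.extD.contract hY.1).contract hX.1
  rw [contractD₂_eq_cartan hω hX hY hXa hYb hf hg hh, extD_smul,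
    extD_add (((hYXh.extD.sub (hYdXh.smul _)).smul _).sub hXdYh) (hXYdh.smul _),
    extD_sub ((hYXh.extD.sub (hYdXh.smul _)).smul _) hXdYh, extD_smul,
    extD_sub hYXh.extD (hYdXh.smul _), extD_extD hYXh, extD_smul, extD_smul]
  module

theorem contractD₂_extD (hω : IsPreNPlectic n ω) (hX : IsSemiHam ω X f) (hW : IsSemiHam ω W h)
    (hf : HomHam n ω a f) (hg : HomHam n ω b g) (hh : HasDeg n c h) :
    contractD₂ n ω f g (extD h)
      = (-2 * sgn ((a + b - 1) * c)) • contract W (extD (contract X (extD g))) := by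
  have hD := homHam_D₂ hω hf hg
  rw [contractD₂, (isSemiHam_someSemiHam hD.mem).contract_extD_comm hω hW hD.deg hh,
    extD_D₂ hω hX hf hg, contract_smul]
  module

theorem contractD₂_extD_eq_cartan (hω : IsPreNPlectic n ω) (hX : IsSemiHam ω X f)
    (hY : IsSemiHam ω Y g) (hXa : HasParity a X) (hYb : HasParity b Y) (hf : HomHam n ω a f)
    (hg : HomHam n ω b g) (hh : HomHam n ω c h) :
    contractD₂ n ω f g (extD h) = (-2 * sgn a) • (sgn ((b - 1) * a) •
        (extD (contract Y (contract X (extD h))) - sgn b • contract Y (extD (contract X (extD h))))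
      - contract X (extD (contract Y (extD h)))) := by
  rw [contractD₂_eq_cartan hω hX hY hXa hYb hf hg hh.extD, extD_extD hh.smooth, contract_zero,
    contract_zero]
  module

theorem D₁_D₃hom (hω : IsPreNPlectic n ω) {a : Fin 3 → ℤ} {f : Fin 3 → FormField E M}
    (hf : ∀ i, HomHam n ω (a i) (f i)) : D₁ (D₃hom n ω a f) = (1 / 2 : ℝ) •
      ((sgn (a 0) * sgn (a 1)) • extD (contractD₂ n ω (f 0) (f 1) (f 2))
        + (sgn (a 1 * a 2) * sgn (a 0) * sgn (a 2)) • extD (contractD₂ n ω (f 0) (f 2) (f 1))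
        + (sgn (a 0 * a 1) * sgn (a 0 * a 2) * sgn (a 1) * sgn (a 2)) •
          extD (contractD₂ n ω (f 1) (f 2) (f 0))) := by
  have h012 := (homHam_contractD₂ hω (hf 0) (hf 1) (hf 2)).smooth
  have h021 := (homHam_contractD₂ hω (hf 0) (hf 2) (hf 1)).smooth
  have h120 := (homHam_contractD₂ hω (hf 1) (hf 2) (hf 0)).smooth
  rw [D₁, D₃hom, extD_smul, extD_add ((h012.smul _).add (h021.smul _)) (h120.smul _),
    extD_add (h012.smul _) (h021.smul _), extD_smul, extD_smul, extD_smul]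
  module

theorem strong_homotopy_jacobi (hω : IsPreNPlectic n ω) {a : Fin 3 → ℤ}
    {f : Fin 3 → FormField E M} (hf : ∀ i, HomHam n ω (a i) (f i)) :
    D₁ (D₃ n ω f)
      + ∑ s ∈ shuffles 1 2, koszul s a • D₃ n ω ![D₁ (f (s 0)), f (s 1), f (s 2)]
      + ∑ s ∈ shuffles 2 1, koszul s a • D₂ n ω (D₂ n ω (f (s 0)) (f (s 1))) (f (s 2)) = 0 := by
  let X (i : Fin 3) : MVField E M := mvPart (a i) (someSemiHam ω (f i))
  have hX (i : Fin 3) : IsSemiHam ω (X i) (f i) :=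
    (isSemiHam_someSemiHam (hf i).mem).mvPart hω (hf i).deg
  have hXa (i : Fin 3) : HasParity (a i) (X i) := hasParity_mvPart _ _
  have hjacobi := jacobi_linear_algebra a
    (fun i j k => extD (contract (X i) (extD (contract (X j) (f k)))))
    (fun i j k => extD (contract (X i) (contract (X j) (extD (f k)))))
    (fun i j k => contract (X i) (extD (contract (X j) (extD (f k)))))
    (fun i j k => extD (contractD₂ n ω (f i) (f j) (f k)))
    (fun i j k => contractD₂ n ω (f i) (f j) (extD (f k)))
    (fun i j k => D₂ n ω (D₂ n ω (f i) (f j)) (f k))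
    (fun i j k => by
      rw [(hX i).contract_contract_comm hω (hX j) (hf i).deg (hf j).deg (hf k).extD.isContraction,
        extD_smul])
    (fun i j k => by
      rw [(hX j).contract_extD_comm hω (hX k) (hf j).deg (hf k).deg, contract_smul, extD_smul])
    (fun i j k => extD_contractD₂ hω (hX i) (hX j) (hXa i) (hXa j) (hf i) (hf j) (hf k))
    (fun i j k => contractD₂_extD hω (hX i) (hX k) (hf i) (hf j) (hf k).deg)
    (fun i j k => contractD₂_extD_eq_cartan hω (hX i) (hX j) (hXa i) (hXa j) (hf i) (hf j) (hf k))
    (fun i j k => D₂_D₂ hω (hX i) (hX j) (hX k) (hf i) (hf j) (hf k))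
  rw [sum_shuffles_one_two, sum_shuffles_two_one, koszul_one, koszul_swap_zero_one,
    koszul_swap_one_two, koszul_finRotate, koszul_finRotate_symm, D₃_D₁ hω (hf _) (hf _) (hf _),
    D₃_D₁ hω (hf _) (hf _) (hf _), D₃_D₁ hω (hf _) (hf _) (hf _), D₃_eq hω hf,
    D₁_D₃hom hω hf, one_smul, one_smul]
  exact hjacobi

end Jacobi

section AssociatedFields

variable {E : Type*} [NormedAddCommGroup E] [NormedSpace ℝ E] [FiniteDimensional ℝ E]
  {M : Type*} [TopologicalSpace M] [ChartedSpace E M] {n : ℕ} {ω : FormField E M}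

theorem coe_update_hamForms {ι : Type*} [DecidableEq ι] (f : ι → hamForms ω) (i : ι)
    (x : hamForms ω) : (fun j => (Function.update f i x j : FormField E M))
      = Function.update (fun j => (f j : FormField E M)) i x :=
  funext fun j => Function.apply_update (fun _ (g : hamForms ω) => (g : FormField E M)) f i x j

variable [IsManifold 𝓘(ℝ, E) (⊤ : ℕ∞) M] {a : Fin 3 → ℤ} {f : Fin 3 → FormField E M}
  {X Y : Fin 3 → MVField E M} {Z : Fin 3 → Fin 3 → MVField E M}

theorem isHam_D₃ (hω : IsPreNPlectic n ω) (hf : ∀ i, HomHam n ω (a i) (f i))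
    (hY : ∀ i, IsHam ω (Y i) (f i))
    (hZ : ∀ i j, i < j → IsSemiHam ω (Z i j) (D₂ n ω (f i) (f j))) :
    IsHam ω
      ((-(1 / 2) : ℝ) • ∑ s ∈ shuffles 2 1,
        (koszul s a * sgn (a (s 0)) * sgn (a (s 1))) • (Y (s 2) * Z (s 0) (s 1)))
      (D₃ n ω f) := by
  have hterm (i j k : Fin 3) (hij : i < j) :
      IsHam ω (Y k * Z i j) (contractD₂ n ω (f i) (f j) (f k)) :=
    isHam_contractD₂ hω (hf i) (hf j) (hY k) (hZ i j hij)
  rw [sum_shuffles_two_one, koszul_one, koszul_swap_one_two, koszul_finRotate, one_mul,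
    D₃_eq hω hf]
  exact ((((hterm 0 1 2 (by decide)).smul _).add ((hterm 0 2 1 (by decide)).smul _)).add
    ((hterm 1 2 0 (by decide)).smul _)).smul _

theorem isSemiHam_D₃ (hω : IsPreNPlectic n ω) (hf : ∀ i, HomHam n ω (a i) (f i))
    (hX : ∀ i, IsSemiHam ω (X i) (f i)) (hY : ∀ i, IsHam ω (Y i) (f i))
    (hZ : ∀ i j, i < j → IsSemiHam ω (Z i j) (D₂ n ω (f i) (f j))) :
    IsSemiHam ω
      (∑ s ∈ shuffles 1 2, (koszul s a * sgn (a (s 1))) •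
          schouten (schouten (X (s 2)) (X (s 1))) (Y (s 0))
        + (1 / 2 : ℝ) • ∑ s ∈ shuffles 2 1, koszul s a • (X (s 2) * Z (s 0) (s 1)))
      (D₃ n ω f) := by
  have hterm (i j k : Fin 3) (hij : i < j) :=
    isSemiHam_contractD₂ hω (hX i) (hX j) (hf i) (hf j) (hY k) (hX k) (hf k) (hZ i j hij)
  have hsmooth (i j k : Fin 3) := (homHam_contractD₂ hω (hf i) (hf j) (hf k)).smooth
  have hsum := ((((hterm 0 1 2 (by decide)).smul (sgn (a 0) * sgn (a 1))).add
    ((hsmooth 0 1 2).smul _) ((hsmooth 0 2 1).smul _)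
    ((hterm 0 2 1 (by decide)).smul (sgn (a 1 * a 2) * sgn (a 0) * sgn (a 2)))).add
    (((hsmooth 0 1 2).smul _).add ((hsmooth 0 2 1).smul _)) ((hsmooth 1 2 0).smul _)
    ((hterm 1 2 0 (by decide)).smul
      (sgn (a 0 * a 1) * sgn (a 0 * a 2) * sgn (a 1) * sgn (a 2)))).smul (-(1 / 2) : ℝ)
  rw [← D₃hom, ← D₃_eq hω hf] at hsum
  convert hsum using 1
  rw [sum_shuffles_one_two, sum_shuffles_two_one, koszul_one, koszul_swap_zero_one,
    koszul_swap_one_two, koszul_finRotate, koszul_finRotate_symm, mul_comm (a 1) (a 0),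
    mul_comm (a 2) (a 0), mul_comm (a 2) (a 1)]
  change (1 * sgn (a 1)) • schouten (schouten (X 2) (X 1)) (Y 0)
      + (sgn (a 0 * a 1) * sgn (a 0)) • schouten (schouten (X 2) (X 0)) (Y 1)
      + (sgn (a 0 * a 2) * sgn (a 1 * a 2) * sgn (a 0)) • schouten (schouten (X 1) (X 0)) (Y 2)
    + (1 / 2 : ℝ) • ((1 : ℝ) • (X 2 * Z 0 1) + sgn (a 1 * a 2) • (X 1 * Z 0 2)
      + (sgn (a 0 * a 1) * sgn (a 0 * a 2)) • (X 0 * Z 1 2)) = _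
  rcases Int.even_or_odd (a 0) with h0 | h0 <;> rcases Int.even_or_odd (a 1) with h1 | h1 <;>
  rcases Int.even_or_odd (a 2) with h2 | h2 <;>
  simp only [h0, h1, h2, sgn_of_even, sgn_of_odd, Even.mul_right, Even.mul_left, Odd.mul] <;>
  module

/-- `D₃` as a trilinear operator on the space of Hamiltonian forms. -/
def D₃Multilinear (hω : IsPreNPlectic n ω) :
    MultilinearMap ℝ (fun _ : Fin 3 => hamForms ω) (hamForms ω) where
  toFun f := ⟨D₃ n ω fun i => (f i : FormField E M), D₃_mem_hamForms hω fun i => (f i).2⟩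
  map_update_add' f i x y := by
    have hadd := D₃_update hω (fun i => (f i).2) i 1 x.2 y.2
    rw [one_smul, one_smul] at hadd
    simp only [Subtype.ext_iff, coe_update_hamForms, Submodule.coe_add]
    convert hadd
  map_update_smul' f i c x := by
    have hsmul := D₃_update hω (fun i => (f i).2) i c x.2 (zero_mem _)
    have hzero :=
      D₃_update hω (fun i => (f i).2) i 1 (zero_mem (hamForms ω)) (zero_mem (hamForms ω))
    rw [one_smul, add_zero, one_smul] at hzero
    rw [left_eq_add.1 hzero, add_zero, add_zero] at hsmul
    simp only [Subtype.ext_iff, coe_update_hamForms, Submodule.coe_smul]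
    convert hsmul

end AssociatedFields

end

end NPlectic

theorem mainTheorem2_general {E : Type*} [NormedAddCommGroup E] [NormedSpace ℝ E]
    [FiniteDimensional ℝ E] {M : Type*} [TopologicalSpace M] [ChartedSpace E M]
    [IsManifold 𝓘(ℝ, E) (⊤ : ℕ∞) M]
    (n : ℕ) (ω : FormField E M) (hω : IsPreNPlectic n ω) :
    (∃ D : MultilinearMap ℝ (fun _ : Fin 3 => hamForms ω) (hamForms ω),
      ∀ f : Fin 3 → hamForms ω, (D f : FormField E M) = D₃ n ω (fun i => (f i : FormField E M))) ∧
    ∀ (a : Fin 3 → ℤ) (f : Fin 3 → FormField E M),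
      (∀ i, f i ∈ hamForms ω) → (∀ i, HasDeg n (a i) (f i)) →
      (∀ X : Fin 3 → MVField E M, (∀ i, IsSemiHam ω (X i) (f i)) → ∀ i j,
        D₂ n ω (f i) (f j) = D₂formula (a i) (a j) (X i) (X j) (f i) (f j) ∧
        D₂ n ω (f i) (f j) ∈ hamForms ω ∧
        IsSemiHam ω ((-2 * sgn (a i)) • schouten (X j) (X i)) (D₂ n ω (f i) (f j))) ∧
      (∀ Z : Fin 3 → Fin 3 → MVField E M,
        (∀ i j, i < j → IsSemiHam ω (Z i j) (D₂ n ω (f i) (f j))) →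
        D₃ n ω f = D₃formula a Z f) ∧
      (∀ s : Equiv.Perm (Fin 3), D₃ n ω f = koszul s a • D₃ n ω (fun i => f (s i))) ∧
      HasDeg n (a 0 + a 1 + a 2 - 1) (D₃ n ω f) ∧
      D₁ (D₃ n ω f)
        + ∑ s ∈ shuffles 1 2, koszul s a • D₃ n ω ![D₁ (f (s 0)), f (s 1), f (s 2)]
        + ∑ s ∈ shuffles 2 1, koszul s a • D₂ n ω (D₂ n ω (f (s 0)) (f (s 1))) (f (s 2)) = 0 ∧
      (∀ (Y : Fin 3 → MVField E M) (Z : Fin 3 → Fin 3 → MVField E M),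
        (∀ i, IsHam ω (Y i) (f i)) →
        (∀ i j, i < j → IsSemiHam ω (Z i j) (D₂ n ω (f i) (f j))) →
        IsHam ω
          ((-(1 / 2) : ℝ) • ∑ s ∈ shuffles 2 1,
            (koszul s a * sgn (a (s 0)) * sgn (a (s 1))) • (Y (s 2) * Z (s 0) (s 1)))
          (D₃ n ω f) ∧
        ∀ X : Fin 3 → MVField E M, (∀ i, IsSemiHam ω (X i) (f i)) →
          IsSemiHam ω
            (∑ s ∈ shuffles 1 2, (koszul s a * sgn (a (s 1))) •
                schouten (schouten (X (s 2)) (X (s 1))) (Y (s 0))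
              + (1 / 2 : ℝ) • ∑ s ∈ shuffles 2 1, koszul s a • (X (s 2) * Z (s 0) (s 1)))
            (D₃ n ω f)) := by
  refine ⟨⟨D₃Multilinear hω, fun _ => rfl⟩, fun a f hmem hdeg => ?_⟩
  have hf (i : Fin 3) : HomHam n ω (a i) (f i) := ⟨hmem i, hdeg i⟩
  refine ⟨fun X hX i j => ⟨D₂_eq hω (hX i) (hX j) (hf i) (hf j), (homHam_D₂ hω (hf i) (hf j)).mem,
    isSemiHam_D₂ hω (hX i) (hX j) (hf i) (hf j)⟩, fun Z hZ => ?independence, D₃_perm hω hf, ?degree,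
    strong_homotopy_jacobi hω hf, fun Y Z hY hZ =>
      ⟨isHam_D₃ hω hf hY hZ, fun X hX => isSemiHam_D₃ hω hf hX hY hZ⟩⟩
  case independence => rw [D₃_eq hω hf, D₃formula_eq_D₃hom hω hf hZ]
  case degree => exact D₃_eq hω hf ▸ (homHam_D₃hom hω hf).deg

theorem mainTheorem2 {E : Type*} [NormedAddCommGroup E] [NormedSpace ℝ E] [FiniteDimensional ℝ E]
    {M : Type*} [TopologicalSpace M] [ChartedSpace E M] [IsManifold 𝓘(ℝ, E) (⊤ : ℕ∞) M]
    (n : ℕ) (ω : FormField E M) (hω : IsNPlectic n ω) :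
    -- `D₃` is a trilinear operator `H(M) × H(M) × H(M) → H(M)`
    (∃ D : MultilinearMap ℝ (fun _ : Fin 3 => hamForms ω) (hamForms ω),
      ∀ f : Fin 3 → hamForms ω, (D f : FormField E M) = D₃ n ω (fun i => (f i : FormField E M))) ∧
    -- for homogeneous Hamiltonian forms `f 0, f 1, f 2` of symmetric degrees `a 0, a 1, a 2`:
    ∀ (a : Fin 3 → ℤ) (f : Fin 3 → FormField E M),
      (∀ i, f i ∈ hamForms ω) → (∀ i, HasDeg n (a i) (f i)) →
      -- the forms `D₂(fᵢ, fⱼ)` that enter `D₃` are well defined Hamiltonian forms, with the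
      -- associated semi-Hamiltonian multivector fields `-2 e(fᵢ) [Xⱼ, Xᵢ]`
      (∀ X : Fin 3 → MVField E M, (∀ i, IsSemiHam ω (X i) (f i)) → ∀ i j,
        D₂ n ω (f i) (f j) = D₂formula (a i) (a j) (X i) (X j) (f i) (f j) ∧
        D₂ n ω (f i) (f j) ∈ hamForms ω ∧
        IsSemiHam ω ((-2 * sgn (a i)) • schouten (X j) (X i)) (D₂ n ω (f i) (f j))) ∧
      -- `D₃` does not depend on the choice of the fields `X_{D₂}(fᵢ, fⱼ)`
      (∀ Z : Fin 3 → Fin 3 → MVField E M,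
        (∀ i j, i < j → IsSemiHam ω (Z i j) (D₂ n ω (f i) (f j))) →
        D₃ n ω f = D₃formula a Z f) ∧
      -- graded symmetry
      (∀ s : Equiv.Perm (Fin 3), D₃ n ω f = koszul s a • D₃ n ω (fun i => f (s i))) ∧
      -- homogeneity of degree `-1`
      HasDeg n (a 0 + a 1 + a 2 - 1) (D₃ n ω f) ∧
      -- the strong homotopy Jacobi equation in dimension three
      D₁ (D₃ n ω f)
        + ∑ s ∈ shuffles 1 2, koszul s a • D₃ n ω ![D₁ (f (s 0)), f (s 1), f (s 2)]
        + ∑ s ∈ shuffles 2 1, koszul s a • D₂ n ω (D₂ n ω (f (s 0)) (f (s 1))) (f (s 2)) = 0 ∧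
      -- associated multivector fields, for all choices of the fields associated to `fᵢ` and to
      -- `D₂(fᵢ, fⱼ)`
      (∀ (Y : Fin 3 → MVField E M) (Z : Fin 3 → Fin 3 → MVField E M),
        (∀ i, IsHam ω (Y i) (f i)) →
        (∀ i j, i < j → IsSemiHam ω (Z i j) (D₂ n ω (f i) (f j))) →
        IsHam ω
          ((-(1 / 2) : ℝ) • ∑ s ∈ shuffles 2 1,
            (koszul s a * sgn (a (s 0)) * sgn (a (s 1))) • (Y (s 2) * Z (s 0) (s 1)))
          (D₃ n ω f) ∧
        ∀ X : Fin 3 → MVField E M, (∀ i, IsSemiHam ω (X i) (f i)) →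
          IsSemiHam ω
            (∑ s ∈ shuffles 1 2, (koszul s a * sgn (a (s 1))) •
                schouten (schouten (X (s 2)) (X (s 1))) (Y (s 0))
              + (1 / 2 : ℝ) • ∑ s ∈ shuffles 2 1, koszul s a • (X (s 2) * Z (s 0) (s 1)))
            (D₃ n ω f)) :=
  mainTheorem2_general n ω hω.isPreNPlectic
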